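/- Let $n\ge 1$ and $f\in C^1(\mathbb R)$ with $f(0)=0$, and suppose that there are $A>0$ and $1<p<1+\frac4n$ with $|f(a)-f(b)|\le A(|a|^{p-1}+|b|^{p-1})|a-b|$ for all $a,b\in\mathbb R$. For $L,r>0$ let $\mathcal O(L,r)$ be the family of open sets $\omega\subset\mathbb R^n$ for which there is a sequence of pairwise disjoint open cubes $I_j$ ($j\in\mathbb N^+$) of side length $L$ with $\overline{\bigcup_j I_j}=\mathbb R^n$, and points $x_j\in I_j$ with $B_r(x_j)\subset I_j\cap\omega$ for all $j$. For $T>0$ and $y^0\in L^2(\mathbb R^n)$, a solution on $[0,T]$ with initial value $y^0$ is a function $y\in C([0,T];L^2(\mathbb R^n))\cap L^\infty_{loc}((0,T);L^\infty(\mathbb R^n))$ with $y(\cdot,0)=y^0$ that solves $\partial_t y-\Delta y+f(y)=0$ in $\mathbb R^n\times(0,T)$ in the mild sense: $y(t)=e^{(t-s)\Delta}y(s)-\int_s^t e^{(t-\tau)\Delta}f(y(\tau))\,d\tau$ for all $0<s<t<T$. Then there are $\beta=\beta(n,L,r)\in(0,1)$, not depending on $f$, and, for every $K\ge0$, a time $T^*=T^*(n,f,K)>0$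 such that the following holds for all $L,r>0$, $\omega\in\mathcal O(L,r)$, $T>0$ and all solutions $y_1,y_2$ on $[0,T]$ with initial values $y_1^0,y_2^0\in L^2(\mathbb R^n)$. (i) If $\|y_i^0\|_{L^2(\mathbb R^n)}\le K$ ($i=1,2$) and $T\le T^*(n,f,K)$, then $$\int_{\mathbb R^n}|y_1-y_2|^2(x,T)\,dx\le C\Big(\int_\omega|y_1-y_2|^2(x,T)\,dx\Big)^{\beta}$$ with a positive constant $C=C(n,f,L,r,K,T)$. (ii) For $T>0$ of any size, the same inequality holds, with the same $\beta$ and a positive constant $C'=C'(n,f,L,r,K,T)$, whenever $\|y_i(\cdot,t)\|_{L^2(\mathbb R^n)}\le K$ for all $t\in[0,T]$ and $i=1,2$. (iii) For $T>0$ of any size, if $y_1(\cdot,T)=y_2(\cdot,T)$ almost everywhere in $\omega$, then $y_1=y_2$ in $\mathbb R^n\times[0,T]$. -/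

import Mathlib

open MeasureTheory

noncomputable section

namespace SemilinearHeat

/-- `ℝⁿ` with its Euclidean norm. -/
abbrev Rn (n : ℕ) : Type := EuclideanSpace ℝ (Fin n)

/-- The Hilbert space `L²(ℝⁿ)`. -/
abbrev L2 (n : ℕ) : Type := Lp ℝ 2 (volume : Measure (Rn n))

/-- `I` is an open cube of side length `L` in `ℝⁿ`, in an arbitrary position: it has a centre `c`
and edges parallel to the vectors of some orthonormal basis `b`. -/
def IsOpenCube {n : ℕ} (L : ℝ) (I : Set (Rn n)) : Prop :=
  ∃ (c : Rn n) (b : OrthonormalBasis (Fin n) ℝ (Rn n)),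
    I = {x | ∀ i, |inner ℝ (b i) (x - c)| < L / 2}

/-- The condition on the observation region: `ω` is open, and `ℝⁿ` is tiled (up to a set with
empty interior) by a sequence of pairwise disjoint open cubes of side length `L`, each of which
contains a ball of radius `r` that lies in `ω`. -/
structure IsObservationRegion {n : ℕ} (ω : Set (Rn n)) (L r : ℝ) : Prop where
  isOpen : IsOpen ω
  side_pos : 0 < L
  radius_pos : 0 < r
  exists_cubes : ∃ I : ℕ → Set (Rn n),
    (∀ j, IsOpenCube L (I j)) ∧
    (∀ j k, j ≠ k → I j ∩ I k = ∅) ∧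
    closure (⋃ j, I j) = Set.univ ∧
    ∀ j, ∃ x ∈ I j, Metric.ball x r ⊆ I j ∩ ω

/-- The condition on the nonlinearity: `f` is `C¹`, `f 0 = 0`, and `f` has power-type Lipschitz
growth with exponent `p > 1`. -/
structure IsPowerNonlinearity (f : ℝ → ℝ) (p : ℝ) : Prop where
  contDiff : ContDiff ℝ 1 f
  map_zero : f 0 = 0
  one_lt : 1 < p
  growth : ∃ A : ℝ, 0 < A ∧ ∀ a b : ℝ,
    |f a - f b| ≤ A * (|a| ^ (p - 1) + |b| ^ (p - 1)) * |a - b|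

/-- The heat kernel `(4πt)^{-n/2} exp(-|z|²/(4t))`, for `t > 0`. -/
def heatKernel {n : ℕ} (t : ℝ) (z : Rn n) : ℝ :=
  (4 * Real.pi * t) ^ (-(n : ℝ) / 2) * Real.exp (-‖z‖ ^ 2 / (4 * t))

/-- `y ∈ C([0,T]; L²(ℝⁿ)) ∩ L^∞_loc((0,T); L^∞(ℝⁿ))` is a (mild) solution of
`∂ₜy - Δy + f(y) = 0` on `[0,T]` with `y(0) = y₀`.

Since `y` is continuous into `L²`, an essential bound in `t` on `‖y(t)‖_∞` over `[a,b]` is the same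
as a bound for every `t ∈ [a,b]`. The equation is Duhamel's formula between any two times
`0 < s < t < T`, where `f(y)` is bounded in `L² ∩ L^∞`, so that all integrals converge; it is
implied by Duhamel's formula from the initial time `0`. The values at `0` and `T` are fixed by
continuity. -/
structure IsSolution {n : ℕ} (f : ℝ → ℝ) (T : ℝ) (y₀ : L2 n) (y : ℝ → L2 n) : Prop where
  continuousOn : ContinuousOn y (Set.Icc 0 T)
  initial : y 0 = y₀
  locallyBounded : ∀ a b : ℝ, 0 < a → b < T →
    ∃ M : ℝ, ∀ t ∈ Set.Icc a b, ∀ᵐ x, |y t x| ≤ M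
  duhamel : ∀ s t : ℝ, 0 < s → s < t → t < T → ∀ᵐ x,
    y t x = (∫ z, heatKernel (t - s) (x - z) * y s z)
      - ∫ τ in s..t, ∫ z, heatKernel (t - τ) (x - z) * f (y τ z)

end SemilinearHeat

end

/-!
The potential `(f(y₁) - f(y₂)) / (y₁ - y₂)` of the equation for the difference of two solutions is
bounded after a smoothing time, so the difference is an almost-orbit of the heat semigroup
(`IsDominated`). Rescaled parabolically around a point and multiplied by a Gaussian, it becomes an
almost-orbit of the Mehler semigroup, a semigroup of symmetric contractions. The Rayleigh quotient
along such an orbit almost decreases, which bounds the mass away from the centre and yields a local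
interpolation estimate; this is summed over the cubes. The same monotonicity for the heat semigroup
gives backward uniqueness.
-/

noncomputable section

namespace SemilinearHeat

open Set Filter Topology

/-! ### The heat kernel -/

/-! The exponent is `β = 1/2`. The difference `u = y₁ - y₂` solves a heat equation whose potential
is bounded by some `M` wherever both solutions are bounded in `L^∞`. All that is kept of that
equation is the pointwise inequality `IsDominated`, obtained in `IsDuhamel.dominated` from Duhamel's
formula and a scalar Gronwall inequality, so no derivative of `u` is ever needed.

The `L^∞` bound comes from `exists_smoothing`. The heat flow takes `L²` into `L^∞` with norm of
order `t^{-n/4}`, and `p < 1 + 4/n` makes the power `p - 1` of this integrable at `t = 0`. So for a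
short time that depends on `f`, `n` and the size of the data only, solutions decay like solutions of
the heat equation and their `L²` norm grows by a factor of at most `3/2`. This provides `T*`; a
bound on the `L²` norm allows restarts at any later time.

Around a point `x₀`, and with a parameter `l > 0`, the weight `exp(-|x - x₀|² / (4(b - t + l)))` is
used on the time interval `[a, b]`. In self-similar variables `u` becomes an almost-orbit of
`e^{-sH}` with `H = -2Δ + |ξ|²/8 - n/2`. Along an exact orbit the Rayleigh quotient of `H`
decreases, so its final value is controlled by the mean decay rate of the logarithm of the norm.
`IsSymmContraction.mul_rayleigh_le` is a discrete version: the error of a step enters the Rayleigh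
quotient quadratically, so `m` steps with errors of order `1/m` add up to `O(1/m)`, which is
harmless after division by the step length. Since `H ≥ |ξ|²/8 - n/2`, a bound on the quotient is a
bound on the mass far from the centre (`IsDominated.concentration`). For `l` small, at least half of
the weighted mass lies in the ball of radius `r`; optimising `l` gives `IsDominated.local_estimate`.

Around separated centres the Gaussian weights have a bounded sum, so the local estimates add up to
`IsDominated.global_estimate`. If the difference vanishes on `ω` at time `T`, this estimate makes it
vanish everywhere at that time; the Rayleigh quotient of the heat semigroup, which stays small along
a nonzero almost-orbit, then excludes extinction in finite time (`IsDominated.backward_uniqueness`).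
-/

theorem heatKernel_pos {n : ℕ} {t : ℝ} (ht : 0 < t) (z : Rn n) : 0 < heatKernel t z := by
  unfold heatKernel
  positivity

theorem heatKernel_neg {n : ℕ} (t : ℝ) (z : Rn n) : heatKernel t (-z) = heatKernel t z := by
  simp [heatKernel]

theorem heatKernel_sub_comm {n : ℕ} (t : ℝ) (x z : Rn n) :
    heatKernel t (x - z) = heatKernel t (z - x) := by
  rw [← heatKernel_neg, neg_sub]

theorem continuous_heatKernel {n : ℕ} (t : ℝ) : Continuous (heatKernel t : Rn n → ℝ) := by
  unfold heatKernel
  fun_prop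

theorem continuousOn_heatKernel_uncurry {n : ℕ} :
    ContinuousOn (fun q : ℝ × Rn n => heatKernel q.1 q.2) (Ioi 0 ×ˢ univ) := by
  unfold heatKernel
  refine ContinuousOn.mul ?_ ?_
  · refine ContinuousOn.rpow_const (by fun_prop) ?_
    rintro ⟨t, z⟩ ⟨ht, -⟩
    left
    have : 0 < t := ht
    positivity
  · refine Real.continuous_exp.comp_continuousOn (ContinuousOn.div (by fun_prop) (by fun_prop) ?_)
    rintro ⟨t, z⟩ ⟨ht, -⟩
    have : 0 < t := ht
    positivity

theorem exp_neg_sq_div_eq {n : ℕ} (t : ℝ) (z : Rn n) :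
    Real.exp (-‖z‖ ^ 2 / (4 * t)) = Real.exp (-(1 / (4 * t)) * ‖z‖ ^ 2) := by
  congr 1
  ring

theorem integral_heatKernel {n : ℕ} {t : ℝ} (ht : 0 < t) :
    ∫ z : Rn n, heatKernel t z = 1 := by
  unfold heatKernel
  simp_rw [exp_neg_sq_div_eq]
  rw [integral_const_mul, GaussianFourier.integral_rexp_neg_mul_sq_norm (by positivity),
    finrank_euclideanSpace_fin, div_div_eq_mul_div, div_one,
    show Real.pi * (4 * t) = 4 * Real.pi * t by ring, ← Real.rpow_add (by positivity)]
  rw [show -(n : ℝ) / 2 + n / 2 = 0 by ring, Real.rpow_zero]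

theorem integrable_heatKernel {n : ℕ} {t : ℝ} (ht : 0 < t) :
    Integrable (heatKernel t : Rn n → ℝ) :=
  .of_integral_ne_zero (by rw [integral_heatKernel ht]; exact one_ne_zero)

theorem integrable_heatKernel_sub {n : ℕ} {t : ℝ} (ht : 0 < t) (x : Rn n) :
    Integrable (fun z => heatKernel t (x - z)) :=
  (integrable_heatKernel ht).comp_sub_left x

theorem integral_heatKernel_sub {n : ℕ} {t : ℝ} (ht : 0 < t) (x : Rn n) :
    ∫ z, heatKernel t (x - z) = 1 := by
  rw [integral_sub_left_eq_self (fun z => heatKernel t z) volume x, integral_heatKernel ht]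

/-- The product of two heat kernels, by completing the square. -/
theorem heatKernel_mul_heatKernel {n : ℕ} {s t : ℝ} (hs : 0 < s) (ht : 0 < t) (x y z : Rn n) :
    heatKernel s (x - z) * heatKernel t (z - y) =
      heatKernel (s + t) (x - y) *
        heatKernel (s * t / (s + t)) ((t / (s + t)) • x + (s / (s + t)) • y - z) := by
  have hst : s + t ≠ 0 := by positivity
  have key : ‖(t / (s + t)) • x + (s / (s + t)) • y - z‖ ^ 2 =
      (t ^ 2 * ‖x - z‖ ^ 2 - 2 * s * t * inner ℝ (x - z) (z - y) + s ^ 2 * ‖z - y‖ ^ 2) /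
        (s + t) ^ 2 := by
    have : (t / (s + t)) • x + (s / (s + t)) • y - z =
        (s + t)⁻¹ • (t • (x - z) - s • (z - y)) := by
      have hz : z = (s + t)⁻¹ • ((s + t) • z) := by rw [smul_smul, inv_mul_cancel₀ hst, one_smul]
      nth_rewrite 1 [hz]
      simp only [smul_sub, smul_add, smul_smul, add_smul, div_eq_inv_mul]
      module
    rw [this, norm_smul, mul_pow, norm_sub_sq_real, norm_smul, norm_smul, inner_smul_left,
      inner_smul_right]
    simp only [norm_inv, Real.norm_eq_abs, inv_pow, sq_abs, mul_pow]
    simp only [conj_trivial]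
    field_simp
  have key2 : ‖x - y‖ ^ 2 = ‖x - z‖ ^ 2 + 2 * inner ℝ (x - z) (z - y) + ‖z - y‖ ^ 2 := by
    rw [← norm_add_sq_real]
    congr 2
    abel
  unfold heatKernel
  rw [key, key2, mul_mul_mul_comm, ← Real.exp_add, mul_mul_mul_comm, ← Real.exp_add,
    ← Real.mul_rpow (by positivity) (by positivity),
    ← Real.mul_rpow (by positivity) (by positivity)]
  congr 2
  · field_simp
  · field_simp
    ring

theorem integrable_heatKernel_mul_heatKernel {n : ℕ} {s t : ℝ} (hs : 0 < s) (ht : 0 < t)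
    (x y : Rn n) : Integrable (fun z => heatKernel s (x - z) * heatKernel t (z - y)) := by
  simp_rw [heatKernel_mul_heatKernel hs ht]
  exact (integrable_heatKernel_sub (by positivity) _).const_mul _

/-- The Chapman–Kolmogorov identity. -/
theorem integral_heatKernel_mul_heatKernel {n : ℕ} {s t : ℝ} (hs : 0 < s) (ht : 0 < t)
    (x y : Rn n) :
    ∫ z, heatKernel s (x - z) * heatKernel t (z - y) = heatKernel (s + t) (x - y) := by
  simp_rw [heatKernel_mul_heatKernel hs ht]
  rw [integral_const_mul, integral_heatKernel_sub (by positivity), mul_one]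

theorem memLp_heatKernel_sub {n : ℕ} {t : ℝ} (ht : 0 < t) (x : Rn n) :
    MemLp (fun z => heatKernel t (x - z)) 2 := by
  refine (memLp_two_iff_integrable_sq ?_).2 ?_
  · exact ((continuous_heatKernel t).comp (continuous_const.sub continuous_id)).aestronglyMeasurable
  · refine (integrable_heatKernel_mul_heatKernel ht ht x x).congr (.of_forall fun z => ?_)
    simp only [sq, heatKernel_sub_comm t z x]

/-- The heat kernel `z ↦ heatKernel t (x - z)` as an element of `L²`, for `t > 0`. -/
def kernelLp {n : ℕ} (t : ℝ) (x : Rn n) : L2 n :=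
  if ht : 0 < t then (memLp_heatKernel_sub ht x).toLp _ else 0

theorem kernelLp_ae {n : ℕ} {t : ℝ} (ht : 0 < t) (x : Rn n) :
    kernelLp t x =ᵐ[volume] fun z => heatKernel t (x - z) := by
  rw [kernelLp, dif_pos ht]
  exact MemLp.coeFn_toLp _

theorem L2.inner_eq {n : ℕ} (v w : L2 n) : inner ℝ v w = ∫ z, v z * w z := by
  rw [L2.inner_def]
  exact integral_congr_ae (.of_forall fun z => by simp [mul_comm])

theorem L2.integrable_mul {n : ℕ} (v w : L2 n) : Integrable (fun z => v z * w z) := by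
  refine (L2.integrable_inner (𝕜 := ℝ) v w).congr (.of_forall fun z => by simp [mul_comm])

theorem L2.norm_sq_eq {n : ℕ} (v : L2 n) : ‖v‖ ^ 2 = ∫ z, v z ^ 2 := by
  rw [← real_inner_self_eq_norm_sq, L2.inner_eq]
  simp_rw [sq]

theorem inner_kernelLp {n : ℕ} {s t : ℝ} (hs : 0 < s) (ht : 0 < t) (x y : Rn n) :
    inner ℝ (kernelLp s x) (kernelLp t y) = heatKernel (s + t) (x - y) := by
  rw [L2.inner_eq, ← integral_heatKernel_mul_heatKernel hs ht]
  refine integral_congr_ae ?_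
  filter_upwards [kernelLp_ae hs x, kernelLp_ae ht y] with z h1 h2
  rw [h1, h2, heatKernel_sub_comm t y z]

theorem heatKernel_zero {n : ℕ} (t : ℝ) :
    heatKernel t (0 : Rn n) = (4 * Real.pi * t) ^ (-(n : ℝ) / 2) := by
  simp [heatKernel]

theorem norm_kernelLp {n : ℕ} {t : ℝ} (ht : 0 < t) (x : Rn n) :
    ‖kernelLp t x‖ = (8 * Real.pi * t) ^ (-(n : ℝ) / 4) := by
  have h : ‖kernelLp t x‖ ^ 2 = ((8 * Real.pi * t) ^ (-(n : ℝ) / 4)) ^ 2 := by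
    rw [← real_inner_self_eq_norm_sq, inner_kernelLp ht ht, sub_self, heatKernel_zero,
      ← Real.rpow_natCast, ← Real.rpow_mul (by positivity)]
    congr 1
    · ring
    · push_cast; ring
  exact (pow_left_inj₀ (norm_nonneg _) (by positivity) two_ne_zero).1 h

/-- Expanding `‖k - k'‖²` leaves only inner products, which `inner_kernelLp` evaluates as values of
the continuous function `heatKernel`. -/
theorem continuousOn_kernelLp {n : ℕ} :
    ContinuousOn (fun q : ℝ × Rn n => kernelLp q.1 q.2) (Ioi 0 ×ˢ univ) := by
  rintro ⟨t, x⟩ ⟨ht, -⟩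
  replace ht : 0 < t := ht
  rw [ContinuousWithinAt, tendsto_iff_norm_sub_tendsto_zero]
  have hK : ∀ {s : ℝ} (_ : 0 < s) (z : Rn n),
      ContinuousAt (fun q : ℝ × Rn n => heatKernel q.1 q.2) (s, z) := fun hs z =>
    continuousOn_heatKernel_uncurry.continuousAt
      ((isOpen_Ioi.prod isOpen_univ).mem_nhds ⟨hs, mem_univ _⟩)
  have h1 : Tendsto (fun q : ℝ × Rn n => heatKernel (q.1 + q.1) (q.2 - q.2) -
      2 * heatKernel (q.1 + t) (q.2 - x) + heatKernel (t + t) (x - x))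
      (𝓝[Ioi 0 ×ˢ univ] (t, x)) (𝓝 (heatKernel (t + t) (x - x) -
      2 * heatKernel (t + t) (x - x) + heatKernel (t + t) (x - x))) := by
    refine Tendsto.mono_left ?_ nhdsWithin_le_nhds
    refine ((Tendsto.sub ?_ (Tendsto.const_mul 2 ?_))).add_const _
    · exact ContinuousAt.comp (f := fun q : ℝ × Rn n => (q.1 + q.1, q.2 - q.2))
        (x := (t, x)) (hK (by positivity) (x - x)) (by fun_prop)
    · exact ContinuousAt.comp (f := fun q : ℝ × Rn n => (q.1 + t, q.2 - x))
        (x := (t, x)) (hK (by positivity) (x - x)) (by fun_prop)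
  have h2 : Tendsto (fun q : ℝ × Rn n => ‖kernelLp q.1 q.2 - kernelLp t x‖ ^ 2)
      (𝓝[Ioi 0 ×ˢ univ] (t, x)) (𝓝 0) := by
    rw [show heatKernel (t + t) (x - x) - 2 * heatKernel (t + t) (x - x) +
      heatKernel (t + t) (x - x) = 0 by ring] at h1
    refine h1.congr' ?_
    filter_upwards [self_mem_nhdsWithin] with q hq
    rw [norm_sub_sq_real, ← real_inner_self_eq_norm_sq, ← real_inner_self_eq_norm_sq,
      inner_kernelLp hq.1 hq.1, inner_kernelLp hq.1 ht, inner_kernelLp ht ht]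
  have h3 := (Real.continuous_sqrt.tendsto 0).comp h2
  simpa [Function.comp_def, Real.sqrt_sq] using h3

/-! ### The heat semigroup -/

/-- The heat semigroup `(e^{hΔ} v)(x)`, for `h > 0`. -/
def heat {n : ℕ} (h : ℝ) (v : Rn n → ℝ) (x : Rn n) : ℝ :=
  ∫ z, heatKernel h (x - z) * v z

theorem heat_congr_ae {n : ℕ} {h : ℝ} {v w : Rn n → ℝ} (hvw : v =ᵐ[volume] w) (x : Rn n) :
    heat h v x = heat h w x := by
  refine integral_congr_ae ?_
  filter_upwards [hvw] with z hz
  rw [hz]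

theorem heat_eq_inner {n : ℕ} {h : ℝ} (hh : 0 < h) (v : L2 n) (x : Rn n) :
    heat h v x = inner ℝ (kernelLp h x) v := by
  rw [L2.inner_eq]
  refine integral_congr_ae ?_
  filter_upwards [kernelLp_ae hh x] with z hz
  rw [hz]

theorem integrable_heatKernel_mul {n : ℕ} {h : ℝ} (hh : 0 < h) (v : L2 n) (x : Rn n) :
    Integrable (fun z => heatKernel h (x - z) * v z) := by
  refine (L2.integrable_mul (kernelLp h x) v).congr ?_
  filter_upwards [kernelLp_ae hh x] with z hz
  rw [hz]

theorem abs_heat_le {n : ℕ} {h : ℝ} (hh : 0 < h) (v : L2 n) (x : Rn n) :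
    |heat h v x| ≤ (8 * Real.pi * h) ^ (-(n : ℝ) / 4) * ‖v‖ := by
  rw [heat_eq_inner hh, ← norm_kernelLp hh x]
  exact abs_real_inner_le_norm _ _

theorem L2.coeFn_abs {n : ℕ} (v : L2 n) : (|v| : L2 n) =ᵐ[volume] fun z => |v z| :=
  Lp.coeFn_abs v

theorem heat_abs {n : ℕ} {h : ℝ} (v : L2 n) (x : Rn n) :
    heat h (|v| : L2 n) x = heat h (fun z => |v z|) x :=
  heat_congr_ae (L2.coeFn_abs v) x

theorem heat_nonneg {n : ℕ} {h : ℝ} (hh : 0 < h) {v : Rn n → ℝ} (hv : 0 ≤ᵐ[volume] v) (x : Rn n) :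
    0 ≤ heat h v x := by
  refine integral_nonneg_of_ae ?_
  filter_upwards [hv] with z hz
  exact mul_nonneg (heatKernel_pos hh _).le hz

theorem abs_heat_le_heat_abs {n : ℕ} {h : ℝ} (hh : 0 < h) (v : Rn n → ℝ) (x : Rn n) :
    |heat h v x| ≤ heat h (fun z => |v z|) x := by
  rw [heat, heat, ← Real.norm_eq_abs]
  refine (norm_integral_le_integral_norm _).trans_eq (integral_congr_ae (.of_forall fun z => ?_))
  simp only [Real.norm_eq_abs, abs_mul, abs_of_pos (heatKernel_pos hh _)]

/-- The maximum principle for the heat semigroup. -/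
theorem heat_le_of_le {n : ℕ} {h B : ℝ} (hh : 0 < h) {v : Rn n → ℝ} (hB : ∀ᵐ z, |v z| ≤ B)
    (x : Rn n) : |heat h v x| ≤ B := by
  have h1 : |heat h v x| ≤ ∫ z, heatKernel h (x - z) * B := by
    rw [heat, ← Real.norm_eq_abs]
    refine norm_integral_le_of_norm_le ((integrable_heatKernel_sub hh x).mul_const B) ?_
    filter_upwards [hB] with z hz
    rw [norm_mul, Real.norm_of_nonneg (heatKernel_pos hh _).le]
    exact mul_le_mul_of_nonneg_left hz (heatKernel_pos hh _).le
  rwa [integral_mul_const, integral_heatKernel_sub hh, one_mul] at h1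

/-- The value at a point is an inner product of two continuous `L²`-valued maps. This supplies the
measurability needed in the Duhamel integrals. -/
theorem continuousOn_heat {n : ℕ} {X : Type*} [TopologicalSpace X] {S : Set X} {h : X → ℝ}
    {v : X → L2 n} {x : X → Rn n} (hh : ContinuousOn h S) (hpos : ∀ q ∈ S, 0 < h q)
    (hv : ContinuousOn v S) (hx : ContinuousOn x S) :
    ContinuousOn (fun q => heat (h q) (v q) (x q)) S := by
  have h1 : ContinuousOn (fun q => kernelLp (h q) (x q)) S :=
    continuousOn_kernelLp.comp (hh.prodMk hx) (fun q hq => ⟨hpos q hq, mem_univ _⟩)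
  refine (h1.inner (𝕜 := ℝ) hv).congr fun q hq => heat_eq_inner (hpos q hq) _ _

section AlmostOrbit


/-! ### Discrete logarithmic convexity -/

variable {H : Type*} [NormedAddCommGroup H] [InnerProductSpace ℝ H]

/-- A symmetric operator `S` with `0 ≤ S ≤ 1`. -/
structure IsSymmContraction (S : H →ₗ[ℝ] H) : Prop where
  symm : ∀ v w, inner ℝ (S v) w = inner ℝ v (S w)
  nonneg : ∀ v, 0 ≤ inner ℝ (S v) v
  le_one : ∀ v, inner ℝ (S v) v ≤ ‖v‖ ^ 2

/-- The Rayleigh quotient of `1 - S`. -/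
def rayleigh (S : H →ₗ[ℝ] H) (w : H) : ℝ := 1 - inner ℝ (S w) w / ‖w‖ ^ 2

variable {S : H →ₗ[ℝ] H}

/-- This is `S² ≤ S`, without a square root of `S`: positivity at `w - S w`, together with `S ≤ 1`
at `S w`. -/
theorem IsSymmContraction.norm_sq_le (hS : IsSymmContraction S) (w : H) :
    ‖S w‖ ^ 2 ≤ inner ℝ (S w) w := by
  have h : ∀ c : ℝ, 0 ≤ inner ℝ (S w) w - 2 * c * ‖S w‖ ^ 2 + c ^ 2 * ‖S w‖ ^ 2 := by
    intro c
    have h1 := hS.nonneg (w - c • S w)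
    have h2 := hS.le_one (S w)
    have h3 : inner ℝ (S (S w)) w = ‖S w‖ ^ 2 := by
      rw [hS.symm, real_inner_self_eq_norm_sq]
    simp only [map_sub, map_smul, inner_sub_left, inner_sub_right, inner_smul_left,
      inner_smul_right, conj_trivial, real_inner_self_eq_norm_sq, h3] at h1
    nlinarith [mul_nonneg (sq_nonneg c) (sub_nonneg.2 h2)]
  have := h 1
  linarith

theorem IsSymmContraction.inner_eq (w : H) (hw : w ≠ 0) :
    inner ℝ (S w) w = (1 - rayleigh S w) * ‖w‖ ^ 2 := by
  have : ‖w‖ ^ 2 ≠ 0 := by positivity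
  rw [rayleigh]
  field_simp
  ring

theorem IsSymmContraction.rayleigh_nonneg (hS : IsSymmContraction S) (w : H) :
    0 ≤ rayleigh S w := by
  rw [rayleigh, sub_nonneg]
  exact div_le_one_of_le₀ (hS.le_one w) (by positivity)

theorem IsSymmContraction.rayleigh_le_one (hS : IsSymmContraction S) (w : H) :
    rayleigh S w ≤ 1 := by
  rw [rayleigh, sub_le_self_iff]
  exact div_nonneg (hS.nonneg w) (by positivity)

/-- By `S² ≤ S` the exact step contracts by `√(1 - a) ≤ 1 - a/2`, where `a` is the Rayleigh
quotient. -/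
theorem IsSymmContraction.norm_le_step (hS : IsSymmContraction S) {w w' : H} {ε : ℝ} (hw : w ≠ 0)
    (h : ‖w' - S w‖ ≤ ε * ‖w‖) : ‖w'‖ ≤ (1 - rayleigh S w / 2 + ε) * ‖w‖ := by
  have ha0 := hS.rayleigh_nonneg w
  have ha1 := hS.rayleigh_le_one w
  have h1 : ‖S w‖ ≤ (1 - rayleigh S w / 2) * ‖w‖ := by
    refine (pow_le_pow_iff_left₀ (norm_nonneg _) ?_ two_ne_zero).1 ?_
    · exact mul_nonneg (by linarith) (norm_nonneg _)
    · refine (hS.norm_sq_le w).trans ?_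
      rw [IsSymmContraction.inner_eq w hw, mul_pow]
      refine mul_le_mul_of_nonneg_right ?_ (by positivity)
      nlinarith [sq_nonneg (rayleigh S w)]
  calc ‖w'‖ = ‖S w + (w' - S w)‖ := by congr 1; abel
    _ ≤ ‖S w‖ + ‖w' - S w‖ := norm_add_le _ _
    _ ≤ _ := by linarith

theorem IsSymmContraction.norm_ge_step {w w' : H} {ε : ℝ} (hw : w ≠ 0)
    (h : ‖w' - S w‖ ≤ ε * ‖w‖) : (1 - rayleigh S w - ε) * ‖w‖ ≤ ‖w'‖ := by
  have h1 : inner ℝ w' w = inner ℝ (S w) w + inner ℝ (w' - S w) w := by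
    rw [← inner_add_left]; congr 1; abel
  have h2 : -(‖w' - S w‖ * ‖w‖) ≤ inner ℝ (w' - S w) w := by
    have := abs_real_inner_le_norm (w' - S w) w
    exact (abs_le.1 this).1
  have h3 : inner ℝ w' w ≤ ‖w'‖ * ‖w‖ := real_inner_le_norm _ _
  rw [IsSymmContraction.inner_eq w hw] at h1
  have hpos : 0 < ‖w‖ := norm_pos_iff.2 hw
  nlinarith [mul_le_mul_of_nonneg_right h hpos.le]

/-- The Rayleigh quotient almost decreases along an almost-orbit of `S`. -/
theorem IsSymmContraction.rayleigh_step (hS : IsSymmContraction S) {w w' : H} {ε : ℝ} (hw : w ≠ 0)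
    (hw' : w' ≠ 0) (h : ‖w' - S w‖ ≤ ε * ‖w‖) :
    rayleigh S w' ≤ rayleigh S w + (1 - rayleigh S w) * ε ^ 2 * ‖w‖ ^ 2 / ‖w'‖ ^ 2 := by
  set a := rayleigh S w with ha
  have ha1 : a ≤ 1 := hS.rayleigh_le_one w
  have hSw := IsSymmContraction.inner_eq (S := S) w hw
  have hSw' := IsSymmContraction.inner_eq (S := S) w' hw'
  rw [← ha] at hSw
  obtain ⟨g, hg⟩ : ∃ g, g = w' - S w := ⟨_, rfl⟩
  -- `z` is the component of `w'` that does not come from `(1 - a) w`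
  obtain ⟨z, hz⟩ : ∃ z, z = w' - (1 - a) • w := ⟨_, rfl⟩
  have hzg : z = S w - (1 - a) • w + g := by rw [hz, hg]; abel
  have hw'z : w' = (1 - a) • w + z := by rw [hz]; abel
  have hzz := hS.nonneg z
  have hg2 : ‖g‖ ^ 2 ≤ ε ^ 2 * ‖w‖ ^ 2 := by
    rw [← mul_pow, hg]
    exact pow_le_pow_left₀ (norm_nonneg _) h 2
  have e1 : inner ℝ (S w') w' = (1 - a) ^ 2 * inner ℝ (S w) w + 2 * (1 - a) * inner ℝ (S w) z +
      inner ℝ (S z) z := by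
    rw [hw'z]
    simp only [map_add, map_smul, inner_add_left, inner_add_right, inner_smul_left,
      inner_smul_right, conj_trivial, hS.symm z w, real_inner_comm (S w) z]
    ring
  have e2 : ‖w'‖ ^ 2 = (1 - a) ^ 2 * ‖w‖ ^ 2 + 2 * (1 - a) * inner ℝ w z + ‖z‖ ^ 2 := by
    rw [hw'z, norm_add_sq_real, norm_smul, mul_pow, inner_smul_left, Real.norm_eq_abs, sq_abs]
    simp only [conj_trivial]
    ring
  have e3 : ‖g‖ ^ 2 = ‖z‖ ^ 2 - 2 * inner ℝ z (S w - (1 - a) • w) +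
      inner ℝ (S w - (1 - a) • w) (S w - (1 - a) • w) := by
    rw [real_inner_self_eq_norm_sq, ← norm_sub_sq_real]
    congr 2
    rw [hzg]; abel
  have e4 : 0 ≤ (inner ℝ (S w - (1 - a) • w) (S w - (1 - a) • w) : ℝ) := real_inner_self_nonneg
  have e5 : (inner ℝ z (S w - (1 - a) • w) : ℝ) = inner ℝ (S w) z - (1 - a) * inner ℝ w z := by
    rw [inner_sub_right, inner_smul_right, real_inner_comm, real_inner_comm z w]
  -- With `v = S w - (1 - a) w`, which is orthogonal to `w`, one has `z = v + g`, and the left side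
  -- equals `(1 - a)(‖g‖² - ‖v‖²) - ⟪S z, z⟫`. Both negative terms are dropped. Nothing linear in
  -- `g` remains, so the loss is of order `ε²`.
  have main : (1 - a) * ‖w'‖ ^ 2 - inner ℝ (S w') w' ≤ (1 - a) * ‖g‖ ^ 2 := by
    rw [e1, e2, e3, e5, hSw]
    have := mul_nonneg (sub_nonneg.2 ha1) e4
    linarith
  have hpos : 0 < ‖w'‖ ^ 2 := by positivity
  rw [hSw'] at main
  rw [← sub_le_iff_le_add', le_div_iff₀ hpos]
  have := mul_le_mul_of_nonneg_left hg2 (sub_nonneg.2 ha1)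
  linarith

/-- While the Rayleigh quotient is small, it grows at most linearly, and the orbit does not
vanish. -/
theorem IsSymmContraction.rayleigh_forward (hS : IsSymmContraction S) {w : ℕ → H} {ε : ℝ}
    {m : ℕ} (hw : ∀ k < m, ‖w (k + 1) - S (w k)‖ ≤ ε * ‖w k‖) {k : ℕ}
    (hk : w k ≠ 0) (hsmall : rayleigh S (w k) + 4 * ε ^ 2 * m + ε ≤ 1 / 2) :
    ∀ j, k + j ≤ m → w (k + j) ≠ 0 ∧
      rayleigh S (w (k + j)) ≤ rayleigh S (w k) + 4 * ε ^ 2 * j := by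
  intro j
  induction j with
  | zero => intro _; exact ⟨hk, by simp⟩
  | succ j ih =>
    intro hj
    obtain ⟨h0, h1⟩ := ih (by omega)
    have hjm : (j : ℝ) ≤ m := by exact_mod_cast (by omega : j ≤ m)
    have hε2 : 4 * ε ^ 2 * j ≤ 4 * ε ^ 2 * m := mul_le_mul_of_nonneg_left hjm (by positivity)
    have hstep := hw (k + j) (by omega)
    have hge := IsSymmContraction.norm_ge_step h0 hstep
    have hp : 0 < ‖w (k + j)‖ := norm_pos_iff.2 h0
    -- A step at most halves the norm, so `‖w‖² / ‖w'‖² ≤ 4`: this is the `4` in `4 * ε ^ 2`.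
    have hhalf : 1 / 2 * ‖w (k + j)‖ ≤ ‖w (k + j + 1)‖ := by
      refine le_trans (mul_le_mul_of_nonneg_right ?_ hp.le) hge
      linarith
    have hne : w (k + j + 1) ≠ 0 := norm_pos_iff.1 (by linarith)
    refine ⟨hne, ?_⟩
    refine (hS.rayleigh_step h0 hne hstep).trans ?_
    have hp' : 0 < ‖w (k + j + 1)‖ := norm_pos_iff.2 hne
    have : (1 - rayleigh S (w (k + j))) * ε ^ 2 * ‖w (k + j)‖ ^ 2 / ‖w (k + j + 1)‖ ^ 2
        ≤ 4 * ε ^ 2 := by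
      rw [div_le_iff₀ (by positivity)]
      have ha0 := hS.rayleigh_nonneg (w (k + j))
      have h2 : ‖w (k + j)‖ ^ 2 ≤ 4 * ‖w (k + j + 1)‖ ^ 2 := by nlinarith
      calc _ ≤ 1 * ε ^ 2 * ‖w (k + j)‖ ^ 2 := by gcongr; linarith
        _ ≤ 1 * ε ^ 2 * (4 * ‖w (k + j + 1)‖ ^ 2) := by gcongr
        _ = _ := by ring
    push_cast
    linarith

/-- The Rayleigh quotient at the end of an almost-orbit is controlled by the decay of the norm. -/
theorem IsSymmContraction.mul_rayleigh_le (hS : IsSymmContraction S) {w : ℕ → H} {ε : ℝ}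
    {m : ℕ} (hm : 0 < m) (hw : ∀ k < m, ‖w (k + 1) - S (w k)‖ ≤ ε * ‖w k‖)
    (hwm : w m ≠ 0) {Y : ℝ} (hY : ‖w 0‖ ^ 2 ≤ Real.exp Y * ‖w m‖ ^ 2)
    (hsmall : (Y + 4 * (m * ε) ^ 2 + 2 * (m * ε)) / m + ε < 1 / 2) :
    rayleigh S (w m) ≤ (Y + 4 * (m * ε) ^ 2 + 2 * (m * ε)) / m := by
  have hm' : (0 : ℝ) < m := by exact_mod_cast hm
  refine le_of_forall_gt_imp_ge_of_dense fun X₀ hX₀ => ?_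
  by_contra! hcon
  -- A level above the claimed bound and below the final Rayleigh quotient, yet small enough for
  -- `rayleigh_forward` to apply.
  obtain ⟨X, hX1, hX2⟩ := exists_between (lt_min hX₀ (lt_sub_iff_add_lt.2 hsmall))
  have hXX₀ : X < X₀ := hX2.trans_le (min_le_left _ _)
  have hXε : X < 1 / 2 - ε := hX2.trans_le (min_le_right _ _)
  -- The error is relative to `‖w k‖`, so an almost-orbit that vanishes once vanishes from then on.
  have hne : ∀ k ≤ m, w k ≠ 0 := by
    intro k hk
    induction hk using Nat.decreasingInduction with
    | self => exact hwm
    | of_succ k hk ih =>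
      intro h0
      have := hw k hk
      rw [h0] at this
      simp only [map_zero, sub_zero, norm_zero, mul_zero, norm_le_zero_iff] at this
      exact ih this
  -- An earlier quotient below this level would, by almost-monotonicity, force the final one down to
  -- `X`. So the quotient is large at every step, and the norm decays more than `hY` allows.
  have hlow : ∀ k ≤ m, X - 4 * ε ^ 2 * m < rayleigh S (w k) := by
    intro k hk
    by_contra! hlt
    have h1 := (hS.rayleigh_forward hw (hne k hk) (by linarith) (m - k) (by omega)).2
    rw [Nat.add_sub_cancel' hk] at h1
    have : ((m - k : ℕ) : ℝ) ≤ m := by exact_mod_cast Nat.sub_le m k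
    have := mul_le_mul_of_nonneg_left this (by positivity : 0 ≤ 4 * ε ^ 2)
    linarith
  have hdecay : ∀ k ≤ m, ‖w k‖ ≤ Real.exp (k * (-(X - 4 * ε ^ 2 * m) / 2 + ε)) * ‖w 0‖ := by
    intro k
    induction k with
    | zero => intro _; simp
    | succ k ih =>
      intro hk
      have h1 := hS.norm_le_step (hne k (by omega)) (hw k (by omega))
      have h2 := hlow k (by omega)
      refine h1.trans ?_
      have h3 : 1 - rayleigh S (w k) / 2 + ε ≤ Real.exp (-(X - 4 * ε ^ 2 * m) / 2 + ε) := by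
        have := Real.add_one_le_exp (-(X - 4 * ε ^ 2 * m) / 2 + ε)
        linarith
      calc _ ≤ Real.exp (-(X - 4 * ε ^ 2 * m) / 2 + ε) *
            (Real.exp (k * (-(X - 4 * ε ^ 2 * m) / 2 + ε)) * ‖w 0‖) := by
            gcongr
            exact ih (by omega)
        _ = _ := by
            rw [← mul_assoc, ← Real.exp_add]
            push_cast
            ring_nf
  have h1 := hdecay m le_rfl
  have hp : 0 < ‖w m‖ := norm_pos_iff.2 hwm
  have h2 : ‖w m‖ ^ 2 ≤ Real.exp (2 * (m * (-(X - 4 * ε ^ 2 * m) / 2 + ε)) + Y) * ‖w m‖ ^ 2 := by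
    calc ‖w m‖ ^ 2 ≤ (Real.exp (m * (-(X - 4 * ε ^ 2 * m) / 2 + ε)) * ‖w 0‖) ^ 2 := by gcongr
      _ = Real.exp (2 * (m * (-(X - 4 * ε ^ 2 * m) / 2 + ε))) * ‖w 0‖ ^ 2 := by
          rw [mul_pow, ← Real.exp_nat_mul]; norm_num
      _ ≤ Real.exp (2 * (m * (-(X - 4 * ε ^ 2 * m) / 2 + ε))) * (Real.exp Y * ‖w m‖ ^ 2) := by
          gcongr
      _ = _ := by rw [Real.exp_add]; ring
  have h3 : 1 ≤ Real.exp (2 * (m * (-(X - 4 * ε ^ 2 * m) / 2 + ε)) + Y) := by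
    by_contra! hlt
    have : 0 < ‖w m‖ ^ 2 := by positivity
    nlinarith
  rw [Real.one_le_exp_iff] at h3
  rw [div_lt_iff₀ hm'] at hX1
  nlinarith


end AlmostOrbit

/-! ### Integral operators with a positive eigenfunction -/

theorem lintegral_mul_sq_le {α : Type*} [MeasurableSpace α] {μ : Measure α} {f g : α → ENNReal}
    (hf : AEMeasurable f μ) (hg : AEMeasurable g μ) :
    (∫⁻ a, f a * g a ∂μ) ^ 2 ≤ (∫⁻ a, f a ^ 2 ∂μ) * ∫⁻ a, g a ^ 2 ∂μ := by
  have h := ENNReal.lintegral_mul_le_Lp_mul_Lq μ Real.HolderConjugate.two_two hf hg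
  simp only [Pi.mul_apply, ENNReal.rpow_two] at h
  calc _ ≤ ((∫⁻ a, f a ^ 2 ∂μ) ^ (1 / 2 : ℝ) * (∫⁻ a, g a ^ 2 ∂μ) ^ (1 / 2 : ℝ)) ^ 2 := by gcongr
    _ = _ := by
      rw [mul_pow, ← ENNReal.rpow_two, ← ENNReal.rpow_two, ← ENNReal.rpow_mul, ← ENNReal.rpow_mul]
      norm_num

/-- A nonnegative symmetric kernel with a positive eigenfunction `φ` of eigenvalue `1`. -/
structure IsSchurKernel {n : ℕ} (k : Rn n → Rn n → ℝ) (φ : Rn n → ℝ) : Prop where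
  continuous : Continuous (Function.uncurry k)
  nonneg : ∀ x z, 0 ≤ k x z
  symm : ∀ x z, k x z = k z x
  memLp : ∀ x, MemLp (k x) 2
  pos : ∀ x, 0 < φ x
  continuous_fun : Continuous φ
  integrable : ∀ x, Integrable fun z => k x z * φ z
  integral_eq : ∀ x, ∫ z, k x z * φ z = φ x

namespace IsSchurKernel

variable {n : ℕ} {k : Rn n → Rn n → ℝ} {φ : Rn n → ℝ}

theorem lintegral_eq (hk : IsSchurKernel k φ) (x : Rn n) :
    ∫⁻ z, ENNReal.ofReal (k x z * φ z) = ENNReal.ofReal (φ x) := by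
  rw [← ofReal_integral_eq_lintegral_ofReal (hk.integrable x), hk.integral_eq]
  exact .of_forall fun z => mul_nonneg (hk.nonneg x z) (hk.pos z).le

theorem integrable_mul (hk : IsSchurKernel k φ) (v : L2 n) (x : Rn n) :
    Integrable fun z => k x z * v z :=
  (hk.memLp x).integrable_mul (Lp.memLp v)

theorem aestronglyMeasurable (hk : IsSchurKernel k φ) (v : L2 n) :
    AEStronglyMeasurable (fun x => ∫ z, k x z * v z) volume := by
  have h : AEStronglyMeasurable (fun q : Rn n × Rn n => k q.1 q.2 * v q.2)
      (volume.prod volume) :=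
    hk.continuous.aestronglyMeasurable.mul (Lp.aestronglyMeasurable v).comp_snd
  exact h.integral_prod_right'

/-- Schur's test: Cauchy–Schwarz after writing `k v = √(k φ) · (√(k / φ) v)`, where the first factor
has squared norm `φ x`. -/
theorem enorm_integral_sq_le (hk : IsSchurKernel k φ) (v : L2 n) (x : Rn n) :
    ‖∫ z, k x z * v z‖ₑ ^ 2 ≤
      ENNReal.ofReal (φ x) * ∫⁻ z, ENNReal.ofReal (k x z / φ z) * ‖v z‖ₑ ^ 2 := by
  have hkx : Continuous (k x) := hk.continuous.comp (by fun_prop : Continuous fun z => (x, z))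
  have hkφ : Continuous fun z => k x z / φ z :=
    hkx.div hk.continuous_fun fun z => (hk.pos z).ne'
  have h1 : ‖∫ z, k x z * v z‖ₑ ≤ ∫⁻ z, ENNReal.ofReal (√(k x z * φ z)) *
      (ENNReal.ofReal (√(k x z / φ z)) * ‖v z‖ₑ) := by
    refine (enorm_integral_le_lintegral_enorm _).trans_eq (lintegral_congr fun z => ?_)
    rw [← mul_assoc, ← ENNReal.ofReal_mul (Real.sqrt_nonneg _), ← Real.sqrt_mul
      (mul_nonneg (hk.nonneg x z) (hk.pos z).le), enorm_mul]
    congr 1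
    have : k x z * φ z * (k x z / φ z) = k x z ^ 2 := by
      have := (hk.pos z).ne'
      field_simp
    rw [this, Real.sqrt_sq (hk.nonneg x z), Real.enorm_of_nonneg (hk.nonneg x z)]
  calc _ ≤ (∫⁻ z, ENNReal.ofReal (√(k x z * φ z)) *
        (ENNReal.ofReal (√(k x z / φ z)) * ‖v z‖ₑ)) ^ 2 := by gcongr
    _ ≤ _ := lintegral_mul_sq_le ?_ ?_
    _ = _ := by
      congr 1
      · rw [← hk.lintegral_eq]
        refine lintegral_congr fun z => ?_
        rw [← ENNReal.ofReal_pow (Real.sqrt_nonneg _),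
          Real.sq_sqrt (mul_nonneg (hk.nonneg x z) (hk.pos z).le)]
      · refine lintegral_congr fun z => ?_
        rw [mul_pow, ← ENNReal.ofReal_pow (Real.sqrt_nonneg _),
          Real.sq_sqrt (div_nonneg (hk.nonneg x z) (hk.pos z).le)]
  · exact ((hkx.mul hk.continuous_fun).sqrt.measurable.ennreal_ofReal).aemeasurable
  · exact (hkφ.sqrt.measurable.ennreal_ofReal).aemeasurable.mul
      (Lp.aestronglyMeasurable v).enorm

/-- After Tonelli the symmetry of `k` produces `∫ k z x * φ x dx = φ z`, which cancels the weight `1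
/ φ z`. -/
theorem lintegral_enorm_sq_le (hk : IsSchurKernel k φ) (v : L2 n) :
    ∫⁻ x, ‖∫ z, k x z * v z‖ₑ ^ 2 ≤ ∫⁻ z, ‖v z‖ₑ ^ 2 := by
  have hkφ : Continuous fun q : Rn n × Rn n => k q.1 q.2 / φ q.2 :=
    hk.continuous.div (hk.continuous_fun.comp continuous_snd) fun q => (hk.pos q.2).ne'
  calc _ ≤ ∫⁻ x, ∫⁻ z, ENNReal.ofReal (φ x) *
        (ENNReal.ofReal (k x z / φ z) * ‖v z‖ₑ ^ 2) := by
        refine lintegral_mono fun x => ?_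
        rw [lintegral_const_mul']
        · exact hk.enorm_integral_sq_le v x
        · exact ENNReal.ofReal_ne_top
    _ = ∫⁻ z, ∫⁻ x, ENNReal.ofReal (φ x) *
        (ENNReal.ofReal (k x z / φ z) * ‖v z‖ₑ ^ 2) := by
        refine lintegral_lintegral_swap ?_
        refine AEMeasurable.mul (f := fun q : Rn n × Rn n => ENNReal.ofReal (φ q.1))
          (g := fun q => ENNReal.ofReal (k q.1 q.2 / φ q.2) * ‖v q.2‖ₑ ^ 2) ?_
          (AEMeasurable.mul (f := fun q : Rn n × Rn n => ENNReal.ofReal (k q.1 q.2 / φ q.2)) ?_ ?_)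
        · exact ((hk.continuous_fun.comp continuous_fst).measurable.ennreal_ofReal).aemeasurable
        · exact hkφ.measurable.ennreal_ofReal.aemeasurable
        · exact (Lp.aestronglyMeasurable v).comp_snd.enorm.pow_const 2
    _ = ∫⁻ z, ‖v z‖ₑ ^ 2 := by
        refine lintegral_congr fun z => ?_
        have : ∀ x, ENNReal.ofReal (φ x) * (ENNReal.ofReal (k x z / φ z) * ‖v z‖ₑ ^ 2) =
            ENNReal.ofReal (k z x * φ x) * (ENNReal.ofReal (1 / φ z) * ‖v z‖ₑ ^ 2) := by
          intro x
          rw [← mul_assoc, ← mul_assoc, ← ENNReal.ofReal_mul (hk.pos x).le,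
            ← ENNReal.ofReal_mul (mul_nonneg (hk.nonneg z x) (hk.pos x).le), hk.symm x z]
          congr 2
          ring
        simp_rw [this]
        rw [lintegral_mul_const', hk.lintegral_eq, ← mul_assoc, ← ENNReal.ofReal_mul (hk.pos z).le,
          mul_one_div_cancel (hk.pos z).ne', ENNReal.ofReal_one, one_mul]
        exact ENNReal.mul_ne_top ENNReal.ofReal_ne_top (by simp)

theorem eLpNorm_two_sq {f : Rn n → ℝ} : eLpNorm f 2 volume ^ 2 = ∫⁻ x, ‖f x‖ₑ ^ 2 := by
  rw [eLpNorm_eq_lintegral_rpow_enorm_toReal two_ne_zero ENNReal.ofNat_ne_top, ← ENNReal.rpow_two,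
    ← ENNReal.rpow_mul]
  norm_num

theorem eLpNorm_le (hk : IsSchurKernel k φ) (v : L2 n) :
    eLpNorm (fun x => ∫ z, k x z * v z) 2 volume ≤ eLpNorm v 2 volume := by
  have h := hk.lintegral_enorm_sq_le v
  rw [← eLpNorm_two_sq, ← eLpNorm_two_sq] at h
  exact (ENNReal.pow_le_pow_left_iff two_ne_zero).1 h

theorem memLp_integral (hk : IsSchurKernel k φ) (v : L2 n) :
    MemLp (fun x => ∫ z, k x z * v z) 2 :=
  ⟨hk.aestronglyMeasurable v, (hk.eLpNorm_le v).trans_lt (Lp.memLp v).2⟩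

/-- The operator on `L²` with the kernel `k`. -/
def op (hk : IsSchurKernel k φ) : L2 n →ₗ[ℝ] L2 n where
  toFun v := (hk.memLp_integral v).toLp _
  map_add' v w := by
    rw [← MemLp.toLp_add, MemLp.toLp_eq_toLp_iff]
    refine .of_forall fun x => ?_
    simp only [Pi.add_apply]
    rw [← integral_add (hk.integrable_mul v x) (hk.integrable_mul w x)]
    refine integral_congr_ae ?_
    filter_upwards [Lp.coeFn_add v w] with z hz
    rw [hz, Pi.add_apply, mul_add]
  map_smul' c v := by
    rw [RingHom.id_apply, ← MemLp.toLp_const_smul, MemLp.toLp_eq_toLp_iff]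
    refine .of_forall fun x => ?_
    simp only [Pi.smul_apply, smul_eq_mul]
    rw [← integral_const_mul]
    refine integral_congr_ae ?_
    filter_upwards [Lp.coeFn_smul c v] with z hz
    rw [hz, Pi.smul_apply, smul_eq_mul]
    ring

theorem op_ae (hk : IsSchurKernel k φ) (v : L2 n) :
    hk.op v =ᵐ[volume] fun x => ∫ z, k x z * v z :=
  (hk.memLp_integral v).coeFn_toLp

theorem norm_op_le (hk : IsSchurKernel k φ) (v : L2 n) : ‖hk.op v‖ ≤ ‖v‖ := by
  rw [Lp.norm_def, Lp.norm_def]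
  refine ENNReal.toReal_mono (Lp.memLp v).2.ne ?_
  rw [eLpNorm_congr_ae (hk.op_ae v)]
  exact hk.eLpNorm_le v

theorem inner_op (hk : IsSchurKernel k φ) (v w : L2 n) :
    inner ℝ (hk.op v) w = ∫ x, ∫ z, k x z * v z * w x := by
  rw [L2.inner_eq]
  refine integral_congr_ae ?_
  filter_upwards [hk.op_ae v] with x hx
  rw [hx, integral_mul_const]

theorem integrable_prod (hk : IsSchurKernel k φ) (v w : L2 n) :
    Integrable (fun q : Rn n × Rn n => k q.1 q.2 * v q.2 * w q.1) (volume.prod volume) := by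
  rw [integrable_prod_iff]
  · refine ⟨.of_forall fun x => (hk.integrable_mul v x).mul_const (w x), ?_⟩
    have := (L2.integrable_mul (hk.op |v|) w).norm
    refine this.congr ?_
    filter_upwards [hk.op_ae |v|] with x hx
    have h1 : ∫ z, k x z * (|v| : L2 n) z = ∫ z, ‖k x z * v z‖ := by
      refine integral_congr_ae ?_
      filter_upwards [L2.coeFn_abs v] with z hz
      rw [hz, norm_mul, Real.norm_of_nonneg (hk.nonneg x z), Real.norm_eq_abs]
    simp only [norm_mul _ (w x), integral_mul_const]
    rw [hx, h1, Real.norm_of_nonneg (integral_nonneg fun z => norm_nonneg _)]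
  · exact (hk.continuous.aestronglyMeasurable.mul (Lp.aestronglyMeasurable v).comp_snd).mul
      (Lp.aestronglyMeasurable w).comp_fst

theorem op_symm (hk : IsSchurKernel k φ) (v w : L2 n) :
    inner ℝ (hk.op v) w = inner ℝ v (hk.op w) := by
  rw [real_inner_comm _ v, inner_op, inner_op, integral_integral_swap (hk.integrable_prod v w)]
  refine integral_congr_ae (.of_forall fun z => integral_congr_ae (.of_forall fun x => ?_))
  simp only
  rw [hk.symm x z]
  ring

theorem isSymmContraction (hk : IsSchurKernel k φ) (hpos : ∀ v, 0 ≤ inner ℝ (hk.op v) v) :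
    IsSymmContraction hk.op where
  symm := hk.op_symm
  nonneg := hpos
  le_one v := by
    refine (real_inner_le_norm _ _).trans ?_
    rw [sq]
    exact mul_le_mul_of_nonneg_right (hk.norm_op_le v) (norm_nonneg _)

/-- A pointwise perturbation bound gives a bound in `L²`. -/
theorem norm_sub_op_le (hk : IsSchurKernel k φ) {v w : L2 n} {ε : ℝ} (hε : 0 ≤ ε)
    (h : ∀ᵐ x, |w x - ∫ z, k x z * v z| ≤ ε * ∫ z, k x z * |v z|) :
    ‖w - hk.op v‖ ≤ ε * ‖v‖ := by
  have h1 : ‖w - hk.op v‖ ≤ ε * ‖hk.op |v|‖ := by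
    refine Lp.norm_le_mul_norm_of_ae_le_mul ?_
    filter_upwards [h, Lp.coeFn_sub w (hk.op v), hk.op_ae v, hk.op_ae |v|] with x hx h2 h3 h4
    rw [h2, Pi.sub_apply, h3, h4, Real.norm_eq_abs, Real.norm_eq_abs]
    refine hx.trans (mul_le_mul_of_nonneg_left ?_ hε)
    refine le_trans (le_of_eq ?_) (le_abs_self _)
    refine integral_congr_ae ?_
    filter_upwards [L2.coeFn_abs v] with z hz
    rw [hz]
  refine h1.trans (mul_le_mul_of_nonneg_left ?_ hε)
  refine (hk.norm_op_le _).trans_eq ?_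
  exact norm_abs_eq_norm v

end IsSchurKernel

/-! ### The heat semigroup on `L²` -/

theorem isSchurKernel_heatKernel {n : ℕ} {h : ℝ} (hh : 0 < h) :
    IsSchurKernel (fun x z : Rn n => heatKernel h (x - z)) (fun _ => 1) where
  continuous := (continuous_heatKernel h).comp (by fun_prop : Continuous
    fun q : Rn n × Rn n => q.1 - q.2)
  nonneg x z := (heatKernel_pos hh _).le
  symm := heatKernel_sub_comm h
  memLp := memLp_heatKernel_sub hh
  pos _ := one_pos
  continuous_fun := continuous_const
  integrable x := by simpa using integrable_heatKernel_sub hh x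
  integral_eq x := by simpa using integral_heatKernel_sub hh x

theorem heatOp_ae {n : ℕ} {h : ℝ} (hh : 0 < h) (v : L2 n) :
    (isSchurKernel_heatKernel hh).op v =ᵐ[volume] heat h v :=
  (isSchurKernel_heatKernel hh).op_ae v

theorem memLp_heat {n : ℕ} {h : ℝ} (hh : 0 < h) (v : L2 n) : MemLp (heat h v) 2 :=
  (isSchurKernel_heatKernel hh).memLp_integral v

theorem heatOp_kernelLp {n : ℕ} {s t : ℝ} (hs : 0 < s) (ht : 0 < t) (x : Rn n) :
    (isSchurKernel_heatKernel ht).op (kernelLp s x) = kernelLp (s + t) x := by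
  refine Lp.ext ?_
  filter_upwards [heatOp_ae ht (kernelLp s x), kernelLp_ae (add_pos hs ht) x] with y h1 h2
  rw [h1, h2, heat_eq_inner ht, inner_kernelLp ht hs, add_comm, heatKernel_sub_comm]

/-- The semigroup property. -/
theorem heat_heat {n : ℕ} {s t : ℝ} (hs : 0 < s) (ht : 0 < t) (v : L2 n) (x : Rn n) :
    heat s (heat t v) x = heat (s + t) v x := by
  -- Symmetry moves the inner heat operator onto the kernel of the outer one, where
  -- Chapman–Kolmogorov applies.
  rw [← heat_congr_ae (heatOp_ae ht v), heat_eq_inner hs, heat_eq_inner (add_pos hs ht),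
    ← heatOp_kernelLp hs ht, IsSchurKernel.op_symm]

/-- The operator at time `h` is the square of the symmetric operator at time `h/2`; hence it is
positive. -/
theorem inner_heatOp_self {n : ℕ} {h : ℝ} (hh : 0 < h) (v : L2 n) :
    inner ℝ ((isSchurKernel_heatKernel hh).op v) v =
      ‖(isSchurKernel_heatKernel (half_pos hh)).op v‖ ^ 2 := by
  rw [← real_inner_self_eq_norm_sq, ← IsSchurKernel.op_symm]
  congr 1
  refine Lp.ext ?_
  filter_upwards [heatOp_ae hh v, heatOp_ae (half_pos hh)
    ((isSchurKernel_heatKernel (half_pos hh)).op v)] with x h1 h2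
  rw [h1, h2, heat_congr_ae (heatOp_ae (half_pos hh) v), heat_heat (half_pos hh) (half_pos hh),
    add_halves]

theorem isSymmContraction_heatOp {n : ℕ} {h : ℝ} (hh : 0 < h) :
    IsSymmContraction (isSchurKernel_heatKernel (n := n) hh).op :=
  (isSchurKernel_heatKernel hh).isSymmContraction fun v => by
    rw [inner_heatOp_self hh]
    positivity

/-! ### The Mehler kernel -/

/-- The kernel of the Ornstein–Uhlenbeck semigroup, conjugated by the square root of the Gaussian
weight. -/
def mehler {n : ℕ} (ρ : ℝ) (ξ η : Rn n) : ℝ :=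
  Real.exp (-‖ξ‖ ^ 2 / 8) * heatKernel (1 - ρ ^ 2) (ρ • ξ - η) * Real.exp (‖η‖ ^ 2 / 8)

/-- The exponent of the Gaussian factors of the Mehler kernel. -/
def mehlerExp (ρ : ℝ) : ℝ := (1 - ρ) / (8 * (1 + ρ))

/-- In this form the kernel is visibly symmetric, and the operator is a heat operator between two
multiplications by the same Gaussian, hence positive. -/
theorem mehler_eq {n : ℕ} {ρ : ℝ} (h0 : 0 < ρ) (h1 : ρ < 1) (ξ η : Rn n) :
    mehler ρ ξ η = ρ ^ (-(n : ℝ) / 2) * (Real.exp (-(mehlerExp ρ * ‖ξ‖ ^ 2)) *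
      heatKernel ((1 - ρ ^ 2) / ρ) (ξ - η) * Real.exp (-(mehlerExp ρ * ‖η‖ ^ 2))) := by
  have h2 : 0 < 1 - ρ := by linarith
  have h3 : 0 < 1 + ρ := by linarith
  have h4 : 1 - ρ ^ 2 = (1 - ρ) * (1 + ρ) := by ring
  have e1 : ‖ρ • ξ - η‖ ^ 2 = ρ ^ 2 * ‖ξ‖ ^ 2 - 2 * ρ * inner ℝ ξ η + ‖η‖ ^ 2 := by
    rw [norm_sub_sq_real, norm_smul, mul_pow, inner_smul_left, Real.norm_eq_abs, sq_abs]
    simp only [conj_trivial]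
    ring
  have e2 : (4 * Real.pi * (1 - ρ ^ 2)) ^ (-(n : ℝ) / 2) =
      ρ ^ (-(n : ℝ) / 2) * (4 * Real.pi * ((1 - ρ ^ 2) / ρ)) ^ (-(n : ℝ) / 2) := by
    have : 0 < 1 - ρ ^ 2 := by rw [h4]; positivity
    rw [← Real.mul_rpow (by positivity) (by positivity)]
    congr 1
    field_simp
  have e3 : Real.exp (-‖ξ‖ ^ 2 / 8) * Real.exp (-‖ρ • ξ - η‖ ^ 2 / (4 * (1 - ρ ^ 2))) *
      Real.exp (‖η‖ ^ 2 / 8) = Real.exp (-(mehlerExp ρ * ‖ξ‖ ^ 2)) *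
      Real.exp (-‖ξ - η‖ ^ 2 / (4 * ((1 - ρ ^ 2) / ρ))) * Real.exp (-(mehlerExp ρ * ‖η‖ ^ 2)) := by
    rw [← Real.exp_add, ← Real.exp_add, ← Real.exp_add, ← Real.exp_add, e1,
      norm_sub_sq_real, mehlerExp, h4]
    congr 1
    field_simp
    ring
  unfold mehler heatKernel
  rw [e2]
  linear_combination (ρ ^ (-(n : ℝ) / 2) * (4 * Real.pi * ((1 - ρ ^ 2) / ρ)) ^ (-(n : ℝ) / 2)) * e3

theorem mehlerExp_pos {ρ : ℝ} (h0 : 0 < ρ) (h1 : ρ < 1) : 0 < mehlerExp ρ :=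
  div_pos (by linarith) (by linarith)

theorem one_sub_sq_pos {ρ : ℝ} (h0 : 0 < ρ) (h1 : ρ < 1) : 0 < 1 - ρ ^ 2 := by nlinarith

theorem continuous_mehler {n : ℕ} (ρ : ℝ) :
    Continuous (Function.uncurry (mehler ρ : Rn n → Rn n → ℝ)) := by
  unfold mehler Function.uncurry
  have := (continuous_heatKernel (n := n) (1 - ρ ^ 2)).comp (by fun_prop : Continuous
    fun q : Rn n × Rn n => ρ • q.1 - q.2)
  fun_prop

/-- The eigenfunction cancels the last factor of the kernel and leaves a heat kernel of mass `1`. -/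
theorem isSchurKernel_mehler {n : ℕ} {ρ : ℝ} (h0 : 0 < ρ) (h1 : ρ < 1) :
    IsSchurKernel (mehler ρ : Rn n → Rn n → ℝ) (fun ξ => Real.exp (-‖ξ‖ ^ 2 / 8)) where
  continuous := continuous_mehler ρ
  nonneg x z := by
    unfold mehler
    have := heatKernel_pos (one_sub_sq_pos h0 h1) (ρ • x - z)
    positivity
  symm x z := by
    rw [mehler_eq h0 h1, mehler_eq h0 h1, heatKernel_sub_comm _ z x]
    ring
  memLp x := by
    have hpos : 0 < (1 - ρ ^ 2) / ρ := div_pos (one_sub_sq_pos h0 h1) h0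
    refine ((memLp_heatKernel_sub hpos x).const_mul (ρ ^ (-(n : ℝ) / 2))).mono
      ((continuous_mehler ρ).comp (by fun_prop : Continuous fun z => (x, z))).aestronglyMeasurable
      (.of_forall fun z => ?_)
    have hb := (mehlerExp_pos h0 h1).le
    have hK := heatKernel_pos hpos (x - z)
    have hle : ∀ y : Rn n, Real.exp (-(mehlerExp ρ * ‖y‖ ^ 2)) ≤ 1 := fun y => by
      rw [Real.exp_le_one_iff, neg_nonpos]; positivity
    rw [mehler_eq h0 h1, Real.norm_of_nonneg (by positivity), Real.norm_of_nonneg (by positivity)]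
    gcongr
    calc _ ≤ 1 * heatKernel ((1 - ρ ^ 2) / ρ) (x - z) * 1 := by
          gcongr
          · exact hle x
          · exact hle z
      _ = _ := by ring
  pos x := Real.exp_pos _
  continuous_fun := by fun_prop
  integrable x := by
    refine ((integrable_heatKernel_sub (one_sub_sq_pos h0 h1) (ρ • x)).const_mul
      (Real.exp (-‖x‖ ^ 2 / 8))).congr (.of_forall fun z => ?_)
    simp only [mehler]
    rw [mul_assoc _ (Real.exp (‖z‖ ^ 2 / 8)), ← Real.exp_add, neg_div _ (‖z‖ ^ 2), add_neg_cancel,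
      Real.exp_zero, mul_one]
  integral_eq x := by
    rw [← mul_one (Real.exp (-‖x‖ ^ 2 / 8)), ← integral_heatKernel_sub (one_sub_sq_pos h0 h1)
      (ρ • x), ← integral_const_mul]
    refine integral_congr_ae (.of_forall fun z => ?_)
    simp only [mehler]
    rw [mul_assoc _ (Real.exp (‖z‖ ^ 2 / 8)), ← Real.exp_add, neg_div _ (‖z‖ ^ 2), add_neg_cancel,
      Real.exp_zero, mul_one]

theorem memLp_gaussian_mul {n : ℕ} {b : ℝ} (hb : 0 ≤ b) (v : L2 n) :
    MemLp (fun ξ => Real.exp (-(b * ‖ξ‖ ^ 2)) * v ξ) 2 := by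
  refine (Lp.memLp v).mono ?_ (.of_forall fun ξ => ?_)
  · exact (by fun_prop : Continuous
      fun ξ : Rn n => Real.exp (-(b * ‖ξ‖ ^ 2))).aestronglyMeasurable.mul
      (Lp.aestronglyMeasurable v)
  · rw [norm_mul, Real.norm_of_nonneg (Real.exp_pos _).le]
    refine mul_le_of_le_one_left (norm_nonneg _) ?_
    rw [Real.exp_le_one_iff, neg_nonpos]
    positivity

theorem inner_mehlerOp {n : ℕ} {ρ : ℝ} (h0 : 0 < ρ) (h1 : ρ < 1) (v : L2 n) :
    inner ℝ ((isSchurKernel_mehler h0 h1).op v) v = ρ ^ (-(n : ℝ) / 2) *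
      inner ℝ ((isSchurKernel_heatKernel (div_pos (one_sub_sq_pos h0 h1) h0)).op
        ((memLp_gaussian_mul (mehlerExp_pos h0 h1).le v).toLp _))
        ((memLp_gaussian_mul (mehlerExp_pos h0 h1).le v).toLp _) := by
  rw [IsSchurKernel.inner_op, IsSchurKernel.inner_op, ← integral_const_mul]
  have hE := (memLp_gaussian_mul (mehlerExp_pos h0 h1).le v).coeFn_toLp
  refine integral_congr_ae ?_
  filter_upwards [hE] with x hx
  rw [← integral_const_mul]
  refine integral_congr_ae ?_
  filter_upwards [hE] with z hz
  rw [hx, hz, mehler_eq h0 h1]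
  ring

theorem isSymmContraction_mehlerOp {n : ℕ} {ρ : ℝ} (h0 : 0 < ρ) (h1 : ρ < 1) :
    IsSymmContraction (isSchurKernel_mehler (n := n) h0 h1).op :=
  (isSchurKernel_mehler h0 h1).isSymmContraction fun v => by
    rw [inner_mehlerOp h0 h1]
    exact mul_nonneg (by positivity)
      ((isSymmContraction_heatOp (div_pos (one_sub_sq_pos h0 h1) h0)).nonneg _)

theorem L2.integrable_sq {n : ℕ} (v : L2 n) : Integrable fun ξ => v ξ ^ 2 :=
  (Lp.memLp v).integrable_sq

/-- The heat operator between the Gaussians is at most `1`. For the generator `2Δ - |ξ|²/8 + n/2`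
this amounts to discarding the Laplacian and keeping the confining potential. -/
theorem inner_mehlerOp_le {n : ℕ} {ρ : ℝ} (h0 : 0 < ρ) (h1 : ρ < 1) (v : L2 n) :
    inner ℝ ((isSchurKernel_mehler h0 h1).op v) v ≤ ρ ^ (-(n : ℝ) / 2) *
      ∫ ξ, Real.exp (-(2 * mehlerExp ρ * ‖ξ‖ ^ 2)) * v ξ ^ 2 := by
  rw [inner_mehlerOp h0 h1]
  refine mul_le_mul_of_nonneg_left ?_ (by positivity)
  refine ((isSymmContraction_heatOp (div_pos (one_sub_sq_pos h0 h1) h0)).le_one _).trans_eq ?_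
  rw [L2.norm_sq_eq]
  refine integral_congr_ae ?_
  filter_upwards [(memLp_gaussian_mul (mehlerExp_pos h0 h1).le v).coeFn_toLp] with x hx
  rw [hx, mul_pow, ← Real.exp_nat_mul]
  congr 2
  push_cast
  ring

/-- A small Rayleigh quotient of the Mehler operator forces concentration near the origin. -/
theorem mehler_concentration {n : ℕ} {ρ : ℝ} (h0 : 0 < ρ) (h1 : ρ < 1) {w : L2 n} (hw : w ≠ 0)
    (δ : ℝ) (hδ : 0 ≤ δ) :
    (1 - Real.exp (-(2 * mehlerExp ρ * δ ^ 2))) * ∫ ξ in {ξ | δ ≤ ‖ξ‖}, w ξ ^ 2 ≤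
      (rayleigh (isSchurKernel_mehler h0 h1).op w + ρ ^ (-(n : ℝ) / 2) - 1) * ‖w‖ ^ 2 := by
  set b := 2 * mehlerExp ρ with hb
  have hbpos : 0 < b := by have := mehlerExp_pos h0 h1; positivity
  set c := ρ ^ (-(n : ℝ) / 2) with hc
  have hc1 : 1 ≤ c := Real.one_le_rpow_of_pos_of_le_one_of_nonpos h0 h1.le (by
    rw [neg_div, neg_nonpos]; positivity)
  have hS : MeasurableSet {ξ : Rn n | δ ≤ ‖ξ‖} := measurableSet_le measurable_const measurable_norm
  have hq : 0 ≤ (1 - Real.exp (-(b * δ ^ 2))) * ∫ ξ in {ξ : Rn n | δ ≤ ‖ξ‖}, w ξ ^ 2 := by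
    refine mul_nonneg ?_ (integral_nonneg fun _ => sq_nonneg _)
    rw [sub_nonneg, Real.exp_le_one_iff, neg_nonpos]
    positivity
  have hint : ∫ ξ, Real.exp (-(b * ‖ξ‖ ^ 2)) * w ξ ^ 2 ≤ ‖w‖ ^ 2 -
      (1 - Real.exp (-(b * δ ^ 2))) * ∫ ξ in {ξ : Rn n | δ ≤ ‖ξ‖}, w ξ ^ 2 := by
    rw [L2.norm_sq_eq, ← integral_indicator hS, ← integral_const_mul, ← integral_sub]
    rotate_left
    · exact L2.integrable_sq w
    · exact ((L2.integrable_sq w).indicator hS).const_mul _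
    refine integral_mono ?_ ((L2.integrable_sq w).sub
      (((L2.integrable_sq w).indicator hS).const_mul _)) fun ξ => ?_
    · refine (L2.integrable_sq w).bdd_mul (c := 1) ?_ (.of_forall fun ξ => ?_)
      · exact (by fun_prop : Continuous
          fun ξ : Rn n => Real.exp (-(b * ‖ξ‖ ^ 2))).aestronglyMeasurable
      · rw [Real.norm_of_nonneg (Real.exp_pos _).le, Real.exp_le_one_iff, neg_nonpos]
        positivity
    · simp only [Set.indicator_apply, mem_ofPred_eq]
      split_ifs with hξ
      · have : Real.exp (-(b * ‖ξ‖ ^ 2)) ≤ Real.exp (-(b * δ ^ 2)) := by gcongr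
        nlinarith [sq_nonneg (w ξ)]
      · rw [mul_zero, sub_zero]
        refine mul_le_of_le_one_left (sq_nonneg _) ?_
        rw [Real.exp_le_one_iff, neg_nonpos]
        positivity
  have hle := inner_mehlerOp_le h0 h1 w
  rw [IsSymmContraction.inner_eq w hw, ← hb, ← hc] at hle
  have hle2 := mul_le_mul_of_nonneg_left hint (zero_le_one.trans hc1)
  -- Since `1 ≤ c`, the factor `c` in front of the tail term may be dropped.
  nlinarith [mul_le_mul_of_nonneg_right hc1 hq]

/-! ### Parabolic rescaling -/

theorem quasiMeasurePreserving_add_smul {n : ℕ} {c : ℝ} (hc : c ≠ 0) (x₀ : Rn n) :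
    Measure.QuasiMeasurePreserving (fun ξ : Rn n => x₀ + c • ξ) volume volume := by
  have h1 : Measure.QuasiMeasurePreserving (fun ξ : Rn n => c • ξ) volume volume := by
    refine ⟨measurable_const_smul c, ?_⟩
    rw [Measure.map_addHaar_smul volume hc]
    exact Measure.smul_absolutelyContinuous
  exact (measurePreserving_add_left volume x₀).quasiMeasurePreserving.comp h1

theorem integral_comp_add_smul {n : ℕ} {c : ℝ} (hc : 0 < c) (x₀ : Rn n) (F : Rn n → ℝ) :
    ∫ ξ, F (x₀ + c • ξ) = (c ^ n)⁻¹ * ∫ x, F x := by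
  rw [Measure.integral_comp_smul volume (fun z => F (x₀ + z)) c, finrank_euclideanSpace_fin,
    integral_add_left_eq_self F x₀, abs_of_pos (by positivity), smul_eq_mul]

theorem memLp_rescale {n : ℕ} {c : ℝ} (hc : 0 < c) (x₀ : Rn n) (u : L2 n) :
    MemLp (fun ξ => Real.exp (-‖ξ‖ ^ 2 / 8) * u (x₀ + c • ξ)) 2 := by
  have hm : AEStronglyMeasurable (fun ξ => u (x₀ + c • ξ)) volume :=
    (Lp.aestronglyMeasurable u).comp_quasiMeasurePreserving
      (quasiMeasurePreserving_add_smul hc.ne' x₀)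
  have h1 : MemLp (fun ξ => u (x₀ + c • ξ)) 2 := by
    rw [memLp_two_iff_integrable_sq hm]
    exact ((L2.integrable_sq u).comp_add_left x₀).comp_smul hc.ne'
  refine h1.mono ?_ (.of_forall fun ξ => ?_)
  · exact (by fun_prop : Continuous
      fun ξ : Rn n => Real.exp (-‖ξ‖ ^ 2 / 8)).aestronglyMeasurable.mul hm
  · rw [norm_mul, Real.norm_of_nonneg (Real.exp_pos _).le]
    refine mul_le_of_le_one_left (norm_nonneg _) ?_
    rw [Real.exp_le_one_iff, neg_div, neg_nonpos]
    positivity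

/-- The function `u`, rescaled by `c` around `x₀` and multiplied by the square root of the Gaussian
weight. -/
def rescale {n : ℕ} {c : ℝ} (hc : 0 < c) (x₀ : Rn n) (u : L2 n) : L2 n :=
  (memLp_rescale hc x₀ u).toLp _

theorem rescale_ae {n : ℕ} {c : ℝ} (hc : 0 < c) (x₀ : Rn n) (u : L2 n) :
    rescale hc x₀ u =ᵐ[volume] fun ξ => Real.exp (-‖ξ‖ ^ 2 / 8) * u (x₀ + c • ξ) :=
  MemLp.coeFn_toLp _

/-- The weight is used with `ψ = 1`, for the norm, and with the indicator of a ball, for the mass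
near the centre. -/
theorem integral_mul_rescale_sq {n : ℕ} {c : ℝ} (hc : 0 < c) (x₀ : Rn n) (u : L2 n)
    (ψ : Rn n → ℝ) :
    ∫ ξ, ψ (x₀ + c • ξ) * rescale hc x₀ u ξ ^ 2 =
      (c ^ n)⁻¹ * ∫ x, ψ x * (Real.exp (-‖x - x₀‖ ^ 2 / (4 * c ^ 2)) * u x ^ 2) := by
  rw [← integral_comp_add_smul hc x₀]
  refine integral_congr_ae ?_
  filter_upwards [rescale_ae hc x₀ u] with ξ hξ
  rw [hξ, mul_pow, ← Real.exp_nat_mul, add_sub_cancel_left, norm_smul, mul_pow, Real.norm_eq_abs,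
    sq_abs]
  congr 3
  push_cast
  field_simp
  ring

theorem norm_rescale_sq {n : ℕ} {c : ℝ} (hc : 0 < c) (x₀ : Rn n) (u : L2 n) :
    ‖rescale hc x₀ u‖ ^ 2 =
      (c ^ n)⁻¹ * ∫ x, Real.exp (-‖x - x₀‖ ^ 2 / (4 * c ^ 2)) * u x ^ 2 := by
  have := integral_mul_rescale_sq hc x₀ u (fun _ => 1)
  simp only [one_mul] at this
  rw [L2.norm_sq_eq, this]

theorem heatKernel_smul {n : ℕ} {c t : ℝ} (hc : 0 < c) (ht : 0 < t) (z : Rn n) :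
    heatKernel (c ^ 2 * t) (c • z) = (c ^ n)⁻¹ * heatKernel t z := by
  unfold heatKernel
  rw [norm_smul, mul_pow, Real.norm_eq_abs, sq_abs, ← mul_assoc (c ^ n)⁻¹]
  congr 1
  · rw [show 4 * Real.pi * (c ^ 2 * t) = c ^ 2 * (4 * Real.pi * t) by ring,
      Real.mul_rpow (by positivity) (by positivity), ← Real.rpow_natCast c 2, ← Real.rpow_mul hc.le,
      ← Real.rpow_natCast c n, ← Real.rpow_neg hc.le]
    congr 2
    push_cast
    ring
  · congr 1
    field_simp

/-- Parabolic rescaling turns the heat semigroup into the Mehler semigroup. -/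
theorem integral_mehler_rescale {n : ℕ} {c ρ : ℝ} (hc : 0 < c) (h0 : 0 < ρ) (h1 : ρ < 1)
    (x₀ : Rn n) (u : Rn n → ℝ) (ξ : Rn n) :
    ∫ η, mehler ρ ξ η * (Real.exp (-‖η‖ ^ 2 / 8) * u (x₀ + c • η)) =
      Real.exp (-‖ξ‖ ^ 2 / 8) * heat (c ^ 2 * (1 - ρ ^ 2)) u (x₀ + (c * ρ) • ξ) := by
  have h2 : heat (c ^ 2 * (1 - ρ ^ 2)) u (x₀ + (c * ρ) • ξ) =
      ∫ η, heatKernel (1 - ρ ^ 2) (ρ • ξ - η) * u (x₀ + c • η) := by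
    have := integral_comp_add_smul hc x₀
      fun z => heatKernel (c ^ 2 * (1 - ρ ^ 2)) (x₀ + (c * ρ) • ξ - z) * u z
    rw [heat, ← mul_right_inj' (inv_ne_zero (pow_ne_zero n hc.ne')), ← this, ← integral_const_mul]
    refine integral_congr_ae (.of_forall fun η => ?_)
    simp only
    rw [← mul_assoc, ← heatKernel_smul hc (one_sub_sq_pos h0 h1), smul_sub, smul_smul]
    congr 2
    abel
  rw [h2, ← integral_const_mul]
  refine integral_congr_ae (.of_forall fun η => ?_)
  simp only [mehler]
  have : Real.exp (‖η‖ ^ 2 / 8) * Real.exp (-‖η‖ ^ 2 / 8) = 1 := by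
    rw [← Real.exp_add, neg_div, add_neg_cancel, Real.exp_zero]
  linear_combination (Real.exp (-‖ξ‖ ^ 2 / 8) * heatKernel (1 - ρ ^ 2) (ρ • ξ - η) *
    u (x₀ + c • η)) * this

/-- A step of an almost-solution of the heat equation, after parabolic rescaling. -/
theorem norm_rescale_sub_le {n : ℕ} {c c' ρ ε : ℝ} (hc : 0 < c) (hc' : 0 < c') (h0 : 0 < ρ)
    (h1 : ρ < 1) (hcc' : c' = c * ρ) (hε : 0 ≤ ε) (x₀ : Rn n) {u u' : L2 n}
    (h : ∀ᵐ x, |u' x - heat (c ^ 2 * (1 - ρ ^ 2)) u x| ≤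
      ε * heat (c ^ 2 * (1 - ρ ^ 2)) (fun z => |u z|) x) :
    ‖rescale hc' x₀ u' - (isSchurKernel_mehler h0 h1).op (rescale hc x₀ u)‖ ≤
      ε * ‖rescale hc x₀ u‖ := by
  refine (isSchurKernel_mehler h0 h1).norm_sub_op_le hε ?_
  have hR := rescale_ae hc x₀ u
  filter_upwards [(quasiMeasurePreserving_add_smul hc'.ne' x₀).ae h, rescale_ae hc' x₀ u']
    with ξ hξ hξ'
  have e1 : ∫ η, mehler ρ ξ η * rescale hc x₀ u η =
      Real.exp (-‖ξ‖ ^ 2 / 8) * heat (c ^ 2 * (1 - ρ ^ 2)) u (x₀ + c' • ξ) := by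
    rw [hcc', ← integral_mehler_rescale hc h0 h1]
    refine integral_congr_ae ?_
    filter_upwards [hR] with η hη
    rw [hη]
  have e2 : ∫ η, mehler ρ ξ η * |rescale hc x₀ u η| =
      Real.exp (-‖ξ‖ ^ 2 / 8) * heat (c ^ 2 * (1 - ρ ^ 2)) (fun z => |u z|) (x₀ + c' • ξ) := by
    rw [hcc', ← integral_mehler_rescale hc h0 h1]
    refine integral_congr_ae ?_
    filter_upwards [hR] with η hη
    rw [hη, abs_mul, abs_of_pos (Real.exp_pos _)]
  rw [e1, e2, hξ', ← mul_sub, abs_mul, abs_of_pos (Real.exp_pos _), mul_left_comm]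
  exact mul_le_mul_of_nonneg_left hξ (Real.exp_pos _).le

/-! ### Almost-solutions of the heat equation and their frequency -/

/-- Between any two times, `u` differs from the heat flow of its modulus by a factor that is
exponential in time. Solutions of `∂ₜu - Δu + Vu = 0` with `|V| ≤ M` have this property. -/
def IsDominated {n : ℕ} (u : ℝ → L2 n) (M a b : ℝ) : Prop :=
  ∀ s t : ℝ, a ≤ s → s < t → t ≤ b → ∀ᵐ x, |u t x - heat (t - s) (u s) x| ≤
    (Real.exp (M * (t - s)) - 1) * heat (t - s) (fun z => |u s z|) x

theorem rescale_congr {n : ℕ} {c c' : ℝ} (hc : 0 < c) (hc' : 0 < c') (x₀ : Rn n) {u u' : L2 n}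
    (h : c = c') (hu : u = u') : rescale hc x₀ u = rescale hc' x₀ u' := by
  subst h hu
  rfl

/-- The scales `c₀ ρ ^ k` decrease geometrically from `c₀` to `c₁`, and the scale `c` belongs to the
time `b + c₁² - c²`. Every step is then an almost-step of the same Mehler operator, and
`mul_rayleigh_le` applies. -/
theorem IsDominated.rayleigh_le {n : ℕ} {u : ℝ → L2 n} {M a b : ℝ} (hu : IsDominated u M a b)
    (hM : 0 ≤ M) {c₀ c₁ : ℝ} (hc₁ : 0 < c₁) (hc₀ : 0 < c₀) (hlt : c₁ < c₀)
    (hab : c₀ ^ 2 - c₁ ^ 2 = b - a) (x₀ : Rn n) {Y : ℝ} (hne : rescale hc₁ x₀ (u b) ≠ 0)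
    (hY : ‖rescale hc₀ x₀ (u a)‖ ^ 2 ≤ Real.exp Y * ‖rescale hc₁ x₀ (u b)‖ ^ 2) {m : ℕ}
    (hm : 0 < m) {s ε : ℝ} (hs : s = Real.log (c₀ / c₁) / m)
    (hε : ε = Real.exp (2 * M * c₀ ^ 2 * s) - 1)
    (hsmall : (Y + 4 * (m * ε) ^ 2 + 2 * (m * ε)) / m + ε < 1 / 2) {ρ : ℝ} (h0 : 0 < ρ) (h1 : ρ < 1)
    (hρ : ρ = Real.exp (-s)) :
    rayleigh (isSchurKernel_mehler h0 h1).op (rescale hc₁ x₀ (u b)) ≤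
      (Y + 4 * (m * ε) ^ 2 + 2 * (m * ε)) / m := by
  have hm' : (m : ℝ) ≠ 0 := by exact_mod_cast hm.ne'
  have hc : ∀ k : ℕ, 0 < c₀ * ρ ^ k := fun k => by positivity
  have hck : ∀ k : ℕ, c₀ * ρ ^ k ≤ c₀ := fun k =>
    mul_le_of_le_one_right hc₀.le (pow_le_one₀ h0.le h1.le)
  have hcm : c₀ * ρ ^ m = c₁ := by
    rw [hρ, ← Real.exp_nat_mul, hs, mul_neg, mul_div_cancel₀ _ hm', Real.exp_neg,
      Real.exp_log (by positivity)]
    field_simp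
  have hmono : ∀ k ≤ m, c₁ ≤ c₀ * ρ ^ k := fun k hk => by
    rw [← hcm]
    exact mul_le_mul_of_nonneg_left (pow_le_pow_of_le_one h0.le h1.le hk) hc₀.le
  set w : ℕ → L2 n := fun k => rescale (hc k) x₀ (u (b + c₁ ^ 2 - (c₀ * ρ ^ k) ^ 2)) with hw
  have hw0 : w 0 = rescale hc₀ x₀ (u a) := by
    refine rescale_congr _ _ _ (by simp) ?_
    congr 1
    rw [pow_zero, mul_one]
    linarith
  have hwm : w m = rescale hc₁ x₀ (u b) := by
    refine rescale_congr _ _ _ hcm ?_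
    congr 1
    rw [hcm]
    ring
  have hspos : 0 ≤ s := by
    rw [hs]
    exact div_nonneg (Real.log_nonneg ((one_le_div hc₁).2 hlt.le)) (Nat.cast_nonneg m)
  have hε0 : 0 ≤ ε := by
    rw [hε, sub_nonneg, Real.one_le_exp_iff]
    positivity
  have hstep : ∀ k < m, ‖w (k + 1) - (isSchurKernel_mehler h0 h1).op (w k)‖ ≤ ε * ‖w k‖ := by
    intro k hk
    refine norm_rescale_sub_le (hc k) (hc (k + 1)) h0 h1 (by ring) hε0 x₀ ?_
    have hsub := one_sub_sq_pos h0 h1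
    have hd : b + c₁ ^ 2 - (c₀ * ρ ^ (k + 1)) ^ 2 - (b + c₁ ^ 2 - (c₀ * ρ ^ k) ^ 2) =
        (c₀ * ρ ^ k) ^ 2 * (1 - ρ ^ 2) := by ring
    have hdpos : 0 < (c₀ * ρ ^ k) ^ 2 * (1 - ρ ^ 2) := mul_pos (pow_pos (hc k) 2) hsub
    have h2 := hu (b + c₁ ^ 2 - (c₀ * ρ ^ k) ^ 2) (b + c₁ ^ 2 - (c₀ * ρ ^ (k + 1)) ^ 2)
      (by have := pow_le_pow_left₀ (hc k).le (hck k) 2; linarith) (by linarith)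
      (by have := pow_le_pow_left₀ hc₁.le (hmono (k + 1) hk) 2; linarith)
    rw [hd] at h2
    filter_upwards [h2] with x hx
    refine hx.trans (mul_le_mul_of_nonneg_right ?_
      (heat_nonneg hdpos (.of_forall fun z => abs_nonneg _) x))
    rw [hε]
    -- The time steps differ in length, but none exceeds `2 c₀² s`; this is why one `ε` serves them
    -- all.
    have h3 : 1 - ρ ^ 2 ≤ 2 * s := by
      have := Real.add_one_le_exp (-(2 * s))
      have h4 : ρ ^ 2 = Real.exp (-(2 * s)) := by
        rw [hρ, ← Real.exp_nat_mul]; push_cast; ring_nf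
      linarith
    have h5 : (c₀ * ρ ^ k) ^ 2 * (1 - ρ ^ 2) ≤ c₀ ^ 2 * (2 * s) :=
      mul_le_mul (pow_le_pow_left₀ (hc k).le (hck k) 2) h3 hsub.le (by positivity)
    have h6 : M * ((c₀ * ρ ^ k) ^ 2 * (1 - ρ ^ 2)) ≤ 2 * M * c₀ ^ 2 * s := by
      calc _ ≤ M * (c₀ ^ 2 * (2 * s)) := mul_le_mul_of_nonneg_left h5 hM
        _ = _ := by ring
    have := Real.exp_le_exp.2 h6
    linarith
  have := (isSymmContraction_mehlerOp h0 h1).mul_rayleigh_le hm hstep (by rwa [hwm]) (Y := Y)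
    (by rwa [hw0, hwm]) hsmall
  rwa [hwm] at this

/-- Slopes along the sequence `S / m`. -/
theorem tendsto_mul_of_hasDerivAt_zero {g : ℝ → ℝ} {g' S : ℝ} (hg : HasDerivAt g g' 0)
    (hg0 : g 0 = 0) (hS : 0 < S) :
    Tendsto (fun m : ℕ => (m : ℝ) / S * g (S / m)) atTop (𝓝 g') := by
  have h1 : Tendsto (fun m : ℕ => S / (m : ℝ)) atTop (𝓝[≠] 0) := by
    rw [tendsto_nhdsWithin_iff]
    refine ⟨tendsto_const_div_atTop_nhds_zero_nat S, ?_⟩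
    filter_upwards [eventually_gt_atTop 0] with m hm
    have : (0 : ℝ) < m := by exact_mod_cast hm
    exact (div_pos hS this).ne'
  refine (hg.tendsto_slope_zero.comp h1).congr fun m => ?_
  simp [hg0, inv_div]

/-- The slope `d / 8` is the potential `|ξ|²/8` of the generator at `|ξ|² = d`. -/
theorem hasDerivAt_mehler_factor (d : ℝ) :
    HasDerivAt (fun s => 1 - Real.exp (-(2 * mehlerExp (Real.exp (-s)) * d))) (d / 8) 0 := by
  have h1 : HasDerivAt (fun s : ℝ => Real.exp (-s)) (-1) 0 := by
    simpa using (hasDerivAt_neg (0 : ℝ)).exp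
  have h2 : HasDerivAt (fun s : ℝ => mehlerExp (Real.exp (-s))) (1 / 16) 0 := by
    unfold mehlerExp
    have := (h1.const_sub 1).div ((h1.const_add 1).const_mul 8) (by norm_num)
    refine this.congr_deriv ?_
    norm_num
  have h3 := (((h2.const_mul 2).mul_const d).neg.exp).const_sub 1
  refine h3.congr_deriv ?_
  simp only [Pi.neg_apply, mehlerExp, neg_zero, Real.exp_zero, sub_self, zero_div, mul_zero,
    zero_mul]
  ring

/-- The mass of a rescaled almost-solution away from the origin, in terms of the growth of its
Gaussian weighted norm. -/
theorem IsDominated.concentration {n : ℕ} {u : ℝ → L2 n} {M a b : ℝ} (hu : IsDominated u M a b)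
    (hM : 0 ≤ M) {c₀ c₁ : ℝ} (hc₁ : 0 < c₁) (hc₀ : 0 < c₀) (hlt : c₁ < c₀)
    (hab : c₀ ^ 2 - c₁ ^ 2 = b - a) (x₀ : Rn n) {Y : ℝ} (hne : rescale hc₁ x₀ (u b) ≠ 0)
    (hY : ‖rescale hc₀ x₀ (u a)‖ ^ 2 ≤ Real.exp Y * ‖rescale hc₁ x₀ (u b)‖ ^ 2)
    {δ : ℝ} (hδ : 0 ≤ δ) {S e : ℝ} (hS : S = Real.log (c₀ / c₁)) (he : e = 2 * M * c₀ ^ 2 * S) :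
    δ ^ 2 / 8 * ∫ ξ in {ξ | δ ≤ ‖ξ‖}, rescale hc₁ x₀ (u b) ξ ^ 2 ≤
      ((Y + 4 * e ^ 2 + 2 * e) / S + n / 2) * ‖rescale hc₁ x₀ (u b)‖ ^ 2 := by
  have hSpos : 0 < S := by rw [hS]; exact Real.log_pos ((one_lt_div hc₁).2 hlt)
  set w := rescale hc₁ x₀ (u b) with hw
  set ε : ℕ → ℝ := fun m => Real.exp (2 * M * c₀ ^ 2 * (S / m)) - 1 with hε
  have hd1 : HasDerivAt (fun s : ℝ => Real.exp (2 * M * c₀ ^ 2 * s) - 1) (2 * M * c₀ ^ 2) 0 := by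
    have := (((hasDerivAt_id (0 : ℝ)).const_mul (2 * M * c₀ ^ 2)).exp).sub_const 1
    simpa using this
  have hd2 : HasDerivAt (fun s : ℝ => Real.exp (-s) ^ (-(n : ℝ) / 2) - 1) ((n : ℝ) / 2) 0 := by
    have h : ∀ s : ℝ, Real.exp (-s) ^ (-(n : ℝ) / 2) = Real.exp ((n : ℝ) / 2 * s) := fun s => by
      rw [← Real.exp_mul]; ring_nf
    simp_rw [h]
    have := (((hasDerivAt_id (0 : ℝ)).const_mul ((n : ℝ) / 2)).exp).sub_const 1
    simpa using this
  have t1 : Tendsto (fun m : ℕ => (m : ℝ) * ε m) atTop (𝓝 e) := by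
    have := (tendsto_mul_of_hasDerivAt_zero hd1 (by simp) hSpos).const_mul S
    rw [show S * (2 * M * c₀ ^ 2) = e by rw [he]; ring] at this
    refine this.congr fun m => ?_
    rw [← mul_assoc, show S * (m / S) = m by field_simp]
  have t2 := tendsto_mul_of_hasDerivAt_zero hd2 (by simp) hSpos
  have t3 := tendsto_mul_of_hasDerivAt_zero (hasDerivAt_mehler_factor (δ ^ 2))
    (by simp [mehlerExp]) hSpos
  have tN : Tendsto (fun m : ℕ => Y + 4 * (m * ε m) ^ 2 + 2 * (m * ε m)) atTop
      (𝓝 (Y + 4 * e ^ 2 + 2 * e)) :=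
    (((t1.pow 2).const_mul 4).const_add Y).add (t1.const_mul 2)
  have tN0 : Tendsto (fun m : ℕ => (Y + 4 * (m * ε m) ^ 2 + 2 * (m * ε m)) / (m : ℝ)) atTop
      (𝓝 0) := tN.div_atTop tendsto_natCast_atTop_atTop
  have tε : Tendsto ε atTop (𝓝 0) := by
    have := t1.div_atTop (tendsto_natCast_atTop_atTop (R := ℝ))
    refine this.congr' ?_
    filter_upwards [eventually_gt_atTop 0] with m hm
    have : (m : ℝ) ≠ 0 := by exact_mod_cast hm.ne'
    field_simp
  have tsmall := tN0.add tε
  rw [add_zero] at tsmall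
  -- With steps of length `S / m`, the bound of `mehler_concentration` is divided by the step length
  -- before `m → ∞`. The quotient contributes `(Y + 4e² + 2e) / S`, and `ρ ^ (-n/2) - 1` contributes
  -- `n / 2`.
  refine le_of_tendsto_of_tendsto (t3.mul_const _) (((tN.div_const S).add t2).mul_const _) ?_
  filter_upwards [eventually_gt_atTop 0, tsmall.eventually (gt_mem_nhds (one_half_pos))]
    with m hm hmsmall
  have hm' : (0 : ℝ) < m := by exact_mod_cast hm
  have hsm : 0 < S / m := div_pos hSpos hm'
  have h0 : 0 < Real.exp (-(S / m)) := Real.exp_pos _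
  have h1 : Real.exp (-(S / m)) < 1 := by rw [Real.exp_lt_one_iff]; linarith
  have hray := hu.rayleigh_le hM hc₁ hc₀ hlt hab x₀ hne hY hm (s := S / m) (ε := ε m)
    (by rw [hS]) rfl hmsmall h0 h1 rfl
  have hcon := mehler_concentration h0 h1 hne δ hδ
  have hle := mul_le_mul_of_nonneg_left (hcon.trans (mul_le_mul_of_nonneg_right
    (sub_le_sub_right (add_le_add_left hray _) 1) (sq_nonneg _))) (div_pos hm' hSpos).le
  refine (mul_assoc _ _ _).trans_le (hle.trans_eq ?_)
  field_simp
  ring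

/-! ### The local interpolation estimate -/

/-- The three conditions make each of the three error terms of the concentration bound at most `r² /
48`. They hold for small `l` because `log (1/l)` diverges while `l log l` tends to `0`. -/
theorem eventually_small_scale (N : ℕ) {r R T : ℝ} (hr : 0 < r) (hT : 0 < T) (M : ℝ) :
    ∃ l₀ : ℝ, 0 < l₀ ∧ l₀ ≤ 1 ∧ ∀ l : ℝ, 0 < l → l ≤ l₀ →
      24 * R ^ 2 / r ^ 2 < 1 / 2 * Real.log ((T + l) / l) ∧
      l * (16 * M ^ 2 * (T + l) ^ 2 * (1 / 2 * Real.log ((T + l) / l)) + 4 * M * (T + l))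
        ≤ r ^ 2 / 48 ∧
      l * (N / 2) ≤ r ^ 2 / 48 := by
  have hr2 : 0 < r ^ 2 / 48 := by positivity
  have e1 : ∀ᶠ l : ℝ in 𝓝[>] 0, 24 * R ^ 2 / r ^ 2 < 1 / 2 * Real.log ((T + l) / l) := by
    have h : 0 < T * Real.exp (-(2 * (24 * R ^ 2 / r ^ 2))) := by positivity
    filter_upwards [self_mem_nhdsWithin, nhdsWithin_le_nhds (gt_mem_nhds h)] with l hl hlt
    have hl0 : 0 < l := hl
    have h1 : 2 * (24 * R ^ 2 / r ^ 2) < Real.log ((T + l) / l) := by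
      rw [Real.lt_log_iff_exp_lt (by positivity), lt_div_iff₀ hl0]
      rw [Real.exp_neg, ← div_eq_mul_inv, lt_div_iff₀ (Real.exp_pos _)] at hlt
      linarith
    linarith
  have e2 : ∀ᶠ l : ℝ in 𝓝[>] 0, l * (16 * M ^ 2 * (T + l) ^ 2 *
      (1 / 2 * Real.log ((T + l) / l)) + 4 * M * (T + l)) < r ^ 2 / 48 := by
    have hc : ContinuousAt (fun l : ℝ => 16 * M ^ 2 * (T + l) ^ 2 *
        (1 / 2 * (l * Real.log (T + l) - l * Real.log l)) + l * (4 * M * (T + l))) 0 := by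
      have h1 : ContinuousAt (fun l : ℝ => Real.log (T + l)) 0 :=
        ContinuousAt.log (by fun_prop) (by simpa using hT.ne')
      have h2 : ContinuousAt (fun l : ℝ => l * Real.log l) 0 := Real.continuous_mul_log.continuousAt
      fun_prop
    have h0 : (16 * M ^ 2 * (T + 0) ^ 2 *
        (1 / 2 * (0 * Real.log (T + 0) - 0 * Real.log 0)) + 0 * (4 * M * (T + 0))) <
        r ^ 2 / 48 := by
      simpa using pow_pos hr 2
    have hev := hc.eventually (gt_mem_nhds h0)
    filter_upwards [self_mem_nhdsWithin, nhdsWithin_le_nhds hev] with l hl hlt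
    have hl0 : 0 < l := hl
    rw [Real.log_div (by positivity) (by positivity)]
    refine lt_of_eq_of_lt ?_ hlt
    ring
  have e3 : ∀ᶠ l : ℝ in 𝓝[>] 0, l * ((N : ℝ) / 2) < r ^ 2 / 48 := by
    have hc : ContinuousAt (fun l : ℝ => l * ((N : ℝ) / 2)) 0 := by fun_prop
    have h0 : 0 * ((N : ℝ) / 2) < r ^ 2 / 48 := by simpa using hr2
    exact nhdsWithin_le_nhds (hc.eventually (gt_mem_nhds h0))
  obtain ⟨d, hd, hsub⟩ := mem_nhdsGT_iff_exists_Ioo_subset.1 (e1.and (e2.and e3))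
  have hd0 : 0 < d := hd
  refine ⟨min 1 (d / 2), by positivity, min_le_left _ _, fun l hl hle => ?_⟩
  have := hsub ⟨hl, (hle.trans (min_le_right _ _)).trans_lt (by linarith)⟩
  exact ⟨this.1, this.2.1.le, this.2.2.le⟩

theorem integrable_gaussian_mul_sq {n : ℕ} (x₀ : Rn n) {c : ℝ} (hc : 0 < c) (u : L2 n) :
    Integrable fun x => Real.exp (-‖x - x₀‖ ^ 2 / c) * u x ^ 2 := by
  refine (L2.integrable_sq u).bdd_mul (c := 1) ?_ (.of_forall fun ξ => ?_)
  · exact (by fun_prop : Continuous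
      fun x : Rn n => Real.exp (-‖x - x₀‖ ^ 2 / c)).aestronglyMeasurable
  · rw [Real.norm_of_nonneg (Real.exp_pos _).le, Real.exp_le_one_iff, neg_div, neg_nonpos]
    positivity

theorem exp_neg_sq_div_le_one {n : ℕ} (x : Rn n) {c : ℝ} (hc : 0 < c) :
    Real.exp (-‖x‖ ^ 2 / c) ≤ 1 := by
  rw [Real.exp_le_one_iff, neg_div, neg_nonpos]
  positivity

theorem setIntegral_ball_le {n : ℕ} (x₀ : Rn n) {R c : ℝ} (hc : 0 < c) (u : L2 n) :
    Real.exp (-(R ^ 2 / c)) * ∫ x in Metric.ball x₀ R, u x ^ 2 ≤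
      ∫ x, Real.exp (-‖x - x₀‖ ^ 2 / c) * u x ^ 2 := by
  classical
  rw [← integral_const_mul, ← integral_indicator Metric.isOpen_ball.measurableSet]
  refine integral_mono (((L2.integrable_sq u).const_mul _).indicator
    Metric.isOpen_ball.measurableSet) (integrable_gaussian_mul_sq x₀ hc u) fun x => ?_
  simp only [Set.indicator_apply]
  split_ifs with hx
  · rw [Metric.mem_ball, dist_eq_norm] at hx
    refine mul_le_mul_of_nonneg_right (Real.exp_le_exp.2 ?_) (sq_nonneg _)
    rw [neg_div, neg_le_neg_iff]
    have := norm_nonneg (x - x₀)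
    gcongr
  · positivity

/-- The part of a rescaled function inside a ball. -/
theorem setIntegral_rescale_le {n : ℕ} {c r : ℝ} (hc : 0 < c) (x₀ : Rn n) (u : L2 n) :
    ∫ ξ in {ξ | r / c ≤ ‖ξ‖}ᶜ, rescale hc x₀ u ξ ^ 2 ≤
      (c ^ n)⁻¹ * ∫ x in Metric.ball x₀ r, u x ^ 2 := by
  classical
  have hS : MeasurableSet {ξ : Rn n | r / c ≤ ‖ξ‖}ᶜ :=
    (measurableSet_le measurable_const measurable_norm).compl
  have h1 := integral_mul_rescale_sq hc x₀ u ((Metric.ball x₀ r).indicator 1)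
  have h2 : ∫ ξ in {ξ | r / c ≤ ‖ξ‖}ᶜ, rescale hc x₀ u ξ ^ 2 =
      ∫ ξ, (Metric.ball x₀ r).indicator 1 (x₀ + c • ξ) * rescale hc x₀ u ξ ^ 2 := by
    rw [← integral_indicator hS]
    refine integral_congr_ae (.of_forall fun ξ => ?_)
    have hiff : ξ ∈ {ξ : Rn n | r / c ≤ ‖ξ‖}ᶜ ↔ x₀ + c • ξ ∈ Metric.ball x₀ r := by
      rw [mem_compl_iff, mem_ofPred_eq, not_le, Metric.mem_ball, dist_eq_norm,
        add_sub_cancel_left, norm_smul, Real.norm_of_nonneg hc.le, lt_div_iff₀ hc, mul_comm]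
    simp only [Set.indicator_apply, hiff]
    split_ifs <;> simp
  rw [h2, h1]
  refine mul_le_mul_of_nonneg_left ?_ (by positivity)
  rw [← integral_indicator Metric.isOpen_ball.measurableSet]
  refine integral_mono_of_nonneg (.of_forall fun x => ?_)
    ((L2.integrable_sq u).indicator Metric.isOpen_ball.measurableSet) (.of_forall fun x => ?_)
  · simp only [Set.indicator_apply]
    split_ifs
    · simp only [Pi.one_apply, one_mul, Pi.zero_apply]
      positivity
    · simp
  · simp only [Set.indicator_apply]
    split_ifs
    · simp only [Pi.one_apply, one_mul]
      exact mul_le_of_le_one_left (sq_nonneg _) (exp_neg_sq_div_le_one _ (by positivity))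
    · simp

/-- At a small scale `l` half of the Gaussian mass lies in the `r`-ball, while replacing this mass
by that of the `R`-ball costs `exp (R² / (4l))`. The admissible `l` depends on `u` only through the
ratio of initial to final mass, and that cost is then a constant times this ratio. -/
theorem IsDominated.local_estimate (n : ℕ) {r R T M : ℝ} (hr : 0 < r) (hR : 0 < R) (hT : 0 < T)
    (hM : 0 ≤ M) : ∃ C : ℝ, 0 < C ∧ ∀ (u : ℝ → L2 n) (a b : ℝ), b - a = T → IsDominated u M a b →
      ∀ x₀ : Rn n, (∫ x in Metric.ball x₀ R, u b x ^ 2) ^ 2 ≤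
        C * (∫ x in Metric.ball x₀ r, u b x ^ 2) *
          ((∫ x, Real.exp (-‖x - x₀‖ ^ 2 / (4 * (T + 1))) * u a x ^ 2) +
            ∫ x in Metric.ball x₀ R, u b x ^ 2) := by
  obtain ⟨l₀, hl₀, hl₀1, hsc⟩ := eventually_small_scale n (R := R) hr hT M
  refine ⟨2 * Real.exp (R ^ 2 / (4 * l₀)), by positivity, ?_⟩
  intro u a b hab hu x₀
  set ER := ∫ x in Metric.ball x₀ R, u b x ^ 2 with hER
  set Er := ∫ x in Metric.ball x₀ r, u b x ^ 2 with hEr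
  set G := ∫ x, Real.exp (-‖x - x₀‖ ^ 2 / (4 * (T + 1))) * u a x ^ 2 with hG
  have hER0 : 0 ≤ ER := integral_nonneg fun _ => sq_nonneg _
  have hEr0 : 0 ≤ Er := integral_nonneg fun _ => sq_nonneg _
  have hG0 : 0 ≤ G := integral_nonneg fun _ => by positivity
  rcases hER0.eq_or_lt with h0 | hERpos
  · rw [← h0, add_zero, zero_pow two_ne_zero]
    exact mul_nonneg (by positivity) hG0
  set Λ := Real.log ((G + ER) / ER) with hΛ
  have hratio : 1 ≤ (G + ER) / ER := by
    rw [one_le_div hERpos]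
    linarith
  have hΛ0 : 0 ≤ Λ := Real.log_nonneg hratio
  -- This choice gives `exp (R² / (4l)) = exp (R² / (4l₀)) * (G + ER) / ER`, the source of the
  -- exponent `1/2`. It also keeps `l * Λ ≤ R² / 4`, so that the growth of the norm costs no more
  -- than the localisation.
  obtain ⟨l, hl⟩ : ∃ l : ℝ, l = (1 / l₀ + 4 * Λ / R ^ 2)⁻¹ := ⟨_, rfl⟩
  have hlpos : 0 < l := by rw [hl]; positivity
  have hlinv : 1 / l = 1 / l₀ + 4 * Λ / R ^ 2 := by rw [hl, one_div, inv_inv]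
  have hll₀ : l ≤ l₀ := by
    refine (one_div_le_one_div hl₀ hlpos).1 ?_
    rw [hlinv]
    have : 0 ≤ 4 * Λ / R ^ 2 := by positivity
    linarith
  have hRl : R ^ 2 / (4 * l) = R ^ 2 / (4 * l₀) + Λ := by
    have : R ^ 2 / (4 * l) = R ^ 2 / 4 * (1 / l) := by ring
    rw [this, hlinv]
    field_simp
  have hlΛ : l * Λ ≤ R ^ 2 / 4 := by
    have h1 : Λ ≤ R ^ 2 / (4 * l) := by
      rw [hRl]
      have : 0 ≤ R ^ 2 / (4 * l₀) := by positivity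
      linarith
    calc l * Λ ≤ l * (R ^ 2 / (4 * l)) := by gcongr
      _ = _ := by field_simp
  obtain ⟨hs1, hs2, hs3⟩ := hsc l hlpos hll₀
  have hc₁ : 0 < √l := Real.sqrt_pos.2 hlpos
  have hc₀ : 0 < √(T + l) := Real.sqrt_pos.2 (by positivity)
  have hc₁sq : √l ^ 2 = l := Real.sq_sqrt hlpos.le
  have hc₀sq : √(T + l) ^ 2 = T + l := Real.sq_sqrt (by positivity)
  have hlt : √l < √(T + l) := Real.sqrt_lt_sqrt hlpos.le (by linarith)
  obtain ⟨S, hS⟩ : ∃ S, S = 1 / 2 * Real.log ((T + l) / l) := ⟨_, rfl⟩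
  have hS' : S = Real.log (√(T + l) / √l) := by
    rw [hS, ← Real.sqrt_div (by positivity), Real.log_sqrt (by positivity)]
    ring
  rw [← hS] at hs1 hs2
  have hSpos : 0 < S := lt_of_le_of_lt (by positivity) hs1
  set W := ∫ x, Real.exp (-‖x - x₀‖ ^ 2 / (4 * l)) * u b x ^ 2 with hW
  set w := rescale hc₁ x₀ (u b) with hw
  have hwn : ‖w‖ ^ 2 = (√l ^ n)⁻¹ * W := by rw [hw, norm_rescale_sq, hc₁sq]
  have hWER : Real.exp (-(R ^ 2 / (4 * l))) * ER ≤ W := setIntegral_ball_le x₀ (by positivity) _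
  have hWpos : 0 < W := lt_of_lt_of_le (by positivity) hWER
  have hwpos : 0 < ‖w‖ ^ 2 := by rw [hwn]; positivity
  have hwne : w ≠ 0 := by
    rintro h
    rw [h, norm_zero] at hwpos
    norm_num at hwpos
  have hERW : ER ≤ Real.exp (R ^ 2 / (4 * l)) * W := by
    rwa [Real.exp_neg, inv_mul_le_iff₀ (Real.exp_pos _)] at hWER
  have hexpΛ : Real.exp Λ * ER = G + ER := by
    rw [hΛ, Real.exp_log (by positivity)]
    field_simp
  have hY : ‖rescale hc₀ x₀ (u a)‖ ^ 2 ≤ Real.exp (Λ + R ^ 2 / (4 * l)) * ‖w‖ ^ 2 := by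
    rw [norm_rescale_sq, hc₀sq, hwn]
    have h1 : ∫ x, Real.exp (-‖x - x₀‖ ^ 2 / (4 * (T + l))) * u a x ^ 2 ≤ G := by
      refine integral_mono (integrable_gaussian_mul_sq x₀ (by positivity) _)
        (integrable_gaussian_mul_sq x₀ (by positivity) _) fun x => ?_
      refine mul_le_mul_of_nonneg_right (Real.exp_le_exp.2 ?_) (sq_nonneg _)
      rw [neg_div, neg_div, neg_le_neg_iff]
      have := hll₀.trans hl₀1
      gcongr
    have h2 : (√(T + l) ^ n)⁻¹ ≤ (√l ^ n)⁻¹ := by gcongr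
    calc _ ≤ (√l ^ n)⁻¹ * G := mul_le_mul h2 h1 (integral_nonneg fun _ => by positivity)
          (by positivity)
      _ ≤ (√l ^ n)⁻¹ * (Real.exp Λ * (Real.exp (R ^ 2 / (4 * l)) * W)) := by
          gcongr
          calc G ≤ G + ER := by linarith
            _ = Real.exp Λ * ER := hexpΛ.symm
            _ ≤ _ := by gcongr
      _ = _ := by rw [Real.exp_add]; ring
  have hcon := hu.concentration hM hc₁ hc₀ hlt (by rw [hc₀sq, hc₁sq]; linarith) x₀ hwne hY
    (δ := r / √l) (by positivity) hS' rfl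
  rw [hc₀sq, div_pow, hc₁sq, ← hw] at hcon
  -- After multiplication by `l` there are three terms, each at most `r² / 48`. Their sum `r² / 16`
  -- leaves at most half of the mass outside the ball.
  have hX : (Λ + R ^ 2 / (4 * l) + 4 * (2 * M * (T + l) * S) ^ 2 + 2 * (2 * M * (T + l) * S)) / S +
      n / 2 ≤ r ^ 2 / l / 8 * (1 / 2) := by
    have h1 : (Λ + R ^ 2 / (4 * l) + 4 * (2 * M * (T + l) * S) ^ 2 +
        2 * (2 * M * (T + l) * S)) / S + n / 2 = ((l * Λ + R ^ 2 / 4) / S +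
        l * (16 * M ^ 2 * (T + l) ^ 2 * S + 4 * M * (T + l)) + l * (n / 2)) / l := by
      field_simp
      ring
    have h2 : (l * Λ + R ^ 2 / 4) / S ≤ r ^ 2 / 48 := by
      rw [div_le_iff₀ hSpos]
      rw [div_lt_iff₀ (by positivity)] at hs1
      linarith
    rw [h1, div_le_iff₀ hlpos]
    have h3 : r ^ 2 / l / 8 * (1 / 2) * l = r ^ 2 / 16 := by field_simp; norm_num
    rw [h3]
    linarith
  have hQ : ∫ ξ in {ξ | r / √l ≤ ‖ξ‖}, w ξ ^ 2 ≤ 1 / 2 * ‖w‖ ^ 2 := by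
    have h1 := hcon.trans (mul_le_mul_of_nonneg_right hX hwpos.le)
    rw [mul_assoc] at h1
    exact le_of_mul_le_mul_left h1 (by positivity)
  have hsplit : (∫ ξ in {ξ | r / √l ≤ ‖ξ‖}, w ξ ^ 2) + ∫ ξ in {ξ | r / √l ≤ ‖ξ‖}ᶜ, w ξ ^ 2 =
      ‖w‖ ^ 2 := by
    rw [L2.norm_sq_eq]
    exact integral_add_compl (measurableSet_le measurable_const measurable_norm)
      (L2.integrable_sq w)
  have hin : ∫ ξ in {ξ | r / √l ≤ ‖ξ‖}ᶜ, w ξ ^ 2 ≤ (√l ^ n)⁻¹ * Er :=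
    setIntegral_rescale_le hc₁ x₀ (u b)
  have hWEr : W ≤ 2 * Er := by
    have h1 : (√l ^ n)⁻¹ * W ≤ (√l ^ n)⁻¹ * (2 * Er) := by
      rw [← hwn]
      linarith
    exact le_of_mul_le_mul_left h1 (by positivity)
  calc ER ^ 2 = ER * ER := sq _
    _ ≤ Real.exp (R ^ 2 / (4 * l)) * (2 * Er) * ER := by
        refine mul_le_mul_of_nonneg_right (hERW.trans ?_) hER0
        gcongr
    _ = 2 * Real.exp (R ^ 2 / (4 * l₀)) * Er * (Real.exp Λ * ER) := by
        rw [hRl, Real.exp_add]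
        ring
    _ = _ := by rw [hexpΛ]

/-! ### Summation over separated points -/

/-- Each Gaussian is at most the mean over its ball of a wider Gaussian, because `|z - y|² ≤ 2 |z -
p|² + 2 r²` there. The balls are disjoint, so the sum is at most one integral. -/
theorem tsum_gaussian_le (n : ℕ) {r c : ℝ} (hr : 0 < r) (hc : 0 < c) :
    ∃ D : ℝ, 0 ≤ D ∧ ∀ p : ℕ → Rn n,
      Pairwise (Function.onFun Disjoint fun j => Metric.ball (p j) r) → ∀ z : Rn n,
      ∑' j, ENNReal.ofReal (Real.exp (-‖z - p j‖ ^ 2 / c)) ≤ ENNReal.ofReal D := by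
  obtain ⟨g, hg⟩ : ∃ g : Rn n → ℝ, g = fun y =>
    Real.exp (r ^ 2 / c) * Real.exp (-‖y‖ ^ 2 / (2 * c)) := ⟨_, rfl⟩
  have hgc : Continuous g := by rw [hg]; fun_prop
  have hg0 : ∀ y, 0 ≤ g y := fun y => by rw [hg]; positivity
  have hgi : Integrable g := by
    rw [hg]
    refine Integrable.const_mul ?_ _
    have h := integrable_heatKernel (n := n) (t := c / 2) (by positivity)
    unfold heatKernel at h
    rw [integrable_const_mul_iff] at h
    · refine h.congr (.of_forall fun y => ?_)
      simp only
      congr 2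
      ring
    · exact (Real.rpow_pos_of_pos (by positivity) _).ne'.isUnit
  set v := volume (Metric.ball (0 : Rn n) r) with hv
  have hv0 : v ≠ 0 := (Metric.measure_ball_pos volume 0 hr).ne'
  have hvt : v ≠ ⊤ := measure_ball_lt_top.ne
  refine ⟨(v.toReal)⁻¹ * ∫ y, g y, mul_nonneg (by positivity) (integral_nonneg hg0), ?_⟩
  intro p hp z
  have key : ∀ j, v * ENNReal.ofReal (Real.exp (-‖z - p j‖ ^ 2 / c)) ≤
      ∫⁻ y in Metric.ball (p j) r, ENNReal.ofReal (g (z - y)) := by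
    intro j
    rw [mul_comm, hv, ← Measure.addHaar_ball_center volume (p j) r, ← setLIntegral_const]
    refine setLIntegral_mono ((hgc.comp (continuous_const.sub
      continuous_id)).measurable.ennreal_ofReal) fun y hy => ?_
    refine ENNReal.ofReal_le_ofReal ?_
    rw [hg]
    simp only
    rw [← Real.exp_add, Real.exp_le_exp]
    have h1 : ‖z - y‖ ≤ ‖z - p j‖ + r := by
      calc ‖z - y‖ = ‖(z - p j) + (p j - y)‖ := by congr 1; abel
        _ ≤ ‖z - p j‖ + ‖p j - y‖ := norm_add_le _ _
        _ ≤ _ := by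
          rw [Metric.mem_ball, dist_comm, dist_eq_norm] at hy
          linarith
    have h2 : ‖z - y‖ ^ 2 ≤ 2 * ‖z - p j‖ ^ 2 + 2 * r ^ 2 := by
      nlinarith [norm_nonneg (z - y), sq_nonneg (‖z - p j‖ - r)]
    have h3 : -‖z - p j‖ ^ 2 / c = (-(2 * ‖z - p j‖ ^ 2 + 2 * r ^ 2)) / (2 * c) + r ^ 2 / c := by
      field_simp
      ring
    rw [h3, add_comm]
    gcongr
  have hsum : v * ∑' j, ENNReal.ofReal (Real.exp (-‖z - p j‖ ^ 2 / c)) ≤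
      ENNReal.ofReal (∫ y, g y) := by
    rw [← ENNReal.tsum_mul_left]
    calc _ ≤ ∑' j, ∫⁻ y in Metric.ball (p j) r, ENNReal.ofReal (g (z - y)) :=
          ENNReal.tsum_le_tsum key
      _ = ∫⁻ y in ⋃ j, Metric.ball (p j) r, ENNReal.ofReal (g (z - y)) :=
          (lintegral_iUnion (fun j => Metric.isOpen_ball.measurableSet) hp _).symm
      _ ≤ ∫⁻ y, ENNReal.ofReal (g (z - y)) := setLIntegral_le_lintegral _ _
      _ = _ := by
          rw [← ofReal_integral_eq_lintegral_ofReal (hgi.comp_sub_left z)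
            (.of_forall fun y => hg0 _), integral_sub_left_eq_self g volume z]
  rw [ENNReal.ofReal_mul (by positivity), ENNReal.ofReal_inv_of_pos (ENNReal.toReal_pos hv0 hvt),
    ENNReal.ofReal_toReal hvt, ← ENNReal.mul_le_iff_le_inv hv0 hvt]
  exact hsum

theorem ofReal_setIntegral_sq {n : ℕ} (u : L2 n) (s : Set (Rn n)) :
    ENNReal.ofReal (∫ x in s, u x ^ 2) = ∫⁻ x in s, ENNReal.ofReal (u x ^ 2) :=
  ofReal_integral_eq_lintegral_ofReal (L2.integrable_sq u).integrableOn
    (.of_forall fun _ => sq_nonneg _)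

theorem tsum_gaussian_integral_le {n : ℕ} {c D : ℝ} (hc : 0 < c) (hD : 0 ≤ D) {p : ℕ → Rn n}
    (hp : ∀ z : Rn n, ∑' j, ENNReal.ofReal (Real.exp (-‖z - p j‖ ^ 2 / c)) ≤ ENNReal.ofReal D)
    (u : L2 n) :
    ∑' j, ENNReal.ofReal (∫ x, Real.exp (-‖x - p j‖ ^ 2 / c) * u x ^ 2) ≤
      ENNReal.ofReal (D * ‖u‖ ^ 2) := by
  have h1 : ∀ j, ENNReal.ofReal (∫ x, Real.exp (-‖x - p j‖ ^ 2 / c) * u x ^ 2) =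
      ∫⁻ x, ENNReal.ofReal (Real.exp (-‖x - p j‖ ^ 2 / c)) * ENNReal.ofReal (u x ^ 2) := by
    intro j
    rw [ofReal_integral_eq_lintegral_ofReal (integrable_gaussian_mul_sq _ hc u)
      (.of_forall fun x => by positivity)]
    exact lintegral_congr fun x => ENNReal.ofReal_mul (Real.exp_pos _).le
  have hum : AEMeasurable (fun x => ENNReal.ofReal (u x ^ 2)) volume :=
    ((Lp.aestronglyMeasurable u).aemeasurable.pow_const 2).ennreal_ofReal
  simp_rw [h1]
  have hjm : ∀ j, AEMeasurable (fun x => ENNReal.ofReal (Real.exp (-‖x - p j‖ ^ 2 / c)) *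
      ENNReal.ofReal (u x ^ 2)) volume := fun j => AEMeasurable.mul (by fun_prop) hum
  rw [← lintegral_tsum hjm]
  simp_rw [ENNReal.tsum_mul_right]
  calc _ ≤ ∫⁻ x, ENNReal.ofReal D * ENNReal.ofReal (u x ^ 2) := by
        refine lintegral_mono fun x => ?_
        gcongr
        exact hp x
    _ = _ := by
        rw [lintegral_const_mul' _ _ ENNReal.ofReal_ne_top, ENNReal.ofReal_mul hD, L2.norm_sq_eq,
          ofReal_integral_eq_lintegral_ofReal (L2.integrable_sq u)
          (.of_forall fun _ => sq_nonneg _)]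

/-- This undoes Young's inequality; the optimal parameter is `η = Z / (2A)`. -/
theorem sq_le_of_forall_le {Z A F : ℝ} (hZ : 0 ≤ Z) (hA : 0 ≤ A) (hF : 0 ≤ F)
    (h : ∀ η : ℝ, 0 < η → Z ≤ η * A + F / η) : Z ^ 2 ≤ 4 * A * F := by
  have h' : ∀ η : ℝ, 0 < η → Z * η ≤ η ^ 2 * A + F := fun η hη => by
    have := mul_le_mul_of_nonneg_right (h η hη) hη.le
    rwa [add_mul, div_mul_cancel₀ _ hη.ne', mul_right_comm, ← sq] at this
  rcases hZ.eq_or_lt with h0 | hZpos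
  · rw [← h0, zero_pow two_ne_zero]
    positivity
  · rcases hA.eq_or_lt with hA0 | hApos
    -- For `A = 0` a large `η` contradicts `0 < Z`.
    · have := h' ((F + 1) / Z) (by positivity)
      rw [← hA0, mul_div_cancel₀ _ hZpos.ne'] at this
      linarith
    · have := h' (Z / (2 * A)) (by positivity)
      rw [← sub_nonneg] at this
      have h2 : (Z / (2 * A)) ^ 2 * A + F - Z * (Z / (2 * A)) = (4 * A * F - Z ^ 2) / (4 * A) := by
        field_simp
        ring
      rw [h2] at this
      rw [le_div_iff₀ (by positivity)] at this
      linarith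

/-- The interpolation estimate for an observation region that contains balls around separated
points. -/
theorem IsDominated.global_estimate (n : ℕ) {r R T M : ℝ} (hr : 0 < r) (hR : 0 < R) (hT : 0 < T)
    (hM : 0 ≤ M) : ∃ C : ℝ, 0 < C ∧ ∀ (u : ℝ → L2 n) (a b : ℝ), b - a = T → IsDominated u M a b →
      ∀ (ω : Set (Rn n)) (p : ℕ → Rn n),
        Pairwise (Function.onFun Disjoint fun j => Metric.ball (p j) r) →
        (∀ j, Metric.ball (p j) r ⊆ ω) → (⋃ j, Metric.ball (p j) R) = univ →
        (‖u b‖ ^ 2) ^ 2 ≤ C * (∫ x in ω, u b x ^ 2) * (‖u a‖ ^ 2 + ‖u b‖ ^ 2) := by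
  obtain ⟨C, hC, hloc⟩ := IsDominated.local_estimate n hr hR hT hM
  have hc : 0 < 4 * (T + 1) := by positivity
  obtain ⟨D, hD, hDsum⟩ := tsum_gaussian_le n hr hc
  set κ := Real.exp (R ^ 2 / (4 * (T + 1))) with hκ
  have hκ1 : 1 ≤ κ := by rw [hκ, Real.one_le_exp_iff]; positivity
  -- The `1` makes the constant positive, as `D` is only known to be nonnegative.
  refine ⟨4 * C * (D * κ) + 1, by positivity, ?_⟩
  intro u a b hab hu ω p hdisj hsub hcov
  set X := ∫ x in ω, u b x ^ 2 with hX
  have hX0 : 0 ≤ X := integral_nonneg fun _ => sq_nonneg _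
  set N : L2 n → ℕ → ℝ := fun v j => ∫ x, Real.exp (-‖x - p j‖ ^ 2 / (4 * (T + 1))) * v x ^ 2
    with hN
  have hN0 : ∀ v j, 0 ≤ N v j := fun v j => integral_nonneg fun _ => by positivity
  have hsumN : ∀ v, ∑' j, ENNReal.ofReal (N v j) ≤ ENNReal.ofReal (D * ‖v‖ ^ 2) := fun v =>
    tsum_gaussian_integral_le hc hD (hDsum p hdisj) v
  have hER : ∀ j, ∫ x in Metric.ball (p j) R, u b x ^ 2 ≤ κ * N (u b) j := fun j => by
    have := setIntegral_ball_le (p j) (R := R) hc (u b)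
    rwa [Real.exp_neg, inv_mul_le_iff₀ (Real.exp_pos _)] at this
  -- The local estimates bound squares by products. Young's inequality with one `η` for all centres
  -- makes them additive, and `η` is optimised after summation.
  have hkey : ∀ η : ℝ, 0 < η → ‖u b‖ ^ 2 ≤ η * (C * X) +
      (D * κ * (‖u a‖ ^ 2 + ‖u b‖ ^ 2)) / η := by
    intro η hη
    have hj : ∀ j, ∫ x in Metric.ball (p j) R, u b x ^ 2 ≤
        η * C * (∫ x in Metric.ball (p j) r, u b x ^ 2) + κ / η * (N (u a) j + N (u b) j) := by
      intro j
      have h1 := hloc u a b hab hu (p j)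
      have hr0 : 0 ≤ ∫ x in Metric.ball (p j) r, u b x ^ 2 := integral_nonneg fun _ => sq_nonneg _
      have hR0 : 0 ≤ ∫ x in Metric.ball (p j) R, u b x ^ 2 := integral_nonneg fun _ => sq_nonneg _
      have h2 : N (u a) j + ∫ x in Metric.ball (p j) R, u b x ^ 2 ≤
          κ * (N (u a) j + N (u b) j) := by
        have := hER j
        nlinarith [hN0 (u a) j]
      have hA0 : 0 ≤ C * ∫ x in Metric.ball (p j) r, u b x ^ 2 := by positivity
      have hB0 : 0 ≤ κ * (N (u a) j + N (u b) j) := by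
        have := hN0 (u a) j
        have := hN0 (u b) j
        positivity
      have h3 := h1.trans (mul_le_mul_of_nonneg_left h2 hA0)
      set A := C * ∫ x in Metric.ball (p j) r, u b x ^ 2 with hA
      set B := κ * (N (u a) j + N (u b) j) with hB
      have h4 : 0 ≤ η * A := by positivity
      have h5 : 0 ≤ B / η := by positivity
      have h6 : A * B = (η * A) * (B / η) := by field_simp
      have h7 : ∫ x in Metric.ball (p j) R, u b x ^ 2 ≤ η * A + B / η := by
        refine abs_le_of_sq_le_sq (h3.trans ?_) (by positivity) |> le_of_abs_le
        rw [h6]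
        nlinarith
      refine h7.trans_eq ?_
      rw [hA, hB]
      ring
    have hmain : ENNReal.ofReal (‖u b‖ ^ 2) ≤ ENNReal.ofReal (η * (C * X) +
        (D * κ * (‖u a‖ ^ 2 + ‖u b‖ ^ 2)) / η) := by
      have e1 : ENNReal.ofReal (‖u b‖ ^ 2) ≤
          ∑' j, ENNReal.ofReal (∫ x in Metric.ball (p j) R, u b x ^ 2) := by
        rw [L2.norm_sq_eq, ← setIntegral_univ, ← hcov, ofReal_setIntegral_sq]
        simp_rw [ofReal_setIntegral_sq]
        exact lintegral_iUnion_le _ _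
      have e2 : ∑' j, ENNReal.ofReal (∫ x in Metric.ball (p j) r, u b x ^ 2) ≤
          ENNReal.ofReal X := by
        rw [hX, ofReal_setIntegral_sq]
        simp_rw [ofReal_setIntegral_sq]
        rw [← lintegral_iUnion (fun j => Metric.isOpen_ball.measurableSet) hdisj]
        exact lintegral_mono_set (iUnion_subset hsub)
      calc _ ≤ _ := e1
        _ ≤ ∑' j, (ENNReal.ofReal (η * C) * ENNReal.ofReal
              (∫ x in Metric.ball (p j) r, u b x ^ 2) + ENNReal.ofReal (κ / η) *
              (ENNReal.ofReal (N (u a) j) + ENNReal.ofReal (N (u b) j))) := by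
            refine ENNReal.tsum_le_tsum fun j => ?_
            rw [← ENNReal.ofReal_add (hN0 _ j) (hN0 _ j), ← ENNReal.ofReal_mul (by positivity),
              ← ENNReal.ofReal_mul (by positivity), ← ENNReal.ofReal_add]
            · exact ENNReal.ofReal_le_ofReal (hj j)
            · exact mul_nonneg (by positivity) (integral_nonneg fun _ => sq_nonneg _)
            · exact mul_nonneg (by positivity) (add_nonneg (hN0 _ j) (hN0 _ j))
        _ ≤ ENNReal.ofReal (η * C) * ENNReal.ofReal X + ENNReal.ofReal (κ / η) *
              (ENNReal.ofReal (D * ‖u a‖ ^ 2) + ENNReal.ofReal (D * ‖u b‖ ^ 2)) := by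
            rw [ENNReal.tsum_add, ENNReal.tsum_mul_left, ENNReal.tsum_mul_left, ENNReal.tsum_add]
            gcongr
            · exact hsumN _
            · exact hsumN _
        _ = _ := by
            rw [← ENNReal.ofReal_add (by positivity) (by positivity),
              ← ENNReal.ofReal_mul (by positivity), ← ENNReal.ofReal_mul (by positivity),
              ← ENNReal.ofReal_add (by positivity) (by positivity)]
            congr 1
            ring
    exact (ENNReal.ofReal_le_ofReal_iff (by positivity)).1 hmain
  have := sq_le_of_forall_le (by positivity) (by positivity) (by positivity) hkey
  refine this.trans ?_
  have h2 : 0 ≤ X * (‖u a‖ ^ 2 + ‖u b‖ ^ 2) := by positivity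
  nlinarith

/-! ### Domination by the heat flow -/

/-- An integral form of Gronwall's inequality, with a weight that may be singular at the end
points. -/
theorem gronwall_integral {s t : ℝ} (hst : s < t) {φ m I : ℝ → ℝ}
    (hφ : ContinuousOn φ (Ioo s t)) (hm : ContinuousOn m (Ioo s t)) (hm0 : ∀ σ ∈ Ioo s t, 0 ≤ m σ)
    (hint : IntervalIntegrable (fun σ => m σ * φ σ) volume s t) (hI : ContinuousOn I (Icc s t))
    (hI' : ∀ σ ∈ Ioo s t, HasDerivAt I (m σ) σ) (hIs : I s = 0)
    (h : ∀ τ ∈ Ioo s t, φ τ ≤ φ s + ∫ σ in s..τ, m σ * φ σ) :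
    ∫ σ in s..t, m σ * φ σ ≤ (Real.exp (I t) - 1) * φ s := by
  set ψ : ℝ → ℝ := fun τ => φ s + ∫ σ in s..τ, m σ * φ σ with hψ
  have hψc : ContinuousOn ψ (Icc s t) := by
    refine continuousOn_const.add ?_
    have := intervalIntegral.continuousOn_primitive_interval'
      (f := fun σ => m σ * φ σ) (a := s) hint left_mem_uIcc
    rwa [uIcc_of_le hst.le] at this
  have hψ' : ∀ τ ∈ Ioo s t, HasDerivAt ψ (m τ * φ τ) τ := by
    intro τ hτ
    refine HasDerivAt.const_add _ ?_
    have hcont : ContinuousOn (fun σ => m σ * φ σ) (Ioo s t) := hm.mul hφ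
    refine intervalIntegral.integral_hasDerivAt_right ?_ ?_ ?_
    · refine hint.mono_set ?_
      rw [uIcc_of_le hτ.1.le, uIcc_of_le hst.le]
      exact Icc_subset_Icc le_rfl hτ.2.le
    · exact hcont.stronglyMeasurableAtFilter isOpen_Ioo τ hτ
    · exact hcont.continuousAt (isOpen_Ioo.mem_nhds hτ)
  -- Its derivative is `m (φ - ψ) exp (-I)`, which is nonpositive because `φ ≤ ψ`.
  have hg : AntitoneOn (fun τ => ψ τ * Real.exp (-I τ)) (Icc s t) := by
    refine antitoneOn_of_deriv_nonpos (convex_Icc s t)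
      (hψc.mul (Real.continuous_exp.comp_continuousOn hI.neg)) ?_ ?_
    · rw [interior_Icc]
      intro τ hτ
      exact ((hψ' τ hτ).mul (hI' τ hτ).neg.exp).differentiableAt.differentiableWithinAt
    · rw [interior_Icc]
      intro τ hτ
      have hd : HasDerivAt (fun τ => ψ τ * Real.exp (-I τ)) (m τ * φ τ * Real.exp (-I τ) +
        ψ τ * (Real.exp (-I τ) * -m τ)) τ := (hψ' τ hτ).mul (hI' τ hτ).neg.exp
      rw [hd.deriv]
      have h1 := h τ hτ
      have h2 := mul_nonneg (hm0 τ hτ) (Real.exp_pos (-I τ)).le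
      nlinarith [mul_le_mul_of_nonneg_left h1 h2]
  have hfin := hg (left_mem_Icc.2 hst.le) (right_mem_Icc.2 hst.le) hst.le
  simp only [hIs, neg_zero, Real.exp_zero, mul_one] at hfin
  have hψs : ψ s = φ s := by simp [hψ]
  rw [hψs, Real.exp_neg, ← div_eq_mul_inv, div_le_iff₀ (Real.exp_pos _)] at hfin
  simp only [hψ] at hfin
  linarith

/-- The data of Duhamel's formula `u(τ) = e^{(τ-s)Δ}u(s) - ∫_s^τ e^{(τ-σ)Δ}F(σ)dσ` on `[s,t]`,
with a source that is dominated by `u`. -/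
structure IsDuhamel {n : ℕ} (u : ℝ → L2 n) (F : ℝ → Rn n → ℝ) (m I : ℝ → ℝ) (s t : ℝ) : Prop where
  lt : s < t
  continuousOn : ContinuousOn u (Icc s t)
  bounded : ∃ B : ℝ, ∀ σ ∈ Icc s t, ∀ᵐ z, |u σ z| ≤ B
  eq : ∀ τ ∈ Ioc s t, ∀ᵐ x, u τ x = heat (τ - s) (u s) x - ∫ σ in s..τ, heat (τ - σ) (F σ) x
  source_le : ∀ σ ∈ Ioo s t, ∀ᵐ z, |F σ z| ≤ m σ * |u σ z|
  nonneg : ∀ σ ∈ Ioo s t, 0 ≤ m σ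
  continuousOn_rate : ContinuousOn m (Ioo s t)
  continuousOn_primitive : ContinuousOn I (Icc s t)
  hasDerivAt : ∀ σ ∈ Ioo s t, HasDerivAt I (m σ) σ
  primitive_left : I s = 0

namespace IsDuhamel

variable {n : ℕ} {u : ℝ → L2 n} {F : ℝ → Rn n → ℝ} {m I : ℝ → ℝ} {s t : ℝ}

/-- The rate may blow up at `s`, but it is the nonnegative derivative of a continuous function. -/
theorem integrableOn_rate (h : IsDuhamel u F m I s t) {τ : ℝ} (hτ : τ ∈ Ioc s t) :
    IntegrableOn m (Ioo s τ) := by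
  refine IntegrableOn.mono_set ?_ Ioo_subset_Ioc_self
  refine intervalIntegral.integrableOn_deriv_of_nonneg (g := I)
    (h.continuousOn_primitive.mono (Icc_subset_Icc le_rfl hτ.2))
    (fun σ hσ => h.hasDerivAt σ ⟨hσ.1, hσ.2.trans_le hτ.2⟩)
    (fun σ hσ => h.nonneg σ ⟨hσ.1, hσ.2.trans_le hτ.2⟩)

theorem continuousOn_abs (h : IsDuhamel u F m I s t) :
    ContinuousOn (fun σ => (|u σ| : L2 n)) (Icc s t) :=
  h.continuousOn.sup h.continuousOn.neg

theorem continuousOn_heat_abs (h : IsDuhamel u F m I s t) {τ : ℝ} (hτ : τ ≤ t) :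
    ContinuousOn (fun q : Rn n × ℝ => heat (τ - q.2) (|u q.2| : L2 n) q.1) (univ ×ˢ Ioo s τ) := by
  refine continuousOn_heat (h := fun q : Rn n × ℝ => τ - q.2) (v := fun q => |u q.2|)
    (x := fun q => q.1) (by fun_prop) (fun q hq => sub_pos.2 hq.2.2) ?_ (by fun_prop)
  exact h.continuousOn_abs.comp continuousOn_snd
    fun q hq => ⟨hq.2.1.le, hq.2.2.le.trans hτ⟩

theorem exists_bound (h : IsDuhamel u F m I s t) :
    ∃ B : ℝ, ∀ τ ≤ t, ∀ σ ∈ Ico s τ, ∀ x, |heat (τ - σ) (|u σ| : L2 n) x| ≤ B := by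
  obtain ⟨B, hB⟩ := h.bounded
  refine ⟨B, fun τ hτ σ hσ x => heat_le_of_le (sub_pos.2 hσ.2) ?_ x⟩
  filter_upwards [hB σ ⟨hσ.1, hσ.2.le.trans hτ⟩, L2.coeFn_abs (u σ)] with z h1 h2
  rwa [h2, abs_abs]

theorem integrable_rate_mul_heat (h : IsDuhamel u F m I s t) {τ : ℝ} (hτ : τ ∈ Ioc s t)
    (x : Rn n) : IntervalIntegrable (fun σ => m σ * heat (τ - σ) (|u σ| : L2 n) x) volume s τ := by
  obtain ⟨B, hB⟩ := h.exists_bound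
  rw [intervalIntegrable_iff_integrableOn_Ioo_of_le hτ.1.le]
  refine Integrable.mul_bdd (c := B) (h.integrableOn_rate hτ) ?_ ?_
  · refine ContinuousOn.aestronglyMeasurable ?_ measurableSet_Ioo
    exact (h.continuousOn_heat_abs hτ.2).comp (f := fun σ : ℝ => (x, σ)) (by fun_prop)
      fun σ hσ => ⟨mem_univ _, hσ⟩
  · refine ae_restrict_of_forall_mem measurableSet_Ioo fun σ hσ => ?_
    exact hB τ hτ.2 σ ⟨hσ.1.le, hσ.2⟩ x

theorem abs_sub_heat_le (h : IsDuhamel u F m I s t) {τ : ℝ} (hτ : τ ∈ Ioc s t) :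
    ∀ᵐ x, |u τ x - heat (τ - s) (u s) x| ≤
      ∫ σ in s..τ, m σ * heat (τ - σ) (|u σ| : L2 n) x := by
  filter_upwards [h.eq τ hτ] with x hx
  rw [hx, sub_sub_cancel_left, abs_neg, ← Real.norm_eq_abs]
  refine intervalIntegral.norm_integral_le_of_norm_le hτ.1.le ?_ (h.integrable_rate_mul_heat hτ x)
  have hne : ∀ᵐ σ : ℝ, σ ≠ τ := by simp [ae_iff]
  filter_upwards [hne] with σ hστ hσ
  have hσ' : σ < τ := lt_of_le_of_ne hσ.2 hστ
  have hpos : 0 < τ - σ := sub_pos.2 hσ'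
  have hb : ‖heat (τ - σ) (F σ) x‖ ≤
      ∫ z, heatKernel (τ - σ) (x - z) * (m σ * (|u σ| : L2 n) z) := by
    rw [heat]
    refine norm_integral_le_of_norm_le ?_ ?_
    · refine ((integrable_heatKernel_mul hpos |u σ| x).const_mul (m σ)).congr
        (.of_forall fun z => ?_)
      simp only
      ring
    · filter_upwards [h.source_le σ ⟨hσ.1, hσ'.trans_le hτ.2⟩, L2.coeFn_abs (u σ)] with z h1 h2
      rw [norm_mul, Real.norm_of_nonneg (heatKernel_pos hpos _).le, h2]
      exact mul_le_mul_of_nonneg_left h1 (heatKernel_pos hpos _).le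
  refine hb.trans_eq ?_
  rw [heat, ← integral_const_mul]
  refine integral_congr_ae (.of_forall fun z => ?_)
  simp only
  ring

theorem integrable_prod (h : IsDuhamel u F m I s t) {τ : ℝ} (hτ : τ ∈ Ioo s t) (x : Rn n) :
    Integrable (fun q : Rn n × ℝ => heatKernel (t - τ) (x - q.1) *
      (m q.2 * heat (τ - q.2) (|u q.2| : L2 n) q.1))
      (volume.prod (volume.restrict (Ioo s τ))) := by
  obtain ⟨B, hB⟩ := h.exists_bound
  have hpos : 0 < t - τ := sub_pos.2 hτ.2
  have h1 := (integrable_heatKernel_sub hpos x).mul_prod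
    (h.integrableOn_rate ⟨hτ.1, hτ.2.le⟩)
  have hmeas : AEStronglyMeasurable (fun q : Rn n × ℝ => heat (τ - q.2) (|u q.2| : L2 n) q.1)
      (volume.prod (volume.restrict (Ioo s τ))) := by
    have := (h.continuousOn_heat_abs hτ.2.le).aestronglyMeasurable (μ := volume.prod volume)
      (MeasurableSet.univ.prod measurableSet_Ioo)
    rwa [← Measure.prod_restrict, Measure.restrict_univ] at this
  have h2 : ∀ᵐ q : Rn n × ℝ ∂(volume.prod (volume.restrict (Ioo s τ))),
      ‖heat (τ - q.2) (|u q.2| : L2 n) q.1‖ ≤ B := by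
    have : (volume : Measure (Rn n)).prod ((volume : Measure ℝ).restrict (Ioo s τ)) =
        (volume.prod volume).restrict (univ ×ˢ Ioo s τ) := by
      rw [← Measure.prod_restrict, Measure.restrict_univ]
    rw [this]
    refine ae_restrict_of_forall_mem (MeasurableSet.univ.prod measurableSet_Ioo) fun q hq => ?_
    exact hB τ hτ.2.le q.2 ⟨hq.2.1.le, hq.2.2⟩ q.1
  refine (h1.mul_bdd hmeas h2).congr (.of_forall fun q => ?_)
  simp only
  ring

/-- Applying `e^{(t-τ)Δ}` to the pointwise bound on `|u τ|` and using the semigroup law under the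
time integral brings every term to the common final time `t`. At fixed `x` this is a scalar Gronwall
inequality for `τ ↦ (e^{(t-τ)Δ} |u τ|) x`. -/
theorem heat_abs_le (h : IsDuhamel u F m I s t) {τ : ℝ} (hτ : τ ∈ Ioo s t) (x : Rn n) :
    heat (t - τ) (|u τ| : L2 n) x ≤ heat (t - s) (|u s| : L2 n) x +
      ∫ σ in s..τ, m σ * heat (t - σ) (|u σ| : L2 n) x := by
  have hpos : 0 < t - τ := sub_pos.2 hτ.2
  have hpos' : 0 < τ - s := sub_pos.2 hτ.1
  set J : Rn n → ℝ := fun z => ∫ σ in Ioo s τ, m σ * heat (τ - σ) (|u σ| : L2 n) z with hJ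
  have hprod := h.integrable_prod hτ x
  have hJint : Integrable fun z => heatKernel (t - τ) (x - z) * J z := by
    have := hprod.integral_prod_left
    refine this.congr (.of_forall fun z => ?_)
    simp only [integral_const_mul, hJ]
  have hJeq : ∫ z, heatKernel (t - τ) (x - z) * J z =
      ∫ σ in s..τ, m σ * heat (t - σ) (|u σ| : L2 n) x := by
    have h1 : ∫ z, heatKernel (t - τ) (x - z) * J z = ∫ z, ∫ σ in Ioo s τ,
        heatKernel (t - τ) (x - z) * (m σ * heat (τ - σ) (|u σ| : L2 n) z) := by
      refine integral_congr_ae (.of_forall fun z => ?_)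
      simp only [integral_const_mul, hJ]
    rw [h1, integral_integral_swap hprod, intervalIntegral.integral_of_le hτ.1.le,
      integral_Ioc_eq_integral_Ioo]
    refine setIntegral_congr_fun measurableSet_Ioo fun σ hσ => ?_
    rw [show t - σ = t - τ + (τ - σ) by ring, ← heat_heat hpos (sub_pos.2 hσ.2), heat,
      ← integral_const_mul]
    refine integral_congr_ae (.of_forall fun z => ?_)
    simp only
    ring
  have hheat : Integrable fun z => heatKernel (t - τ) (x - z) *
      heat (τ - s) (|u s| : L2 n) z := by
    refine (integrable_heatKernel_mul hpos ((memLp_heat hpos' |u s|).toLp _) x).congr ?_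
    filter_upwards [(memLp_heat hpos' |u s|).coeFn_toLp] with z hz
    rw [hz]
  calc heat (t - τ) (|u τ| : L2 n) x
      ≤ ∫ z, (heatKernel (t - τ) (x - z) * heat (τ - s) (|u s| : L2 n) z +
          heatKernel (t - τ) (x - z) * J z) := by
        refine integral_mono_ae (integrable_heatKernel_mul hpos _ x) (hheat.add hJint) ?_
        filter_upwards [h.abs_sub_heat_le ⟨hτ.1, hτ.2.le⟩, L2.coeFn_abs (u τ)] with z h1 h2
        rw [h2, ← mul_add]
        refine mul_le_mul_of_nonneg_left ?_ (heatKernel_pos hpos _).le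
        rw [intervalIntegral.integral_of_le hτ.1.le, integral_Ioc_eq_integral_Ioo] at h1
        have h3 := abs_heat_le_heat_abs hpos' (u s) z
        rw [← heat_abs] at h3
        have h4 := abs_sub_abs_le_abs_sub (u τ z) (heat (τ - s) (u s) z)
        linarith
    _ = heat (t - s) (|u s| : L2 n) x + ∫ σ in s..τ, m σ * heat (t - σ) (|u σ| : L2 n) x := by
        rw [integral_add hheat hJint, hJeq, show t - s = t - τ + (τ - s) by ring,
          ← heat_heat hpos hpos']
        rfl

/-- A solution of Duhamel's formula with a dominated source stays close to the heat flow. -/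
theorem dominated (h : IsDuhamel u F m I s t) :
    ∀ᵐ x, |u t x - heat (t - s) (u s) x| ≤
      (Real.exp (I t) - 1) * heat (t - s) (fun z => |u s z|) x := by
  have ht : t ∈ Ioc s t := right_mem_Ioc.2 h.lt
  filter_upwards [h.abs_sub_heat_le ht] with x hx
  refine hx.trans ?_
  rw [← heat_abs]
  refine gronwall_integral h.lt ?_ h.continuousOn_rate h.nonneg (h.integrable_rate_mul_heat ht x)
    h.continuousOn_primitive h.hasDerivAt h.primitive_left fun τ hτ => h.heat_abs_le hτ x
  exact (h.continuousOn_heat_abs le_rfl).comp (f := fun σ : ℝ => (x, σ)) (by fun_prop)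
    fun σ hσ => ⟨mem_univ _, hσ⟩

theorem abs_le (h : IsDuhamel u F m I s t) :
    ∀ᵐ x, |u t x| ≤ Real.exp (I t) * heat (t - s) (fun z => |u s z|) x := by
  filter_upwards [h.dominated] with x hx
  have h1 := abs_heat_le_heat_abs (sub_pos.2 h.lt) (u s) x
  have h2 := abs_sub_abs_le_abs_sub (u t x) (heat (t - s) (u s) x)
  linarith

end IsDuhamel

/-! ### Backward uniqueness -/

theorem IsDominated.norm_sub_heatOp_le {n : ℕ} {u : ℝ → L2 n} {M a b : ℝ}
    (hu : IsDominated u M a b) (hM : 0 ≤ M) {s h : ℝ} (hh : 0 < h) (has : a ≤ s) (hsb : s + h ≤ b) :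
    ‖u (s + h) - (isSchurKernel_heatKernel hh).op (u s)‖ ≤ (Real.exp (M * h) - 1) * ‖u s‖ := by
  refine IsSchurKernel.norm_sub_op_le _ ?_ ?_
  · rw [sub_nonneg, Real.one_le_exp_iff]
    positivity
  · have := hu s (s + h) has (by linarith) hsb
    rw [add_sub_cancel_left] at this
    exact this

theorem IsDominated.backward_uniqueness {n : ℕ} {u : ℝ → L2 n} {M a b : ℝ} (hab : a < b)
    (hM : 0 ≤ M) (hu : IsDominated u M a b) (hc : ContinuousOn u (Icc a b)) (hb : u b = 0) :
    u a = 0 := by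
  by_contra hne
  -- By continuity `u` is still nonzero after one `q`-th of the interval. This first piece, of
  -- length `L`, yields a finite logarithmic decay `Y`; the remaining pieces only propagate the
  -- Rayleigh quotient.
  obtain ⟨q, hq0, hq⟩ : ∃ q : ℕ, 0 < q ∧ u (a + (b - a) / q) ≠ 0 := by
    have h1 : Tendsto (fun q : ℕ => a + (b - a) / q) atTop (𝓝[Icc a b] a) := by
      rw [tendsto_nhdsWithin_iff]
      constructor
      · simpa using (tendsto_const_div_atTop_nhds_zero_nat (b - a)).const_add a
      · filter_upwards [eventually_gt_atTop 0] with q hq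
        have hq' : (1 : ℝ) ≤ q := by exact_mod_cast hq
        have h2 : (b - a) / q ≤ b - a := div_le_self (by linarith) hq'
        have h3 : 0 ≤ (b - a) / q := div_nonneg (by linarith) (by linarith)
        exact ⟨by linarith, by linarith⟩
    have h2 := (hc a (left_mem_Icc.2 hab.le)).tendsto.comp h1
    have h3 := h2.eventually_ne hne
    obtain ⟨q, h4, h5⟩ := (h3.and (eventually_gt_atTop 0)).exists
    exact ⟨q, h5, h4⟩
  have hq' : (0 : ℝ) < q := by exact_mod_cast hq0
  set L := (b - a) / q with hL
  have hLpos : 0 < L := div_pos (by linarith) hq'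
  have hLq : q * L = b - a := by rw [hL]; field_simp
  set Y := Real.log (‖u a‖ ^ 2 / ‖u (a + L)‖ ^ 2) with hY
  have hn1 : 0 < ‖u (a + L)‖ := norm_pos_iff.2 hq
  have hn0 : 0 < ‖u a‖ := norm_pos_iff.2 hne
  have hYe : ‖u a‖ ^ 2 ≤ Real.exp Y * ‖u (a + L)‖ ^ 2 := by
    rw [hY, Real.exp_log (by positivity)]
    field_simp
    rfl
  set ε : ℕ → ℝ := fun m => Real.exp (M * (L / m)) - 1 with hε
  have hd : HasDerivAt (fun s : ℝ => Real.exp (M * s) - 1) M 0 := by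
    have := (((hasDerivAt_id (0 : ℝ)).const_mul M).exp).sub_const 1
    simpa using this
  have t1 : Tendsto (fun m : ℕ => (m : ℝ) * ε m) atTop (𝓝 (L * M)) := by
    refine ((tendsto_mul_of_hasDerivAt_zero hd (by simp) hLpos).const_mul L).congr fun m => ?_
    rw [← mul_assoc, show L * (m / L) = m by field_simp]
  have tε : Tendsto ε atTop (𝓝 0) := by
    refine (t1.div_atTop (tendsto_natCast_atTop_atTop (R := ℝ))).congr' ?_
    filter_upwards [eventually_gt_atTop 0] with m hm
    have : (m : ℝ) ≠ 0 := by exact_mod_cast hm.ne'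
    field_simp
  have tN : Tendsto (fun m : ℕ => (Y + 4 * (m * ε m) ^ 2 + 2 * (m * ε m)) / (m : ℝ)) atTop (𝓝 0) :=
    ((((t1.pow 2).const_mul 4).const_add Y).add (t1.const_mul 2)).div_atTop
      tendsto_natCast_atTop_atTop
  have tQ : Tendsto (fun m : ℕ => 4 * ε m ^ 2 * ((q * m : ℕ) : ℝ)) atTop (𝓝 0) := by
    have := ((tε.mul t1).const_mul (4 * (q : ℝ)))
    rw [zero_mul, mul_zero] at this
    refine this.congr fun m => ?_
    push_cast
    ring
  have tS := (tN.add tQ).add tε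
  rw [add_zero, add_zero] at tS
  -- The quotient after `m` steps is `O(1/m)`, and the later steps add at most `4 ε² q m = O(1/m)`.
  -- For large `m` both stay below the threshold of `rayleigh_forward`, so `u b` cannot vanish.
  obtain ⟨m, ⟨hm0, hm1⟩, hm2⟩ := ((((eventually_gt_atTop 0).and
    (tS.eventually (gt_mem_nhds (one_half_pos)))).and
    ((tN.add tε).eventually (gt_mem_nhds (by simp : (0 : ℝ) + 0 < 1 / 2))))).exists
  have hm' : (0 : ℝ) < m := by exact_mod_cast hm0
  have hh : 0 < L / m := div_pos hLpos hm'
  set w : ℕ → L2 n := fun k => u (a + k * (L / m)) with hw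
  have hstep : ∀ k < q * m, ‖w (k + 1) - (isSchurKernel_heatKernel hh).op (w k)‖ ≤
      ε m * ‖w k‖ := by
    intro k hk
    have h1 : ((k : ℝ) + 1) * (L / m) ≤ b - a := by
      have h2 : ((k : ℝ) + 1) ≤ q * m := by exact_mod_cast hk
      calc ((k : ℝ) + 1) * (L / m) ≤ q * m * (L / m) := by gcongr
        _ = b - a := by rw [← hLq]; field_simp
    have h3 := hu.norm_sub_heatOp_le hM hh (s := a + k * (L / m))
      (by have : 0 ≤ (k : ℝ) * (L / m) := by positivity
          linarith) (by linarith)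
    have h4 : w (k + 1) = u (a + k * (L / m) + L / m) := by
      simp only [hw]
      congr 1
      push_cast
      ring
    rw [h4]
    exact h3
  have hw0 : w 0 = u a := by simp [hw]
  have hwm : w m = u (a + L) := by
    simp only [hw]
    congr 2
    field_simp
  have hwq : w (m + (q * m - m)) = u b := by
    have hle : m ≤ q * m := Nat.le_mul_of_pos_left m hq0
    rw [Nat.add_sub_cancel' hle]
    simp only [hw]
    congr 1
    push_cast
    have : (q : ℝ) * m * (L / m) = q * L := by field_simp
    rw [this, hLq]
    ring
  have hle : m ≤ q * m := Nat.le_mul_of_pos_left m hq0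
  have hray := (isSymmContraction_heatOp hh).mul_rayleigh_le hm0
    (fun k hk => hstep k (hk.trans_le hle)) (by rwa [hwm]) (Y := Y) (by rwa [hw0, hwm]) hm2
  have hfin := (isSymmContraction_heatOp hh).rayleigh_forward hstep (k := m) (by rwa [hwm])
    (by linarith) (q * m - m) (by omega)
  rw [hwq] at hfin
  exact hfin.1 hb

/-- Domination extends to the final time by continuity. -/
theorem IsDominated.of_forall_lt {n : ℕ} {u : ℝ → L2 n} {M a b : ℝ}
    (hc : ContinuousOn u (Icc a b)) (h : ∀ c < b, IsDominated u M a c) : IsDominated u M a b := by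
  intro s t has hst htb
  rcases htb.lt_or_eq with htb | rfl
  · exact h t htb s t has hst le_rfl
  have hpos : 0 < t - s := sub_pos.2 hst
  set τ : ℕ → ℝ := fun k => t - (t - s) / (k + 2) with hτ
  have hτlt : ∀ k, τ k < t := fun k => by
    have : 0 < (t - s) / ((k : ℝ) + 2) := by positivity
    simp only [hτ]
    linarith
  have hτgt : ∀ k, s < τ k := fun k => by
    have : (t - s) / ((k : ℝ) + 2) < t - s := div_lt_self hpos (by
      have : (0 : ℝ) ≤ k := Nat.cast_nonneg k
      linarith)
    simp only [hτ]
    linarith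
  have hτt : Tendsto τ atTop (𝓝 t) := by
    have h1 : Tendsto (fun k : ℕ => (t - s) / ((k : ℝ) + 2)) atTop (𝓝 0) :=
      tendsto_const_nhds.div_atTop
        (tendsto_atTop_add_const_right _ _ tendsto_natCast_atTop_atTop)
    simpa using h1.const_sub t
  have hut : Tendsto (fun k => u (τ k)) atTop (𝓝 (u t)) := by
    refine (hc t ⟨has.trans hst.le, le_rfl⟩).tendsto.comp (tendsto_nhdsWithin_iff.2 ⟨hτt, ?_⟩)
    exact .of_forall fun k => ⟨has.trans (hτgt k).le, (hτlt k).le⟩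
  -- Convergence in `L²` gives almost everywhere convergence along a subsequence, which is enough to
  -- pass to the limit in the pointwise bound.
  obtain ⟨ns, hns, hae⟩ := (tendstoInMeasure_of_tendsto_Lp hut).exists_seq_tendsto_ae
  have hall : ∀ᵐ x, ∀ k, |u (τ k) x - heat (τ k - s) (u s) x| ≤
      (Real.exp (M * (τ k - s)) - 1) * heat (τ k - s) (fun z => |u s z|) x :=
    ae_all_iff.2 fun k => h (τ k) (hτlt k) s (τ k) has (hτgt k) le_rfl
  have hheat : ∀ (v : L2 n) (x : Rn n), Tendsto (fun k => heat (τ k - s) v x) atTop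
      (𝓝 (heat (t - s) v x)) := by
    intro v x
    have h1 : ContinuousOn (fun q : ℝ => heat (q - s) v x) (Ioi s) :=
      continuousOn_heat (h := fun q : ℝ => q - s) (v := fun _ => v) (x := fun _ => x)
        (by fun_prop) (fun q hq => sub_pos.2 hq) continuousOn_const continuousOn_const
    exact (h1.continuousAt (isOpen_Ioi.mem_nhds hst)).tendsto.comp hτt
  filter_upwards [hae, hall] with x h1 h2
  have hnst := hns.tendsto_atTop
  refine le_of_tendsto_of_tendsto (h1.sub ((hheat (u s) x).comp hnst)).abs (Tendsto.mul ?_ ?_)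
    (.of_forall fun k => h2 (ns k))
  · have : Continuous fun τ : ℝ => Real.exp (M * (τ - s)) - 1 := by fun_prop
    exact (this.tendsto t).comp (hτt.comp hnst)
  · simp_rw [← heat_abs]
    exact (hheat |u s| x).comp hnst

/-! ### Solutions of the semilinear equation -/

/-- The truncation of a number to `[-B, B]`. -/
def clamp (B a : ℝ) : ℝ := max (-B) (min a B)

theorem abs_clamp_le {B : ℝ} (hB : 0 ≤ B) (a : ℝ) : |clamp B a| ≤ B :=
  abs_le.2 ⟨le_max_left _ _, max_le (by linarith) (min_le_right _ _)⟩

theorem clamp_eq {B a : ℝ} (ha : |a| ≤ B) : clamp B a = a := by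
  rw [clamp, min_eq_left (abs_le.1 ha).2, max_eq_right (abs_le.1 ha).1]

theorem abs_clamp_sub_le (B a b : ℝ) : |clamp B a - clamp B b| ≤ |a - b| := by
  have h : LipschitzWith 1 (clamp B) := (LipschitzWith.id.min_const B).const_max (-B)
  simpa [Real.dist_eq] using h.dist_le_mul a b

/-- The growth condition with a given constant. -/
structure HasGrowth (f : ℝ → ℝ) (p A : ℝ) : Prop where
  map_zero : f 0 = 0
  one_lt : 1 < p
  pos : 0 < A
  growth : ∀ a b : ℝ, |f a - f b| ≤ A * (|a| ^ (p - 1) + |b| ^ (p - 1)) * |a - b|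

theorem IsPowerNonlinearity.exists_hasGrowth {f : ℝ → ℝ} {p : ℝ} (hf : IsPowerNonlinearity f p) :
    ∃ A, HasGrowth f p A := by
  obtain ⟨A, hA, h⟩ := hf.growth
  exact ⟨A, hf.map_zero, hf.one_lt, hA, h⟩

namespace HasGrowth

variable {f : ℝ → ℝ} {p A : ℝ}

theorem abs_le (hf : HasGrowth f p A) {a B : ℝ} (ha : |a| ≤ B) :
    |f a| ≤ A * B ^ (p - 1) * |a| := by
  have hp : 0 < p - 1 := sub_pos.2 hf.one_lt
  have h := hf.growth a 0
  rw [hf.map_zero, sub_zero, sub_zero, abs_zero, Real.zero_rpow hp.ne', add_zero] at h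
  refine h.trans ?_
  have := hf.pos
  gcongr

theorem abs_sub_le (hf : HasGrowth f p A) {a b B : ℝ} (ha : |a| ≤ B) (hb : |b| ≤ B) :
    |f a - f b| ≤ 2 * A * B ^ (p - 1) * |a - b| := by
  have hp : 0 < p - 1 := sub_pos.2 hf.one_lt
  refine (hf.growth a b).trans ?_
  have := hf.pos
  calc _ ≤ A * (B ^ (p - 1) + B ^ (p - 1)) * |a - b| := by gcongr
    _ = _ := by ring

/-- Truncation makes `f` globally Lipschitz, so that composition with it acts continuously on `L²`,
and it changes nothing on functions bounded by `B`. -/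
theorem lipschitzWith_clamp (hf : HasGrowth f p A) {B : ℝ} (hB : 0 ≤ B) :
    LipschitzWith (Real.toNNReal (2 * A * B ^ (p - 1))) (fun a => f (clamp B a)) := by
  have hA := hf.pos
  refine LipschitzWith.of_dist_le_mul fun a b => ?_
  rw [Real.dist_eq, Real.dist_eq, Real.coe_toNNReal _ (by positivity)]
  refine (hf.abs_sub_le (abs_clamp_le hB a) (abs_clamp_le hB b)).trans ?_
  exact mul_le_mul_of_nonneg_left (abs_clamp_sub_le B a b) (by positivity)

theorem map_clamp_zero (hf : HasGrowth f p A) {B : ℝ} (hB : 0 ≤ B) : f (clamp B 0) = 0 := by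
  rw [clamp_eq (by simpa using hB), hf.map_zero]

/-- The composition of `f` with a bounded function of class `L²`. -/
theorem exists_comp_ae (hf : HasGrowth f p A) {n : ℕ} {y : ℝ → L2 n} {S : Set ℝ}
    (hy : ContinuousOn y S) {B : ℝ} (hB : 0 ≤ B) (hyB : ∀ σ ∈ S, ∀ᵐ z, |y σ z| ≤ B) :
    ∃ g : ℝ → L2 n, ContinuousOn g S ∧ ∀ σ ∈ S, g σ =ᵐ[volume] fun z => f (y σ z) := by
  refine ⟨fun σ => (hf.lipschitzWith_clamp hB).compLp (hf.map_clamp_zero hB) (y σ), ?_, ?_⟩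
  · exact ((hf.lipschitzWith_clamp hB).continuous_compLp (hf.map_clamp_zero hB)).comp_continuousOn
      hy
  · intro σ hσ
    filter_upwards [(hf.lipschitzWith_clamp hB).coeFn_compLp (hf.map_clamp_zero hB) (y σ),
      hyB σ hσ] with z h1 h2
    rw [h1, Function.comp_apply, clamp_eq h2]

end HasGrowth

namespace IsSolution

variable {n : ℕ} {f : ℝ → ℝ} {p A T : ℝ} {y₀ : L2 n} {y : ℝ → L2 n}

theorem exists_bound (hy : IsSolution f T y₀ y) {s t : ℝ} (hs : 0 < s) (ht : t < T) :
    ∃ B : ℝ, 0 < B ∧ ∀ σ ∈ Icc s t, ∀ᵐ z, |y σ z| ≤ B := by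
  obtain ⟨B, hB⟩ := hy.locallyBounded s t hs ht
  refine ⟨|B| + 1, by positivity, fun σ hσ => ?_⟩
  filter_upwards [hB σ hσ] with z hz
  have := le_abs_self B
  linarith

theorem isDuhamel (hy : IsSolution f T y₀ y) {s t : ℝ} (hs : 0 < s) (hst : s < t) (ht : t < T)
    {m I : ℝ → ℝ} (hsrc : ∀ σ ∈ Ioo s t, ∀ᵐ z, |f (y σ z)| ≤ m σ * |y σ z|)
    (hm0 : ∀ σ ∈ Ioo s t, 0 ≤ m σ) (hm : ContinuousOn m (Ioo s t))
    (hI : ContinuousOn I (Icc s t)) (hI' : ∀ σ ∈ Ioo s t, HasDerivAt I (m σ) σ)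
    (hI0 : I s = 0) : IsDuhamel y (fun σ z => f (y σ z)) m I s t where
  lt := hst
  continuousOn := hy.continuousOn.mono (Icc_subset_Icc hs.le ht.le)
  bounded := by
    obtain ⟨B, -, hB⟩ := hy.exists_bound hs ht
    exact ⟨B, hB⟩
  eq τ hτ := hy.duhamel s τ hs hτ.1 (hτ.2.trans_lt ht)
  source_le := hsrc
  nonneg := hm0
  continuousOn_rate := hm
  continuousOn_primitive := hI
  hasDerivAt := hI'
  primitive_left := hI0

/-- Domination with a constant rate. -/
theorem abs_le_of_bound (hf : HasGrowth f p A) (hy : IsSolution f T y₀ y) {s t B : ℝ} (hs : 0 < s)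
    (hst : s < t) (ht : t < T) (hB0 : 0 ≤ B) (hB : ∀ σ ∈ Icc s t, ∀ᵐ z, |y σ z| ≤ B) :
    ∀ᵐ x, |y t x| ≤ Real.exp (A * B ^ (p - 1) * (t - s)) * heat (t - s) (fun z => |y s z|) x := by
  have hA := hf.pos
  refine (hy.isDuhamel hs hst ht (m := fun _ => A * B ^ (p - 1))
    (I := fun τ => A * B ^ (p - 1) * (τ - s)) ?_ ?_ ?_ ?_ ?_ ?_).abs_le
  · intro σ hσ
    filter_upwards [hB σ ⟨hσ.1.le, hσ.2.le⟩] with z hz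
    exact hf.abs_le hz
  · intro σ _
    positivity
  · exact continuousOn_const
  · fun_prop
  · intro σ _
    simpa using ((hasDerivAt_id σ).sub_const s).const_mul (A * B ^ (p - 1))
  · simp

theorem intervalIntegrable_source (hf : HasGrowth f p A) (hy : IsSolution f T y₀ y) {s t : ℝ}
    (hs : 0 < s) (hst : s < t) (ht : t < T) (x : Rn n) :
    IntervalIntegrable (fun σ => heat (t - σ) (fun z => f (y σ z)) x) volume s t := by
  obtain ⟨B, hB0, hB⟩ := hy.exists_bound hs ht
  obtain ⟨g, hg, hgy⟩ := hf.exists_comp_ae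
    (hy.continuousOn.mono (Icc_subset_Icc hs.le ht.le)) hB0.le hB
  rw [intervalIntegrable_iff_integrableOn_Ioo_of_le hst.le]
  have hc : ContinuousOn (fun σ => heat (t - σ) (g σ) x) (Ioo s t) :=
    continuousOn_heat (h := fun σ => t - σ) (v := g) (x := fun _ => x) (by fun_prop)
      (fun σ hσ => sub_pos.2 hσ.2) (hg.mono Ioo_subset_Icc_self) continuousOn_const
  have hA := hf.pos
  refine IntegrableOn.of_bound (C := A * B ^ (p - 1) * B) (by simp) ?_ ?_
  · refine (hc.congr fun σ hσ => ?_).aestronglyMeasurable measurableSet_Ioo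
    exact heat_congr_ae (hgy σ (Ioo_subset_Icc_self hσ)).symm x
  · refine ae_restrict_of_forall_mem measurableSet_Ioo fun σ hσ => ?_
    refine heat_le_of_le (sub_pos.2 hσ.2) ?_ x
    filter_upwards [hB σ (Ioo_subset_Icc_self hσ)] with z hz
    refine (hf.abs_le hz).trans ?_
    gcongr

end IsSolution

theorem heat_sub {n : ℕ} {h : ℝ} (hh : 0 < h) (v w : L2 n) (x : Rn n) :
    heat h (v - w : L2 n) x = heat h v x - heat h w x := by
  rw [heat_eq_inner hh, heat_eq_inner hh, heat_eq_inner hh, inner_sub_right]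

/-- The difference of two bounded solutions is dominated by the heat flow. -/
theorem IsSolution.isDominated_sub {n : ℕ} {f : ℝ → ℝ} {p A T : ℝ} {y₁₀ y₂₀ : L2 n}
    {y₁ y₂ : ℝ → L2 n} (hf : HasGrowth f p A) (h₁ : IsSolution f T y₁₀ y₁)
    (h₂ : IsSolution f T y₂₀ y₂) {a B : ℝ} (ha : 0 < a) (hB0 : 0 ≤ B)
    (hB₁ : ∀ σ, a ≤ σ → σ < T → ∀ᵐ z, |y₁ σ z| ≤ B)
    (hB₂ : ∀ σ, a ≤ σ → σ < T → ∀ᵐ z, |y₂ σ z| ≤ B) :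
    IsDominated (y₁ - y₂) (2 * A * B ^ (p - 1)) a T := by
  have hA := hf.pos
  refine IsDominated.of_forall_lt ((h₁.continuousOn.sub h₂.continuousOn).mono
    (Icc_subset_Icc ha.le le_rfl)) fun c hc s t has hst htc => ?_
  have hs : 0 < s := ha.trans_le has
  have htT : t < T := htc.trans_lt hc
  have hsub : Icc s t ⊆ Icc 0 T := Icc_subset_Icc hs.le htT.le
  refine IsDuhamel.dominated (F := fun σ z => f (y₁ σ z) - f (y₂ σ z))
    (m := fun _ => 2 * A * B ^ (p - 1)) (I := fun τ => 2 * A * B ^ (p - 1) * (τ - s))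
    ⟨hst, (h₁.continuousOn.sub h₂.continuousOn).mono hsub, ⟨2 * B, fun σ hσ => ?_⟩,
      fun τ hτ => ?_, fun σ hσ => ?_, fun _ _ => by positivity, continuousOn_const, by fun_prop,
      fun σ _ => ?_, by simp⟩
  · filter_upwards [hB₁ σ (has.trans hσ.1) (hσ.2.trans_lt htT),
      hB₂ σ (has.trans hσ.1) (hσ.2.trans_lt htT), Lp.coeFn_sub (y₁ σ) (y₂ σ)] with z h1 h2 h3
    rw [Pi.sub_apply, h3, Pi.sub_apply]
    have := abs_sub (y₁ σ z) (y₂ σ z)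
    linarith
  · have hτT : τ < T := hτ.2.trans_lt htT
    filter_upwards [h₁.duhamel s τ hs hτ.1 hτT, h₂.duhamel s τ hs hτ.1 hτT,
      Lp.coeFn_sub (y₁ τ) (y₂ τ)] with x h1 h2 h3
    have e1 : y₁ τ x = heat (τ - s) (y₁ s) x -
      ∫ σ in s..τ, heat (τ - σ) (fun z => f (y₁ σ z)) x := h1
    have e2 : y₂ τ x = heat (τ - s) (y₂ s) x -
      ∫ σ in s..τ, heat (τ - σ) (fun z => f (y₂ σ z)) x := h2
    have e3 : ∫ σ in s..τ, heat (τ - σ) (fun z => f (y₁ σ z) - f (y₂ σ z)) x =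
        (∫ σ in s..τ, heat (τ - σ) (fun z => f (y₁ σ z)) x) -
        ∫ σ in s..τ, heat (τ - σ) (fun z => f (y₂ σ z)) x := by
      rw [← intervalIntegral.integral_sub (h₁.intervalIntegrable_source hf hs hτ.1 hτT x)
        (h₂.intervalIntegrable_source hf hs hτ.1 hτT x)]
      rw [intervalIntegral.integral_of_le hτ.1.le, intervalIntegral.integral_of_le hτ.1.le,
        integral_Ioc_eq_integral_Ioo, integral_Ioc_eq_integral_Ioo]
      refine setIntegral_congr_fun measurableSet_Ioo fun σ hσ => ?_
      have hpos : 0 < τ - σ := sub_pos.2 hσ.2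
      -- `heat_sub` splits differences of `L²` functions, so both sources are first represented in
      -- `L²`.
      have hcomp : ∀ {y₀ : L2 n} {y : ℝ → L2 n} (_ : IsSolution f T y₀ y),
          ∃ g : L2 n, g =ᵐ[volume] fun z => f (y σ z) := by
        intro y₀ y hy
        obtain ⟨B', hB'0, hB'⟩ := hy.exists_bound hs hτT
        obtain ⟨g, -, hg⟩ := hf.exists_comp_ae
          (hy.continuousOn.mono (Icc_subset_Icc hs.le hτT.le)) hB'0.le hB'
        exact ⟨g σ, hg σ (Ioo_subset_Icc_self hσ)⟩
      obtain ⟨g₁, hg₁⟩ := hcomp h₁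
      obtain ⟨g₂, hg₂⟩ := hcomp h₂
      have e4 : (fun z => f (y₁ σ z) - f (y₂ σ z)) =ᵐ[volume] (g₁ - g₂ : L2 n) := by
        filter_upwards [hg₁, hg₂, Lp.coeFn_sub g₁ g₂] with z k1 k2 k3
        rw [k3, Pi.sub_apply, k1, k2]
      rw [heat_congr_ae e4, heat_sub hpos, heat_congr_ae hg₁, heat_congr_ae hg₂]
    rw [Pi.sub_apply, Pi.sub_apply, h3, Pi.sub_apply, heat_sub (sub_pos.2 hτ.1), e3, e1, e2]
    ring
  · filter_upwards [hB₁ σ (has.trans hσ.1.le) (hσ.2.trans htT),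
      hB₂ σ (has.trans hσ.1.le) (hσ.2.trans htT), Lp.coeFn_sub (y₁ σ) (y₂ σ)] with z h1 h2 h3
    rw [Pi.sub_apply, h3, Pi.sub_apply]
    exact hf.abs_sub_le h1 h2
  · simpa using ((hasDerivAt_id σ).sub_const s).const_mul (2 * A * B ^ (p - 1))

/-! ### The smoothing estimate -/

/-- The slack `3/4` gained by the bootstrap pays for a short step of crude growth and for the
decrease of the weight along it. -/
theorem exists_small_step (C δ₀ N : ℝ) :
    ∃ δ : ℝ, 0 < δ ∧ Real.exp (C * δ) * (3 / 4) * (1 + δ / δ₀) ^ N ≤ 1 := by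
  have hc : ContinuousAt (fun δ : ℝ => Real.exp (C * δ) * (3 / 4) * (1 + δ / δ₀) ^ N) 0 := by
    refine ContinuousAt.mul (by fun_prop) (ContinuousAt.rpow_const (by fun_prop) (Or.inl ?_))
    simp
  have h0 : Real.exp (C * 0) * (3 / 4) * (1 + 0 / δ₀) ^ N < 1 := by norm_num
  have hev : ∀ᶠ δ in 𝓝[>] (0 : ℝ), Real.exp (C * δ) * (3 / 4) * (1 + δ / δ₀) ^ N < 1 :=
    nhdsWithin_le_nhds (hc.eventually (gt_mem_nhds h0))
  obtain ⟨δ, h1, h2⟩ := (hev.and self_mem_nhdsWithin).exists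
  exact ⟨δ, h2, h1.le⟩

namespace IsSolution

variable {n : ℕ} {f : ℝ → ℝ} {p A T : ℝ} {y₀ : L2 n} {y : ℝ → L2 n}

/-- The assumed decay bounds the potential `f(y)/y` by a multiple of `(σ - s)^{-κ}` with `κ =
n(p-1)/4 < 1`, which is integrable at `s`. This is where subcriticality enters. -/
theorem abs_le_of_decay (hf : HasGrowth f p A) (hy : IsSolution f T y₀ y) {s t B : ℝ} (hs : 0 < s)
    (hst : s < t) (ht : t < T) (hB0 : 0 < B) (hκ : (n : ℝ) / 4 * (p - 1) < 1)
    (hB : ∀ σ ∈ Ioo s t, ∀ᵐ z, |y σ z| ≤ B * (σ - s) ^ (-((n : ℝ) / 4))) :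
    ∀ᵐ x, |y t x| ≤ Real.exp (A * B ^ (p - 1) / (1 - n / 4 * (p - 1)) *
      (t - s) ^ (1 - (n : ℝ) / 4 * (p - 1))) * heat (t - s) (fun z => |y s z|) x := by
  have hA := hf.pos
  set κ := (n : ℝ) / 4 * (p - 1) with hκdef
  refine (hy.isDuhamel hs hst ht (m := fun σ => A * B ^ (p - 1) * (σ - s) ^ (-κ))
    (I := fun τ => A * B ^ (p - 1) / (1 - κ) * (τ - s) ^ (1 - κ)) ?_ ?_ ?_ ?_ ?_ ?_).abs_le
  · intro σ hσ
    have hσs : 0 < σ - s := sub_pos.2 hσ.1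
    filter_upwards [hB σ hσ] with z hz
    refine (hf.abs_le hz).trans_eq ?_
    rw [Real.mul_rpow hB0.le (by positivity), ← Real.rpow_mul hσs.le, hκdef, neg_mul]
    ring
  · intro σ hσ
    have hσs : 0 < σ - s := sub_pos.2 hσ.1
    positivity
  · refine continuousOn_const.mul (ContinuousOn.rpow_const (by fun_prop) fun σ hσ => ?_)
    exact Or.inl (sub_pos.2 hσ.1).ne'
  · refine continuousOn_const.mul (ContinuousOn.rpow_const (by fun_prop) fun σ hσ => ?_)
    exact Or.inr (by linarith)
  · intro σ hσ
    have hσs : 0 < σ - s := sub_pos.2 hσ.1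
    have h1 := (((hasDerivAt_id σ).sub_const s).rpow_const (p := 1 - κ)
      (Or.inl hσs.ne')).const_mul (A * B ^ (p - 1) / (1 - κ))
    refine h1.congr_deriv ?_
    have : 1 - κ ≠ 0 := by linarith
    simp only [id]
    rw [show 1 - κ - 1 = -κ by ring]
    field_simp
  · simp only [sub_self]
    rw [Real.zero_rpow (by linarith), mul_zero]

/-- The bootstrap step. Over a short time the Gronwall factor is at most `3/2`, and `B` is twice the
smoothing constant of the heat flow times `K`, so the assumed decay returns with the smaller
constant `(3/4) B`. -/
theorem abs_le_of_small (hf : HasGrowth f p A) (hy : IsSolution f T y₀ y) {s b B Ts K : ℝ}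
    (hs : 0 < s) (hbT : b < T) (hK : 0 < K) (hκ : (n : ℝ) / 4 * (p - 1) < 1)
    (hBK : B = 2 * (8 * Real.pi) ^ (-((n : ℝ) / 4)) * K)
    (hTs : A * B ^ (p - 1) / (1 - n / 4 * (p - 1)) * Ts ^ (1 - (n : ℝ) / 4 * (p - 1)) ≤
      Real.log (3 / 2)) (hbs : b - s ≤ Ts) (hyK : ‖y s‖ ≤ K) {t : ℝ} (hst : s < t) (htb : t ≤ b)
    (hB : ∀ σ ∈ Ioo s t, ∀ᵐ z, |y σ z| ≤ B * (σ - s) ^ (-((n : ℝ) / 4))) :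
    (∀ᵐ x, |y t x| ≤ 3 / 2 * heat (t - s) (fun z => |y s z|) x) ∧
      ∀ᵐ x, |y t x| ≤ 3 / 4 * (B * (t - s) ^ (-((n : ℝ) / 4))) := by
  have hA := hf.pos
  have hB0 : 0 < B := by rw [hBK]; positivity
  have hts : 0 < t - s := sub_pos.2 hst
  have h1 := hy.abs_le_of_decay hf hs hst (htb.trans_lt hbT) hB0 hκ hB
  have hexp : Real.exp (A * B ^ (p - 1) / (1 - n / 4 * (p - 1)) *
      (t - s) ^ (1 - (n : ℝ) / 4 * (p - 1))) ≤ 3 / 2 := by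
    rw [← Real.exp_log (by norm_num : (0 : ℝ) < 3 / 2), Real.exp_le_exp]
    refine le_trans (mul_le_mul_of_nonneg_left ?_ ?_) hTs
    · exact Real.rpow_le_rpow hts.le (by linarith) (by linarith)
    · have : 0 < 1 - (n : ℝ) / 4 * (p - 1) := by linarith
      positivity
  have h2 : ∀ᵐ x, |y t x| ≤ 3 / 2 * heat (t - s) (fun z => |y s z|) x := by
    filter_upwards [h1] with x hx
    refine hx.trans (mul_le_mul_of_nonneg_right hexp ?_)
    exact heat_nonneg hts (.of_forall fun z => abs_nonneg _) x
  refine ⟨h2, ?_⟩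
  filter_upwards [h2] with x hx
  refine hx.trans ?_
  have h3 := abs_heat_le hts (|y s| : L2 n) x
  rw [heat_abs, norm_abs_eq_norm] at h3
  have h4 : (8 * Real.pi * (t - s)) ^ (-(n : ℝ) / 4) =
      (8 * Real.pi) ^ (-((n : ℝ) / 4)) * (t - s) ^ (-((n : ℝ) / 4)) := by
    rw [Real.mul_rpow (by positivity) hts.le, neg_div]
  rw [h4] at h3
  have h5 := (le_abs_self _).trans (h3.trans (mul_le_mul_of_nonneg_left hyK (by positivity)))
  rw [hBK]
  linarith

/-- A continuity argument in discrete steps, because `y` is not known to be continuous into `L^∞`.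
The step `δ` depends on the solution through its local bound `M₀`, but the resulting decay does not.
-/
theorem decay_of_small (hn : 0 < n) (hf : HasGrowth f p A) (hy : IsSolution f T y₀ y)
    {s b B Ts K : ℝ} (hs : 0 < s) (hbT : b < T) (hK : 0 < K)
    (hκ : (n : ℝ) / 4 * (p - 1) < 1) (hBK : B = 2 * (8 * Real.pi) ^ (-((n : ℝ) / 4)) * K)
    (hTs : A * B ^ (p - 1) / (1 - n / 4 * (p - 1)) * Ts ^ (1 - (n : ℝ) / 4 * (p - 1)) ≤
      Real.log (3 / 2)) (hbs : b - s ≤ Ts) (hyK : ‖y s‖ ≤ K) :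
    ∀ σ ∈ Ioc s b, ∀ᵐ z, |y σ z| ≤ B * (σ - s) ^ (-((n : ℝ) / 4)) := by
  have hA := hf.pos
  have hB0 : 0 < B := by rw [hBK]; positivity
  have hn' : (0 : ℝ) < n := by exact_mod_cast hn
  obtain ⟨M₀, hM₀, hbd⟩ := hy.exists_bound hs hbT
  -- Up to time `δ₀` after `s` the weight `B (σ - s)^{-n/4}` is at least `M₀`, so the induction
  -- starts for free.
  set δ₀ := (B / M₀) ^ (4 / (n : ℝ)) with hδ₀
  have hδ₀pos : 0 < δ₀ := by positivity
  have hδ₀eq : δ₀ ^ ((n : ℝ) / 4) = B / M₀ := by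
    rw [hδ₀, ← Real.rpow_mul (by positivity), show 4 / (n : ℝ) * (n / 4) = 1 by field_simp,
      Real.rpow_one]
  obtain ⟨δ, hδ, hδ1⟩ := exists_small_step (A * M₀ ^ (p - 1)) δ₀ ((n : ℝ) / 4)
  have main : ∀ k : ℕ, ∀ σ ∈ Ioc s (min b (s + δ₀ + k * δ)),
      ∀ᵐ z, |y σ z| ≤ B * (σ - s) ^ (-((n : ℝ) / 4)) := by
    intro k
    induction k with
    | zero =>
      intro σ hσ
      have hσb := hσ.2.trans (min_le_left _ _)
      have hσδ : σ - s ≤ δ₀ := by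
        have := hσ.2.trans (min_le_right _ _)
        push_cast at this
        linarith
      have hσs : 0 < σ - s := sub_pos.2 hσ.1
      filter_upwards [hbd σ ⟨hσ.1.le, hσb⟩] with z hz
      refine hz.trans ?_
      rw [Real.rpow_neg hσs.le, ← div_eq_mul_inv, le_div_iff₀ (by positivity)]
      calc M₀ * (σ - s) ^ ((n : ℝ) / 4) ≤ M₀ * δ₀ ^ ((n : ℝ) / 4) := by gcongr
        _ = B := by rw [hδ₀eq]; field_simp
    | succ k ih =>
      intro σ hσ
      set t := s + δ₀ + k * δ with ht
      rcases le_or_gt σ (min b t) with hle | hgt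
      · exact ih σ ⟨hσ.1, hle⟩
      have hσb := hσ.2.trans (min_le_left _ _)
      have htσ : t < σ := by
        rcases min_lt_iff.1 hgt with h | h
        · linarith
        · exact h
      have hσt : σ ≤ t + δ := by
        have := hσ.2.trans (min_le_right _ _)
        push_cast at this
        linarith
      have htb : t ≤ b := htσ.le.trans hσb
      have hkδ : 0 ≤ k * δ := by positivity
      have hst : s < t := by linarith
      rw [min_eq_right htb] at ih
      have hyt := (hy.abs_le_of_small hf hs hbT hK hκ hBK hTs hbs hyK hst htb
        fun σ' hσ' => ih σ' ⟨hσ'.1, hσ'.2.le⟩).2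
      have hstep := hy.abs_le_of_bound hf (hs.trans hst) htσ (hσb.trans_lt hbT) hM₀.le
        fun σ' hσ' => hbd σ' ⟨hst.le.trans hσ'.1, hσ'.2.trans hσb⟩
      have hts : 0 < t - s := sub_pos.2 hst
      have hσs : 0 < σ - s := by linarith
      filter_upwards [hstep] with x hx
      have h1 : heat (σ - t) (fun z => |y t z|) x ≤ 3 / 4 * (B * (t - s) ^ (-((n : ℝ) / 4))) := by
        refine (le_abs_self _).trans (heat_le_of_le (sub_pos.2 htσ) ?_ x)
        filter_upwards [hyt] with z hz
        rwa [abs_abs]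
      have h2 : Real.exp (A * M₀ ^ (p - 1) * (σ - t)) ≤ Real.exp (A * M₀ ^ (p - 1) * δ) := by
        gcongr
        linarith
      have h3 : (t - s) ^ (-((n : ℝ) / 4)) ≤
          (1 + δ / δ₀) ^ ((n : ℝ) / 4) * (σ - s) ^ (-((n : ℝ) / 4)) := by
        have h4 : σ - s ≤ (1 + δ / δ₀) * (t - s) := by
          have h5 : δ ≤ δ / δ₀ * (t - s) := by
            rw [div_mul_eq_mul_div, le_div_iff₀ hδ₀pos]
            gcongr
            linarith
          linarith
        rw [Real.rpow_neg hts.le, Real.rpow_neg hσs.le, ← div_eq_mul_inv,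
          le_div_iff₀ (by positivity), inv_mul_le_iff₀ (by positivity), mul_comm,
          ← Real.mul_rpow (by positivity) hts.le]
        exact Real.rpow_le_rpow hσs.le h4 (by positivity)
      calc |y σ x| ≤ _ := hx
        _ ≤ Real.exp (A * M₀ ^ (p - 1) * δ) * (3 / 4 * (B * ((1 + δ / δ₀) ^ ((n : ℝ) / 4) *
              (σ - s) ^ (-((n : ℝ) / 4))))) := by
            refine mul_le_mul h2 (h1.trans ?_) ?_ (by positivity)
            · gcongr
            · exact heat_nonneg (sub_pos.2 htσ) (.of_forall fun z => abs_nonneg _) x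
        _ = (Real.exp (A * M₀ ^ (p - 1) * δ) * (3 / 4) * (1 + δ / δ₀) ^ ((n : ℝ) / 4)) *
              (B * (σ - s) ^ (-((n : ℝ) / 4))) := by ring
        _ ≤ 1 * (B * (σ - s) ^ (-((n : ℝ) / 4))) := by gcongr
        _ = _ := one_mul _
  obtain ⟨k, hk⟩ := exists_nat_gt ((b - s) / δ)
  rw [div_lt_iff₀ hδ] at hk
  have := main k
  rwa [min_eq_left (by linarith)] at this

end IsSolution

/-- Over a short time that depends on the size of `y(s)` only, `y` decays in `L^∞` like a solution
of the heat equation, and its norm in `L²` stays bounded. -/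
theorem exists_smoothing {n : ℕ} (hn : 0 < n) {f : ℝ → ℝ} {p A : ℝ} (hf : HasGrowth f p A)
    (hp : p < 1 + 4 / (n : ℝ)) {K : ℝ} (hK : 0 < K) :
    ∃ Ts B : ℝ, 0 < Ts ∧ 0 < B ∧ ∀ (T : ℝ) (y₀ : L2 n) (y : ℝ → L2 n), IsSolution f T y₀ y →
      ∀ s t : ℝ, 0 < s → s < t → t < T → t - s ≤ Ts → ‖y s‖ ≤ K →
        (∀ᵐ x, |y t x| ≤ B * (t - s) ^ (-((n : ℝ) / 4))) ∧ ‖y t‖ ≤ 3 / 2 * K := by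
  have hA := hf.pos
  have hn' : (0 : ℝ) < n := by exact_mod_cast hn
  have hκ : (n : ℝ) / 4 * (p - 1) < 1 := by
    have h1 : p - 1 < 4 / n := by linarith
    calc (n : ℝ) / 4 * (p - 1) < n / 4 * (4 / n) := by gcongr
      _ = 1 := by field_simp
  obtain ⟨B, hBK⟩ : ∃ B : ℝ, B = 2 * (8 * Real.pi) ^ (-((n : ℝ) / 4)) * K := ⟨_, rfl⟩
  have hB0 : 0 < B := by rw [hBK]; positivity
  have hγ : 0 < 1 - (n : ℝ) / 4 * (p - 1) := by linarith
  obtain ⟨Ts, hTs0, hTs⟩ : ∃ Ts : ℝ, 0 < Ts ∧ A * B ^ (p - 1) / (1 - n / 4 * (p - 1)) *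
      Ts ^ (1 - (n : ℝ) / 4 * (p - 1)) ≤ Real.log (3 / 2) := by
    have hlog : 0 < Real.log (3 / 2) := Real.log_pos (by norm_num)
    set D := A * B ^ (p - 1) / (1 - n / 4 * (p - 1)) with hD
    have hDpos : 0 < D := by positivity
    refine ⟨(Real.log (3 / 2) / D) ^ (1 / (1 - (n : ℝ) / 4 * (p - 1))), by positivity, ?_⟩
    rw [← Real.rpow_mul (by positivity), one_div_mul_cancel hγ.ne', Real.rpow_one]
    exact (mul_div_cancel₀ _ hDpos.ne').le
  refine ⟨Ts, B, hTs0, hB0, fun T y₀ y hy s t hs hst htT hts hyK => ?_⟩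
  have hdec := hy.decay_of_small hn hf hs htT hK hκ hBK hTs hts hyK
  refine ⟨hdec t (right_mem_Ioc.2 hst), ?_⟩
  have h1 := (hy.abs_le_of_small hf hs htT hK hκ hBK hTs hts hyK hst le_rfl
    fun σ hσ => hdec σ ⟨hσ.1, hσ.2.le⟩).1
  have hpos : 0 < t - s := sub_pos.2 hst
  have h2 : ‖y t‖ ≤ 3 / 2 * ‖(isSchurKernel_heatKernel hpos).op |y s|‖ := by
    refine Lp.norm_le_mul_norm_of_ae_le_mul ?_
    filter_upwards [h1, heatOp_ae hpos |y s|] with x hx hx'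
    rw [hx', heat_abs, Real.norm_eq_abs, Real.norm_eq_abs]
    exact hx.trans (mul_le_mul_of_nonneg_left (le_abs_self _) (by norm_num))
  have h3 := (isSchurKernel_heatKernel hpos).norm_op_le |y s|
  rw [norm_abs_eq_norm] at h3
  linarith

/-! ### Observation regions -/

theorem IsOpenCube.dist_le {n : ℕ} {L : ℝ} (hL : 0 < L) {I : Set (Rn n)} (hI : IsOpenCube L I)
    {x y : Rn n} (hx : x ∈ I) (hy : y ∈ I) : ‖x - y‖ ≤ (n + 1) * L := by
  obtain ⟨c, b, rfl⟩ := hI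
  have h1 : ‖x - y‖ ^ 2 ≤ n * L ^ 2 := by
    rw [← b.sum_sq_norm_inner_right (x - y)]
    calc _ ≤ ∑ _i : Fin n, L ^ 2 := by
          refine Finset.sum_le_sum fun i _ => ?_
          have e : inner ℝ (b i) (x - y) = inner ℝ (b i) (x - c) - inner ℝ (b i) (y - c) := by
            rw [← inner_sub_right]
            congr 1
            abel
          rw [Real.norm_eq_abs]
          refine pow_le_pow_left₀ (abs_nonneg _) ?_ 2
          have h2 := abs_sub (inner ℝ (b i) (x - c)) (inner ℝ (b i) (y - c))
          rw [e]
          have h3 := hx i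
          have h4 := hy i
          linarith
      _ = n * L ^ 2 := by simp
  have hn : (0 : ℝ) ≤ n := Nat.cast_nonneg n
  refine abs_le_of_sq_le_sq (h1.trans ?_) (by positivity) |> le_of_abs_le
  rw [mul_pow]
  gcongr
  nlinarith

/-- The union of the cubes is dense, so every point is within `L` of some cube, whose diameter is at
most `(n + 1) L`. -/
theorem IsObservationRegion.exists_points {n : ℕ} {ω : Set (Rn n)} {L r : ℝ}
    (h : IsObservationRegion ω L r) : ∃ p : ℕ → Rn n,
      Pairwise (Function.onFun Disjoint fun j => Metric.ball (p j) r) ∧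
      (∀ j, Metric.ball (p j) r ⊆ ω) ∧ (⋃ j, Metric.ball (p j) ((n + 2) * L)) = univ := by
  obtain ⟨I, hcube, hdisj, hcl, hball⟩ := h.exists_cubes
  choose p hpI hp using hball
  refine ⟨p, fun j k hjk => ?_, fun j => (hp j).trans inter_subset_right, ?_⟩
  · refine Disjoint.mono ((hp j).trans inter_subset_left) ((hp k).trans inter_subset_left) ?_
    exact disjoint_iff_inter_eq_empty.2 (hdisj j k hjk)
  · refine eq_univ_of_forall fun x => ?_
    have hx : x ∈ closure (⋃ j, I j) := by rw [hcl]; trivial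
    obtain ⟨z, hz, hxz⟩ := Metric.mem_closure_iff.1 hx L h.side_pos
    obtain ⟨j, hj⟩ := mem_iUnion.1 hz
    refine mem_iUnion.2 ⟨j, ?_⟩
    have h1 := (hcube j).dist_le h.side_pos hj (hpI j)
    rw [← dist_eq_norm] at h1
    rw [Metric.mem_ball]
    have h2 := dist_triangle x z (p j)
    linarith

/-! ### The estimate for two solutions -/

/-- Smoothing is restarted a fixed time `τ` before `t`; taking `τ ≤ a / 2` keeps the starting time
positive. -/
theorem exists_sup_bound {n : ℕ} (hn : 0 < n) {f : ℝ → ℝ} {p A : ℝ} (hf : HasGrowth f p A)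
    (hp : p < 1 + 4 / (n : ℝ)) {K a : ℝ} (hK : 0 < K) (ha : 0 < a) :
    ∃ B : ℝ, 0 ≤ B ∧ ∀ (T : ℝ) (y₀ : L2 n) (y : ℝ → L2 n), IsSolution f T y₀ y →
      (∀ t ∈ Icc 0 T, ‖y t‖ ≤ K) → ∀ t, a ≤ t → t < T → ∀ᵐ x, |y t x| ≤ B := by
  obtain ⟨Ts, B, hTs, hB, h⟩ := exists_smoothing hn hf hp hK
  set τ := min Ts (a / 2) with hτ
  have hτ0 : 0 < τ := by positivity
  have hτTs : τ ≤ Ts := min_le_left _ _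
  have hτa : τ ≤ a / 2 := min_le_right _ _
  refine ⟨B * τ ^ (-((n : ℝ) / 4)), by positivity, fun T y₀ y hy hyK t hat htT => ?_⟩
  have := (h T y₀ y hy (t - τ) t (by linarith) (by linarith) htT (by linarith)
    (hyK _ ⟨by linarith, by linarith⟩)).1
  rwa [sub_sub_cancel] at this

theorem integral_abs_sub_sq {n : ℕ} (v w : L2 n) (s : Set (Rn n)) :
    ∫ x in s, |v x - w x| ^ 2 = ∫ x in s, (v - w : L2 n) x ^ 2 := by
  refine integral_congr_ae (ae_restrict_of_ae ?_)
  filter_upwards [Lp.coeFn_sub v w] with x hx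
  rw [hx, Pi.sub_apply, sq_abs]

/-- The first half of the interval is spent on smoothing, and `global_estimate` is applied on the
second half. -/
theorem exists_interpolation {n : ℕ} (hn : 0 < n) {f : ℝ → ℝ} {p A : ℝ} (hf : HasGrowth f p A)
    (hp : p < 1 + 4 / (n : ℝ)) (L r K T : ℝ) :
    ∃ C : ℝ, 0 < C ∧ (0 < T → ∀ ω : Set (Rn n), IsObservationRegion ω L r →
      ∀ (y₁₀ y₂₀ : L2 n) (y₁ y₂ : ℝ → L2 n), IsSolution f T y₁₀ y₁ → IsSolution f T y₂₀ y₂ →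
      (∀ t ∈ Icc 0 T, ‖y₁ t‖ ≤ K ∧ ‖y₂ t‖ ≤ K) →
      ∫ x, |y₁ T x - y₂ T x| ^ 2 ≤ C * (∫ x in ω, |y₁ T x - y₂ T x| ^ 2) ^ (1 / 2 : ℝ)) := by
  by_cases hpar : 0 < T ∧ 0 < L ∧ 0 < r
  swap
  -- The constant has to exist for all real parameters; if one of `T`, `L`, `r` is not positive,
  -- nothing is claimed.
  · exact ⟨1, one_pos, fun hT ω hω => absurd ⟨hT, hω.side_pos, hω.radius_pos⟩ hpar⟩
  obtain ⟨hT, hL, hr⟩ := hpar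
  have hA := hf.pos
  have hK' : 0 < |K| + 1 := by positivity
  obtain ⟨B, hB0, hB⟩ := exists_sup_bound hn hf hp hK' (half_pos hT)
  obtain ⟨C, hC, hglob⟩ := IsDominated.global_estimate n hr (R := (n + 2) * L) (by positivity)
    (half_pos hT) (M := 2 * A * B ^ (p - 1)) (by positivity)
  refine ⟨√(C * (8 * (|K| + 1) ^ 2)), by positivity, fun _ ω hω y₁₀ y₂₀ y₁ y₂ h₁ h₂ hyK => ?_⟩
  have hKle : K ≤ |K| + 1 := by have := le_abs_self K; linarith
  have hn₁ : ∀ t ∈ Icc 0 T, ‖y₁ t‖ ≤ |K| + 1 := fun t ht => (hyK t ht).1.trans hKle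
  have hn₂ : ∀ t ∈ Icc 0 T, ‖y₂ t‖ ≤ |K| + 1 := fun t ht => (hyK t ht).2.trans hKle
  have hdom := h₁.isDominated_sub hf h₂ (half_pos hT) hB0 (hB T y₁₀ y₁ h₁ hn₁) (hB T y₂₀ y₂ h₂ hn₂)
  obtain ⟨q, hq1, hq2, hq3⟩ := hω.exists_points
  have hest := hglob (y₁ - y₂) (T / 2) T (by ring) hdom ω q hq1 hq2 hq3
  have hsub : ∀ t ∈ Icc 0 T, ‖(y₁ - y₂) t‖ ^ 2 ≤ 4 * (|K| + 1) ^ 2 := fun t ht => by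
    have h3 : ‖(y₁ - y₂) t‖ ≤ 2 * (|K| + 1) := by
      refine (norm_sub_le _ _).trans ?_
      linarith [hn₁ t ht, hn₂ t ht]
    calc ‖(y₁ - y₂) t‖ ^ 2 ≤ (2 * (|K| + 1)) ^ 2 := by gcongr
      _ = _ := by ring
  have hl : ∫ x, |y₁ T x - y₂ T x| ^ 2 = ‖(y₁ - y₂) T‖ ^ 2 := by
    have := integral_abs_sub_sq (y₁ T) (y₂ T) univ
    rw [setIntegral_univ, setIntegral_univ] at this
    rw [this, L2.norm_sq_eq]
    rfl
  have hr' : ∫ x in ω, |y₁ T x - y₂ T x| ^ 2 = ∫ x in ω, (y₁ - y₂) T x ^ 2 :=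
    integral_abs_sub_sq (y₁ T) (y₂ T) ω
  rw [hl, hr', ← Real.sqrt_eq_rpow, ← Real.sqrt_mul (by positivity)]
  refine Real.le_sqrt_of_sq_le (hest.trans ?_)
  have hX : 0 ≤ ∫ x in ω, (y₁ - y₂) T x ^ 2 := integral_nonneg fun _ => sq_nonneg _
  have h4 := hsub (T / 2) ⟨by linarith, by linarith⟩
  have h5 := hsub T ⟨hT.le, le_rfl⟩
  calc _ ≤ C * (∫ x in ω, (y₁ - y₂) T x ^ 2) * (4 * (|K| + 1) ^ 2 + 4 * (|K| + 1) ^ 2) := by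
        gcongr
    _ = _ := by ring

theorem norm_le_of_forall_Ioo {n : ℕ} {y : ℝ → L2 n} {T K : ℝ} (hT : 0 < T)
    (hy : ContinuousOn y (Icc 0 T)) (h : ∀ t ∈ Ioo 0 T, ‖y t‖ ≤ K) : ∀ t ∈ Icc 0 T, ‖y t‖ ≤ K := by
  have hcl : closure (Ioo 0 T) = Icc 0 T := closure_Ioo hT.ne
  intro t ht
  refine le_on_closure (f := fun t => ‖y t‖) (g := fun _ => K) h ?_ continuousOn_const ?_
  · rw [hcl]
    exact hy.norm
  · rwa [hcl]

/-- Duhamel's formula starts only at positive times. By continuity at `0` the norm is still below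
`|K| + 1` at some small `s > 0`, and the smoothing estimate runs from there. -/
theorem exists_norm_bound {n : ℕ} (hn : 0 < n) {f : ℝ → ℝ} {p A : ℝ} (hf : HasGrowth f p A)
    (hp : p < 1 + 4 / (n : ℝ)) (K : ℝ) :
    ∃ Ts : ℝ, 0 < Ts ∧ ∀ (T : ℝ) (y₀ : L2 n) (y : ℝ → L2 n), 0 < T → T ≤ Ts →
      IsSolution f T y₀ y → ‖y₀‖ ≤ K → ∀ t ∈ Icc 0 T, ‖y t‖ ≤ 3 / 2 * (|K| + 1) := by
  obtain ⟨Ts, B, hTs, -, h⟩ := exists_smoothing hn hf hp (K := |K| + 1) (by positivity)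
  refine ⟨Ts, hTs, fun T y₀ y hT hTTs hy hK => ?_⟩
  refine norm_le_of_forall_Ioo hT hy.continuousOn fun t ht => ?_
  have hlt : ‖y 0‖ < |K| + 1 := by
    rw [hy.initial]
    have := le_abs_self K
    linarith
  have hc : Tendsto (fun s => ‖y s‖) (𝓝[>] 0) (𝓝 ‖y 0‖) := by
    have h0 := (hy.continuousOn 0 (left_mem_Icc.2 hT.le)).norm.tendsto
    refine h0.mono_left ?_
    rw [← nhdsWithin_Ioo_eq_nhdsGT hT]
    exact nhdsWithin_mono _ Ioo_subset_Icc_self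
  obtain ⟨s, hs1, hs2⟩ := ((hc.eventually (gt_mem_nhds hlt)).and (Ioo_mem_nhdsGT ht.1)).exists
  exact (h T y₀ y hy s t hs2.1 hs2.2 ht.2 (by linarith [hs2.1, ht.2]) hs1.le).2

/-- The bound on the potential degenerates at time `0`, so backward uniqueness is applied on `[t,
T]` for each `t` in `(0, T)`; continuity covers the end points. -/
theorem eq_of_eq_final {n : ℕ} (hn : 0 < n) {f : ℝ → ℝ} {p A : ℝ} (hf : HasGrowth f p A)
    (hp : p < 1 + 4 / (n : ℝ)) {T K : ℝ} (hT : 0 < T) {y₁₀ y₂₀ : L2 n} {y₁ y₂ : ℝ → L2 n}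
    (h₁ : IsSolution f T y₁₀ y₁) (h₂ : IsSolution f T y₂₀ y₂)
    (hK : ∀ t ∈ Icc 0 T, ‖y₁ t‖ ≤ K ∧ ‖y₂ t‖ ≤ K) (hfin : y₁ T = y₂ T) :
    ∀ t ∈ Icc 0 T, y₁ t = y₂ t := by
  have hA := hf.pos
  have hKle : K ≤ |K| + 1 := by have := le_abs_self K; linarith
  have hc : ContinuousOn (y₁ - y₂) (Icc 0 T) := h₁.continuousOn.sub h₂.continuousOn
  have hIoo : ∀ t ∈ Ioo 0 T, ‖(y₁ - y₂) t‖ ≤ 0 := by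
    intro t ht
    obtain ⟨B, hB0, hB⟩ := exists_sup_bound hn hf hp (K := |K| + 1) (by positivity) ht.1
    have hdom := h₁.isDominated_sub hf h₂ ht.1 hB0
      (hB T y₁₀ y₁ h₁ fun t ht => (hK t ht).1.trans hKle)
      (hB T y₂₀ y₂ h₂ fun t ht => (hK t ht).2.trans hKle)
    have := hdom.backward_uniqueness ht.2 (by positivity)
      (hc.mono (Icc_subset_Icc ht.1.le le_rfl)) (sub_eq_zero.2 hfin)
    rw [this, norm_zero]
  intro t ht
  have := norm_le_of_forall_Ioo hT hc hIoo t ht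
  exact sub_eq_zero.1 (norm_le_zero_iff.1 this)

end SemilinearHeat

end

/-! ### Assembly of the two estimates and of unique continuation -/

theorem theorem2 (n : ℕ) (hn : 0 < n) :
    ∃ β : ℝ → ℝ → ℝ, (∀ L r : ℝ, 0 < L → 0 < r → 0 < β L r ∧ β L r < 1) ∧
    ∀ (f : ℝ → ℝ) (p : ℝ), SemilinearHeat.IsPowerNonlinearity f p → p < 1 + 4 / (n : ℝ) →
    ∃ (Tstar : ℝ → ℝ) (C C' : ℝ → ℝ → ℝ → ℝ → ℝ),
      (∀ K, 0 < Tstar K) ∧ (∀ L r K T, 0 < C L r K T) ∧ (∀ L r K T, 0 < C' L r K T) ∧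
      ∀ (ω : Set (SemilinearHeat.Rn n)) (L r : ℝ),
        SemilinearHeat.IsObservationRegion ω L r →
      ∀ (T : ℝ), 0 < T →
      ∀ (y₁₀ y₂₀ : SemilinearHeat.L2 n) (y₁ y₂ : ℝ → SemilinearHeat.L2 n),
        SemilinearHeat.IsSolution f T y₁₀ y₁ → SemilinearHeat.IsSolution f T y₂₀ y₂ →
        -- constant depending on the initial data only through the size of their norms
        (∀ K : ℝ, ‖y₁₀‖ ≤ K → ‖y₂₀‖ ≤ K → T ≤ Tstar K →
          ∫ x, |y₁ T x - y₂ T x| ^ 2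
            ≤ C L r K T * (∫ x in ω, |y₁ T x - y₂ T x| ^ 2) ^ (β L r)) ∧
        -- arbitrarily long time intervals
        (∀ K : ℝ, (∀ t ∈ Set.Icc 0 T, ‖y₁ t‖ ≤ K ∧ ‖y₂ t‖ ≤ K) →
          ∫ x, |y₁ T x - y₂ T x| ^ 2
            ≤ C' L r K T * (∫ x in ω, |y₁ T x - y₂ T x| ^ 2) ^ (β L r)) ∧
        -- unique continuation
        ((∀ᵐ x ∂(MeasureTheory.volume.restrict ω), y₁ T x = y₂ T x) →
          ∀ t ∈ Set.Icc 0 T, y₁ t = y₂ t) := by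
  refine ⟨fun _ _ => 1 / 2, fun _ _ _ _ => by norm_num, fun f p hfp hp => ?_⟩
  obtain ⟨A, hf⟩ := hfp.exists_hasGrowth
  choose C' hC'pos hC' using SemilinearHeat.exists_interpolation hn hf hp
  choose Ts hTs hbound using SemilinearHeat.exists_norm_bound hn hf hp
  -- Before `T*` the norm bound on the data persists with `3/2 * (|K| + 1)`, so the first estimate
  -- is the second one with this larger bound.
  refine ⟨Ts, fun L r K T => C' L r (3 / 2 * (|K| + 1)) T, C', hTs, fun _ _ _ _ => hC'pos _ _ _ _,
    hC'pos, fun ω L r hω T hT y₁₀ y₂₀ y₁ y₂ h₁ h₂ => ⟨?_, ?_, ?_⟩⟩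
  · intro K hK₁ hK₂ hTK
    exact hC' L r _ T hT ω hω y₁₀ y₂₀ y₁ y₂ h₁ h₂ fun t ht =>
      ⟨hbound K T y₁₀ y₁ hT hTK h₁ hK₁ t ht, hbound K T y₂₀ y₂ hT hTK h₂ hK₂ t ht⟩
  · intro K hK
    exact hC' L r K T hT ω hω y₁₀ y₂₀ y₁ y₂ h₁ h₂ hK
  · intro hae
    obtain ⟨K₁, hK₁⟩ := isCompact_Icc.exists_bound_of_continuousOn h₁.continuousOn
    obtain ⟨K₂, hK₂⟩ := isCompact_Icc.exists_bound_of_continuousOn h₂.continuousOn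
    have hK : ∀ t ∈ Set.Icc 0 T, ‖y₁ t‖ ≤ max K₁ K₂ ∧ ‖y₂ t‖ ≤ max K₁ K₂ := fun t ht =>
      ⟨(hK₁ t ht).trans (le_max_left _ _), (hK₂ t ht).trans (le_max_right _ _)⟩
    refine SemilinearHeat.eq_of_eq_final hn hf hp hT h₁ h₂ hK ?_
    have hzero : ∫ x in ω, |y₁ T x - y₂ T x| ^ 2 = 0 := by
      refine integral_eq_zero_of_ae ?_
      filter_upwards [hae] with x hx
      simp [hx]
    -- With the compactness bound in place of `K`, equality on `ω` gives equality everywhere at time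
    -- `T`, the input of `eq_of_eq_final`.
    have hle := hC' L r _ T hT ω hω y₁₀ y₂₀ y₁ y₂ h₁ h₂ hK
    rw [hzero, Real.zero_rpow (by norm_num), mul_zero] at hle
    have hnorm := SemilinearHeat.integral_abs_sub_sq (y₁ T) (y₂ T) Set.univ
    rw [setIntegral_univ, setIntegral_univ, ← SemilinearHeat.L2.norm_sq_eq] at hnorm
    rw [hnorm] at hle
    have : ‖y₁ T - y₂ T‖ = 0 := pow_eq_zero_iff two_ne_zero |>.1 (le_antisymm hle (sq_nonneg _))
    exact sub_eq_zero.1 (norm_eq_zero.1 this)
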